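/- Let $B$ be a unital algebra over a field $k$. A left $B$-bialgebroid is an algebra $\mathcal L$ with an algebra map $s:B\to\mathcal L$ and an anti-algebra map $t:B\to\mathcal L$ with commuting images (write $b=s(b)$, $\bar b=t(b)$), a coassociative counital coproduct $\Delta X=X_{(1)}\diamond_B X_{(2)}\in\mathcal L\diamond_B\mathcal L=\mathcal L\otimes\mathcal L/(\bar bX\otimes Y-X\otimes bY)$ and a counit $\varepsilon:\mathcal L\to B$, both $B$-bilinear for $a.X.b=a\bar bX$, such that $\Delta$ takes values in the Takeuchi product ($X_{(1)}\bar b\diamond X_{(2)}=X_{(1)}\diamond X_{(2)}b$) and is a unital algebra map, $\varepsilon(1)=1$ and $\varepsilon(XY)=\varepsilon(X\varepsilon(Y))=\varepsilon(X\overline{\varepsilon(Y)})$. It is a left Hopf algebroid if $\lambda:\mathcal L\otimes_{\overline B}\mathcal L\to\mathcal L\diamond_B\mathcal L$, $X\otimes Y\mapsto X_{(1)}\diamond X_{(2)}Y$, is bijective, where $\mathcal L\otimes_{\overline B}\mathcal L=\mathcal L\otimes\mathcal L/(X\bar b\otimes Y-X\otimes\bar bY)$; then $X_+\otimes_{\overline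 B}X_-:=\lambda^{-1}(X\diamond_B1)$. A dual pairing between left $B$-bialgebroids $\Lambda$ and $\mathcal L$ is a $k$-linear map $\langle\cdot|\cdot\rangle:\Lambda\otimes\mathcal L\to B$ with (1) $\langle a\bar b\alpha c\bar d|X\rangle f=a\langle\alpha|c\bar fXd\bar b\rangle$; (2) $\langle\alpha|XY\rangle=\langle\alpha_{(1)}|X\overline{\langle\alpha_{(2)}|Y\rangle}\rangle=\langle\overline{\langle\alpha_{(2)}|Y\rangle}\alpha_{(1)}|X\rangle$; (3) $\langle\alpha\beta|X\rangle=\langle\alpha\langle\beta|X_{(1)}\rangle|X_{(2)}\rangle=\langle\alpha|\langle\beta|X_{(1)}\rangle X_{(2)}\rangle$; (4) $\langle\alpha|1\rangle=\varepsilon(\alpha)$; (5) $\langle1|X\rangle=\varepsilon(X)$. An invertible left 2-cocycle in $\Lambda$ is an element $F=F^\alpha\diamond F_\alpha\in\Lambda\diamond_B\Lambda$ with $(\varepsilon\diamond\mathrm{id})F=1=(\mathrm{id}\diamond\varepsilon)F$ and $(\Delta\diamond\mathrm{id})(F)F^{12}=(\mathrm{id}\diamond\Delta)(F)F^{23}$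 in $\Lambda\diamond_B\Lambda\diamond_B\Lambda$, such that for all left $\Lambda$-modules $M,N$ the map $F^\#:M\diamond_{B^F}N\to M\diamond_BN$, $m\otimes n\mapsto F^\alpha m\diamond F_\alpha n$, is bijective, where $s^F(b)=\varepsilon(F^\alpha b)F_\alpha$, $t^F(b)=\overline{\varepsilon(F_\alpha b)}F^\alpha$ and $M\diamond_{B^F}N=M\otimes N/(t^F(b)m\otimes n-m\otimes s^F(b)n)$. Xu's twist $\Lambda^F$ has base $B^F$ (the vector space $B$ with product $a\cdot_Fb=\varepsilon(F^\alpha a)\varepsilon(F_\alpha b)$), the product, unit and counit of $\Lambda$, source $s^F$, target $t^F$, and coproduct $\Delta^F(\alpha)=(F^\#)^{-1}(\alpha_{(1)}F^\alpha\diamond\alpha_{(2)}F_\alpha)$. A left 2-cocycle on $\mathcal L$ is a bilinear $\Gamma:\mathcal L\times\mathcal L\to B$ with $\Gamma(X\bar b,Y)=\Gamma(X,\bar bY)$, $\Gamma(\bar bX,Y)=\Gamma(X,Y)b$, $\Gamma(X,\Gamma(Y_{(1)},Z_{(1)})Y_{(2)}Z_{(2)})=\Gamma(\Gamma(X_{(1)},Y_{(1)})X_{(2)}Y_{(2)},Z)$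 and $\Gamma(1,X)=\varepsilon(X)=\Gamma(X,1)$. For a left Hopf algebroid $\mathcal L$, the cotwist $\mathcal L^\Gamma$ has base $B^\Gamma$ (the vector space $B$ with product $a\cdot_\Gamma b=\Gamma(a,b)$), underlying vector space, unit, source and target maps of $\mathcal L$, product $X\cdot_\Gamma Y=\Gamma(X_{(1)},Y_{(1)})X_{(2)+}Y_{(2)+}\overline{\Gamma(Y_{(2)-},X_{(2)-})}$, counit $\varepsilon^\Gamma(X)=\Gamma(X_+,X_-)$ and coproduct $\Delta^\Gamma(X)=(\Gamma^\#)^{-1}(\Delta X)$, where $\Gamma^\#:\mathcal L^\Gamma\diamond_{B^\Gamma}\mathcal L^\Gamma\to\mathcal L\diamond_B\mathcal L$, $X\otimes Y\mapsto X_+\overline{\Gamma(X_-,Y_{(1)})}\diamond Y_{(2)}$, provided that $\Gamma^\#$ is well defined and bijective. Theorem. Let $\langle\cdot|\cdot\rangle$ be a dual pairing between left $B$-bialgebroids $\Lambda$ and $\mathcal L$, let $\mathcal L$ be a left Hopf algebroid, let $F$ be an invertible left 2-cocycle in $\Lambda$, and put $\Gamma_F(X,Y)=\langle F^\alpha|X\overline{\langle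 F_\alpha|Y\rangle}\rangle$. Then $\Gamma_F$ is a left 2-cocycle on $\mathcal L$, $\Gamma_F^\#$ is well defined and bijective, $B^F=B^{\Gamma_F}$ as algebras, $\Lambda^F$ and $\mathcal L^{\Gamma_F}$ are left bialgebroids over this algebra, and $$[\alpha|X]=\langle F^\alpha\alpha\,|\,X_+\overline{\langle F_\alpha|X_-\rangle}\rangle,\qquad\alpha\in\Lambda,\ X\in\mathcal L,$$ is a dual pairing between $\Lambda^F$ and $\mathcal L^{\Gamma_F}$. -/

import Mathlib

open scoped TensorProduct

universe u

namespace Bialgd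

/-! Balanced tensor products over a (noncommutative) base, as quotients of `⊗[k]`. -/

section Balanced

variable {k : Type*} [Field k] {B : Type*}
  {M : Type*} [AddCommGroup M] [Module k M] {N : Type*} [AddCommGroup N] [Module k N]
  {P : Type*} [AddCommGroup P] [Module k P] {A : Type*} [AddCommGroup A] [Module k A]

/-- The span of all `ρ b m ⊗ n - m ⊗ σ b n`. -/
def balRel (ρ : B → M →ₗ[k] M) (σ : B → N →ₗ[k] N) : Submodule k (M ⊗[k] N) :=
  Submodule.span k {z | ∃ b m n, z = ρ b m ⊗ₜ[k] n - m ⊗ₜ[k] σ b n}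

/-- `M ⊗ N` modulo `ρ b m ⊗ n = m ⊗ σ b n`. -/
def Bal (ρ : B → M →ₗ[k] M) (σ : B → N →ₗ[k] N) : Type _ := (M ⊗[k] N) ⧸ balRel ρ σ

instance (ρ : B → M →ₗ[k] M) (σ : B → N →ₗ[k] N) : AddCommGroup (Bal ρ σ) :=
  inferInstanceAs (AddCommGroup ((M ⊗[k] N) ⧸ balRel ρ σ))

instance (ρ : B → M →ₗ[k] M) (σ : B → N →ₗ[k] N) : Module k (Bal ρ σ) :=
  inferInstanceAs (Module k ((M ⊗[k] N) ⧸ balRel ρ σ))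

/-- The quotient map. -/
def Bal.proj (ρ : B → M →ₗ[k] M) (σ : B → N →ₗ[k] N) : M ⊗[k] N →ₗ[k] Bal ρ σ :=
  (balRel ρ σ).mkQ

variable (ρ : B → M →ₗ[k] M) (σ : B → N →ₗ[k] N)

/-- The class of `m ⊗ n`, as a bilinear map. -/
def Bal.mk : M →ₗ[k] N →ₗ[k] Bal ρ σ := (TensorProduct.mk k M N).compr₂ (Bal.proj ρ σ)

variable {ρ σ}

theorem Bal.mk_bal (b : B) (m : M) (n : N) : Bal.mk ρ σ (ρ b m) n = Bal.mk ρ σ m (σ b n) := by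
  refine (Submodule.Quotient.eq (balRel ρ σ)).2 (Submodule.subset_span ⟨b, m, n, rfl⟩)

/-- A bilinear map that is balanced descends to the balanced tensor product. -/
def Bal.lift (f : M →ₗ[k] N →ₗ[k] P) (h : ∀ b m n, f (ρ b m) n = f m (σ b n)) :
    Bal ρ σ →ₗ[k] P :=
  (balRel ρ σ).liftQ (TensorProduct.lift f) <| by
    refine Submodule.span_le.2 ?_
    rintro _ ⟨b, m, n, rfl⟩
    simp [h]

@[simp] theorem Bal.lift_mk (f : M →ₗ[k] N →ₗ[k] P) (h : ∀ b m n, f (ρ b m) n = f m (σ b n))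
    (m : M) (n : N) : Bal.lift f h (Bal.mk ρ σ m n) = f m n := rfl

theorem Bal.induction {p : Bal ρ σ → Prop} (z : Bal ρ σ)
    (hmk : ∀ m n, p (Bal.mk ρ σ m n)) (hadd : ∀ x y, p x → p y → p (x + y)) : p z := by
  obtain ⟨w, rfl⟩ : ∃ w, Bal.proj ρ σ w = z := Submodule.mkQ_surjective _ z
  induction w with
  | zero => simpa using hmk 0 0
  | tmul m n => exact hmk m n
  | add x y hx hy => rw [map_add]; exact hadd _ _ hx hy

/-- Descent for a linear family of balanced bilinear maps. -/
def Bal.liftFam (f : A →ₗ[k] M →ₗ[k] N →ₗ[k] P)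
    (h : ∀ a b m n, f a (ρ b m) n = f a m (σ b n)) : A →ₗ[k] Bal ρ σ →ₗ[k] P where
  toFun a := Bal.lift (f a) (h a)
  map_add' a a' := by
    refine LinearMap.ext fun z => ?_
    induction z using Bal.induction with
    | hmk m n => simp
    | hadd x y hx hy =>
      exact (LinearMap.map_add _ x y).trans
        ((congrArg₂ (· + ·) hx hy).trans (LinearMap.map_add _ x y).symm)
  map_smul' c a := by
    refine LinearMap.ext fun z => ?_
    induction z using Bal.induction with
    | hmk m n => simp
    | hadd x y hx hy => simp_all

@[simp] theorem Bal.liftFam_mk (f : A →ₗ[k] M →ₗ[k] N →ₗ[k] P)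
    (h : ∀ a b m n, f a (ρ b m) n = f a m (σ b n)) (a : A) (m : M) (n : N) :
    Bal.liftFam f h a (Bal.mk ρ σ m n) = f a m n := rfl

end Balanced

/-! Left bialgebroids. -/

/-- An algebra `L` with an algebra map `s` and an anti-algebra map `t` from `B` whose images
commute; `s b` and `t b` are the elements written `b` and `\bar b`. -/
structure BeRing (k B L : Type u) [Field k] [Ring B] [Algebra k B] [Ring L] [Algebra k L] where
  s : B →ₐ[k] L
  t : B →ₗ[k] L
  t_one : t 1 = 1
  t_mul : ∀ a b, t (a * b) = t b * t a
  comm : ∀ a b, s a * t b = t b * s a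

section Diamond

variable {k B L : Type u} [Field k] [Ring B] [Algebra k B] [Ring L] [Algebra k L]

/-- The action of `\bar b` on a left `L`-module. -/
def BeRing.tAct (R : BeRing k B L) (M : Type u)
    [AddCommGroup M] [Module k M] [Module L M] [IsScalarTower k L M] (b : B) : M →ₗ[k] M :=
  Algebra.lsmul k k M (R.t b)

/-- The action of `b` on a left `L`-module. -/
def BeRing.sAct (R : BeRing k B L) (M : Type u)
    [AddCommGroup M] [Module k M] [Module L M] [IsScalarTower k L M] (b : B) : M →ₗ[k] M :=
  Algebra.lsmul k k M (R.s b)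

@[simp] theorem BeRing.tAct_apply (R : BeRing k B L) {M : Type u}
    [AddCommGroup M] [Module k M] [Module L M] [IsScalarTower k L M] (b : B) (m : M) :
    R.tAct M b m = R.t b • m := rfl

@[simp] theorem BeRing.sAct_apply (R : BeRing k B L) {M : Type u}
    [AddCommGroup M] [Module k M] [Module L M] [IsScalarTower k L M] (b : B) (m : M) :
    R.sAct M b m = R.s b • m := rfl

section MDiamond

variable (R : BeRing k B L) (M N : Type u)
    [AddCommGroup M] [Module k M] [Module L M] [IsScalarTower k L M]
    [AddCommGroup N] [Module k N] [Module L N] [IsScalarTower k L N]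

/-- `M ◇_B N`, i.e. `M ⊗ N` modulo `\bar b m ⊗ n = m ⊗ b n`, for left `L`-modules `M`, `N`. -/
def BeRing.MDiamond : Type u := Bal (R.tAct M) (R.sAct N)

instance : AddCommGroup (R.MDiamond M N) := inferInstanceAs (AddCommGroup (Bal (R.tAct M) (R.sAct N)))

instance : Module k (R.MDiamond M N) := inferInstanceAs (Module k (Bal (R.tAct M) (R.sAct N)))

/-- `L ◇_B L`. -/
abbrev BeRing.Diamond (R : BeRing k B L) : Type u := R.MDiamond L L

variable {M N} {P : Type*} [AddCommGroup P] [Module k P] {A : Type*} [AddCommGroup A] [Module k A]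

/-- The class of `m ⊗ n` in `M ◇_B N`. -/
def BeRing.dmk : M →ₗ[k] N →ₗ[k] R.MDiamond M N := Bal.mk (R.tAct M) (R.sAct N)

theorem BeRing.dmk_bal (b : B) (m : M) (n : N) : R.dmk (R.t b • m) n = R.dmk m (R.s b • n) :=
  Bal.mk_bal (ρ := R.tAct M) (σ := R.sAct N) b m n

theorem BeRing.dmk_bal' (b : B) (x y : L) : R.dmk (R.t b * x) y = R.dmk x (R.s b * y) :=
  R.dmk_bal b x y

/-- Descent to `M ◇_B N`. -/
def BeRing.dlift (f : M →ₗ[k] N →ₗ[k] P)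
    (h : ∀ (b : B) (m : M) (n : N), f (R.t b • m) n = f m (R.s b • n)) : R.MDiamond M N →ₗ[k] P :=
  Bal.lift (ρ := R.tAct M) (σ := R.sAct N) f h

@[simp] theorem BeRing.dlift_dmk (f : M →ₗ[k] N →ₗ[k] P)
    (h : ∀ (b : B) (m : M) (n : N), f (R.t b • m) n = f m (R.s b • n)) (m : M) (n : N) :
    R.dlift f h (R.dmk m n) = f m n := rfl

/-- Descent to `M ◇_B N` for a linear family. -/
def BeRing.dliftFam (f : A →ₗ[k] M →ₗ[k] N →ₗ[k] P)
    (h : ∀ a (b : B) (m : M) (n : N), f a (R.t b • m) n = f a m (R.s b • n)) :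
    A →ₗ[k] R.MDiamond M N →ₗ[k] P :=
  Bal.liftFam (ρ := R.tAct M) (σ := R.sAct N) f h

@[simp] theorem BeRing.dliftFam_dmk (f : A →ₗ[k] M →ₗ[k] N →ₗ[k] P)
    (h : ∀ a (b : B) (m : M) (n : N), f a (R.t b • m) n = f a m (R.s b • n))
    (a : A) (m : M) (n : N) : R.dliftFam f h a (R.dmk m n) = f a m n := rfl

theorem BeRing.dind {R : BeRing k B L} {p : R.MDiamond M N → Prop} (z : R.MDiamond M N)
    (hmk : ∀ m n, p (R.dmk m n)) (hadd : ∀ x y, p x → p y → p (x + y)) : p z :=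
  Bal.induction (ρ := R.tAct M) (σ := R.sAct N) z hmk hadd

end MDiamond

variable (R : BeRing k B L)

section Act
variable {M N : Type u} [AddCommGroup M] [Module k M] [Module L M] [IsScalarTower k L M]
    [AddCommGroup N] [Module k N] [Module L N] [IsScalarTower k L N]

/-- `x ◇ y ↦ (m, n ↦ x m ◇ y n)`. For `M = N = L` this is the right multiplication of `L ◇ L` by
elements of `L ⊗ L`. -/
def BeRing.act : R.Diamond →ₗ[k] M →ₗ[k] N →ₗ[k] R.MDiamond M N :=
  R.dlift
    (LinearMap.mk₂ k
      (fun x y => LinearMap.mk₂ k (fun (m : M) (n : N) => R.dmk (x • m) (y • n))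
        (by intros; simp [smul_add]) (by intros; simp [smul_algebra_smul_comm])
        (by intros; simp [smul_add]) (by intros; simp [smul_algebra_smul_comm]))
      (by intros; ext; simp [add_smul]) (by intros; ext; simp)
      (by intros; ext; simp [add_smul]) (by intros; ext; simp))
    (by intro b x y; ext m n; simp [mul_smul, R.dmk_bal])

@[simp] theorem BeRing.act_dmk (x y : L) (m : M) (n : N) :
    R.act (R.dmk x y) m n = R.dmk (x • m) (y • n) := rfl

end Act

/-- `x ◇ y ↦ s(b) x ◇ y`. -/
def BeRing.leftS (b : B) : R.Diamond →ₗ[k] R.Diamond :=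
  R.dlift (R.dmk ∘ₗ LinearMap.mulLeft k (R.s b)) (by
    intro c x y
    simp only [LinearMap.comp_apply, LinearMap.mulLeft_apply, smul_eq_mul]
    rw [← mul_assoc, R.comm, mul_assoc, R.dmk_bal'])

/-- `x ◇ y ↦ x ◇ t(b) y`. -/
def BeRing.rightT (b : B) : R.Diamond →ₗ[k] R.Diamond :=
  R.dlift (R.dmk.compl₂ (LinearMap.mulLeft k (R.t b))) (by
    intro c x y
    simp only [LinearMap.compl₂_apply, LinearMap.mulLeft_apply, smul_eq_mul]
    rw [R.dmk_bal', ← mul_assoc, R.comm, mul_assoc])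

@[simp] theorem BeRing.leftS_dmk (b : B) (x y : L) :
    R.leftS b (R.dmk x y) = R.dmk (R.s b * x) y := rfl

@[simp] theorem BeRing.rightT_dmk (b : B) (x y : L) :
    R.rightT b (R.dmk x y) = R.dmk x (R.t b * y) := rfl

/-- `L ◇_B L ◇_B L`, bracketed as `L ◇_B (L ◇_B L)`. -/
def BeRing.Diamond₃ : Type u := Bal (R.tAct L) R.leftS

instance : AddCommGroup R.Diamond₃ := inferInstanceAs (AddCommGroup (Bal (R.tAct L) R.leftS))

instance : Module k R.Diamond₃ := inferInstanceAs (Module k (Bal (R.tAct L) R.leftS))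

/-- `(x, y ◇ z) ↦ x ◇ y ◇ z`. -/
def BeRing.mkRight : L →ₗ[k] R.Diamond →ₗ[k] R.Diamond₃ := Bal.mk (R.tAct L) R.leftS

theorem BeRing.mkRight_bal (b : B) (x : L) (w : R.Diamond) :
    R.mkRight (R.t b * x) w = R.mkRight x (R.leftS b w) :=
  Bal.mk_bal (ρ := R.tAct L) (σ := R.leftS) b x w

/-- `(x ◇ y, z) ↦ x ◇ y ◇ z`. -/
def BeRing.mkLeft : R.Diamond →ₗ[k] L →ₗ[k] R.Diamond₃ :=
  R.dlift
    (LinearMap.mk₂ k (fun x y => R.mkRight x ∘ₗ R.dmk y)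
      (by intros; ext; simp) (by intros; ext; simp) (by intros; ext; simp) (by intros; ext; simp))
    (by
      intro b x y
      ext z
      exact R.mkRight_bal b x (R.dmk y z))

@[simp] theorem BeRing.mkLeft_dmk (x y z : L) :
    R.mkLeft (R.dmk x y) z = R.mkRight x (R.dmk y z) := rfl

theorem BeRing.mkLeft_bal (b : B) (w : R.Diamond) (z : L) :
    R.mkLeft (R.rightT b w) z = R.mkLeft w (R.s b * z) := by
  induction w using BeRing.dind with
  | hmk x y => exact congrArg (R.mkRight x) (R.dmk_bal' b y z)
  | hadd v w hv hw => simp [hv, hw]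

end Diamond

/-- Comultiplication and counit, `B`-bilinear for `a . X . b = a \bar b X`, with the
comultiplication taking values in the Takeuchi product. -/
structure ComulData (k B L : Type u) [Field k] [Ring B] [Algebra k B] [Ring L] [Algebra k L]
    extends BeRing k B L where
  comul : L →ₗ[k] toBeRing.Diamond
  counit : L →ₗ[k] B
  comul_s : ∀ b x, comul (s b * x) = toBeRing.leftS b (comul x)
  comul_t : ∀ b x, comul (t b * x) = toBeRing.rightT b (comul x)
  takeuchi : ∀ x b, toBeRing.act (comul x) (t b) (1 : L) = toBeRing.act (comul x) (1 : L) (s b)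
  counit_s : ∀ b x, counit (s b * x) = b * counit x
  counit_t : ∀ b x, counit (t b * x) = counit x * b

section Comul

variable {k B L : Type u} [Field k] [Ring B] [Algebra k B] [Ring L] [Algebra k L]

theorem BeRing.act_mul (R : BeRing k B L) (T : R.Diamond) (a b c d : L) :
    R.act T (a * c) (b * d) = R.act (R.act T a b) c d := by
  induction T using BeRing.dind with
  | hmk x y => simp [mul_assoc]
  | hadd v w hv hw => simp [hv, hw]

variable (C : ComulData k B L)

theorem ComulData.takeuchi' (x : L) (b : B) (y z : L) :
    C.act (C.comul x) (C.t b * y) z = C.act (C.comul x) y (C.s b * z) := by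
  have h1 := C.act_mul (C.comul x) (C.t b) 1 y z
  have h2 := C.act_mul (C.comul x) 1 (C.s b) y z
  rw [one_mul] at h1 h2
  rw [h1, h2, C.takeuchi]

/-- `(x, y ◇ z) ↦ x₁ y ◇ x₂ z`, the product of an element of the Takeuchi product with an element
of `L ◇ L`. -/
def ComulData.comulAct : L →ₗ[k] C.Diamond →ₗ[k] C.Diamond :=
  C.dliftFam (C.act ∘ₗ C.comul) (fun x b y z => C.takeuchi' x b y z)

@[simp] theorem ComulData.comulAct_dmk (x y z : L) :
    C.comulAct x (C.dmk y z) = C.act (C.comul x) y z := rfl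

theorem ComulData.comulAct_s (b : B) (x : L) (w : C.Diamond) :
    C.comulAct (C.s b * x) w = C.leftS b (C.comulAct x w) := by
  induction w using BeRing.dind with
  | hmk y z =>
    change C.act (C.comul (C.s b * x)) y z = C.leftS b (C.act (C.comul x) y z)
    rw [C.comul_s]
    induction C.comul x using BeRing.dind with
    | hmk p q => simp [mul_assoc]
    | hadd v w hv hw => simp [hv, hw]
  | hadd v w hv hw => simp [hv, hw]

theorem ComulData.comulAct_t (b : B) (x : L) (w : C.Diamond) :
    C.comulAct (C.t b * x) w = C.rightT b (C.comulAct x w) := by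
  induction w using BeRing.dind with
  | hmk y z =>
    change C.act (C.comul (C.t b * x)) y z = C.rightT b (C.act (C.comul x) y z)
    rw [C.comul_t]
    induction C.comul x using BeRing.dind with
    | hmk p q => simp [mul_assoc]
    | hadd v w hv hw => simp [hv, hw]
  | hadd v w hv hw => simp [hv, hw]

/-- `Δ ◇ id`. -/
def ComulData.comulLeft : C.Diamond →ₗ[k] C.Diamond₃ :=
  C.dlift (C.mkLeft ∘ₗ C.comul) (by
    intro b x y
    change C.mkLeft (C.comul (C.t b * x)) y = C.mkLeft (C.comul x) (C.s b * y)
    rw [C.comul_t, C.mkLeft_bal])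

/-- `id ◇ Δ`. -/
def ComulData.comulRight : C.Diamond →ₗ[k] C.Diamond₃ :=
  C.dlift (C.mkRight.compl₂ C.comul) (by
    intro b x y
    change C.mkRight (C.t b * x) (C.comul y) = C.mkRight x (C.comul (C.s b * y))
    rw [C.comul_s, C.mkRight_bal])

/-- `ε ◇ id : x ◇ y ↦ ε(x) y`. -/
def ComulData.counitLeft : C.Diamond →ₗ[k] L :=
  C.dlift (LinearMap.mul k L ∘ₗ C.s.toLinearMap ∘ₗ C.counit) (by
    intro b x y
    simp [C.counit_t, mul_assoc])

/-- `id ◇ ε : x ◇ y ↦ \bar{ε(y)} x`. -/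
def ComulData.counitRight : C.Diamond →ₗ[k] L :=
  C.dlift (LinearMap.mul k L ∘ₗ C.t ∘ₗ C.counit).flip (by
    intro b x y
    simp [C.counit_s, C.t_mul, mul_assoc])

end Comul

/-- Left `B`-bialgebroids. -/
structure LeftBialgebroid (k B L : Type u) [Field k] [Ring B] [Algebra k B] [Ring L] [Algebra k L]
    extends ComulData k B L where
  coassoc : ∀ x, (toComulData.comulLeft (comul x) : toBeRing.Diamond₃) =
    toComulData.comulRight (comul x)
  counit_comul_left : ∀ x, toComulData.counitLeft (comul x) = x
  counit_comul_right : ∀ x, toComulData.counitRight (comul x) = x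
  comul_one : comul 1 = toBeRing.dmk 1 1
  comul_mul : ∀ x y, comul (x * y) = toComulData.comulAct x (comul y)
  counit_one : counit 1 = 1
  counit_mul_s : ∀ x y, counit (x * y) = counit (x * s (counit y))
  counit_mul_t : ∀ x y, counit (x * y) = counit (x * t (counit y))

/-! Left Hopf algebroids and the translation map `X ↦ X₊ ⊗ X₋`. -/

section Hopf

variable {k B L : Type u} [Field k] [Ring B] [Algebra k B] [Ring L] [Algebra k L]

/-- `x ↦ x \bar b`. -/
def BeRing.mulT (R : BeRing k B L) (b : B) : L →ₗ[k] L := LinearMap.mulRight k (R.t b)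

/-- `x ↦ \bar b x`. -/
def BeRing.tMul (R : BeRing k B L) (b : B) : L →ₗ[k] L := LinearMap.mulLeft k (R.t b)

@[simp] theorem BeRing.mulT_apply (R : BeRing k B L) (b : B) (x : L) :
    R.mulT b x = x * R.t b := rfl

@[simp] theorem BeRing.tMul_apply (R : BeRing k B L) (b : B) (x : L) :
    R.tMul b x = R.t b * x := rfl

/-- `L ⊗_{\bar B} L`, i.e. `L ⊗ L` modulo `x \bar b ⊗ y = x ⊗ \bar b y`. -/
def BeRing.Bar (R : BeRing k B L) : Type u := Bal R.mulT R.tMul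

section Bar

variable (R : BeRing k B L) {P : Type*} [AddCommGroup P] [Module k P]
  {A : Type*} [AddCommGroup A] [Module k A]

instance : AddCommGroup R.Bar := inferInstanceAs (AddCommGroup (Bal R.mulT R.tMul))

instance : Module k R.Bar := inferInstanceAs (Module k (Bal R.mulT R.tMul))

/-- The class of `x ⊗ y` in `L ⊗_{\bar B} L`. -/
def BeRing.bmk : L →ₗ[k] L →ₗ[k] R.Bar := Bal.mk R.mulT R.tMul

theorem BeRing.bmk_bal (b : B) (x y : L) : R.bmk (x * R.t b) y = R.bmk x (R.t b * y) :=
  Bal.mk_bal (ρ := R.mulT) (σ := R.tMul) b x y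

/-- Descent to `L ⊗_{\bar B} L`. -/
def BeRing.blift (f : L →ₗ[k] L →ₗ[k] P)
    (h : ∀ (b : B) (x y : L), f (x * R.t b) y = f x (R.t b * y)) : R.Bar →ₗ[k] P :=
  Bal.lift (ρ := R.mulT) (σ := R.tMul) f h

@[simp] theorem BeRing.blift_bmk (f : L →ₗ[k] L →ₗ[k] P)
    (h : ∀ (b : B) (x y : L), f (x * R.t b) y = f x (R.t b * y)) (x y : L) :
    R.blift f h (R.bmk x y) = f x y := rfl

/-- Descent to `L ⊗_{\bar B} L` for a linear family. -/
def BeRing.bliftFam (f : A →ₗ[k] L →ₗ[k] L →ₗ[k] P)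
    (h : ∀ a (b : B) (x y : L), f a (x * R.t b) y = f a x (R.t b * y)) : A →ₗ[k] R.Bar →ₗ[k] P :=
  Bal.liftFam (ρ := R.mulT) (σ := R.tMul) f h

@[simp] theorem BeRing.bliftFam_bmk (f : A →ₗ[k] L →ₗ[k] L →ₗ[k] P)
    (h : ∀ a (b : B) (x y : L), f a (x * R.t b) y = f a x (R.t b * y)) (a : A) (x y : L) :
    R.bliftFam f h a (R.bmk x y) = f a x y := rfl

theorem BeRing.bind {R : BeRing k B L} {p : R.Bar → Prop} (z : R.Bar)
    (hmk : ∀ x y, p (R.bmk x y)) (hadd : ∀ x y, p x → p y → p (x + y)) : p z :=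
  Bal.induction (ρ := R.mulT) (σ := R.tMul) z hmk hadd

end Bar

/-- `x ⊗ y ↦ a x ⊗ y`. -/
def BeRing.barL (R : BeRing k B L) (a : L) : R.Bar →ₗ[k] R.Bar :=
  R.blift (R.bmk ∘ₗ LinearMap.mulLeft k a) (by
    intro b x y
    simp [← mul_assoc, R.bmk_bal])

/-- `x ⊗ y ↦ x ⊗ y a`. -/
def BeRing.barR (R : BeRing k B L) (a : L) : R.Bar →ₗ[k] R.Bar :=
  R.blift (R.bmk.compl₂ (LinearMap.mulRight k a)) (by
    intro b x y
    simp [mul_assoc, R.bmk_bal])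

/-- `x ⊗ y ↦ x b ⊗ y`. -/
def BeRing.barS (R : BeRing k B L) (b : B) : R.Bar →ₗ[k] R.Bar :=
  R.blift (R.bmk ∘ₗ LinearMap.mulRight k (R.s b)) (by
    intro c x y
    simp [mul_assoc, ← R.comm, ← R.bmk_bal])

@[simp] theorem BeRing.barL_bmk (R : BeRing k B L) (a x y : L) :
    R.barL a (R.bmk x y) = R.bmk (a * x) y := rfl

@[simp] theorem BeRing.barR_bmk (R : BeRing k B L) (a x y : L) :
    R.barR a (R.bmk x y) = R.bmk x (y * a) := rfl

@[simp] theorem BeRing.barS_bmk (R : BeRing k B L) (b : B) (x y : L) :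
    R.barS b (R.bmk x y) = R.bmk (x * R.s b) y := rfl

namespace LeftBialgebroid

variable (H : LeftBialgebroid k B L)

theorem comul_s_one (b : B) : H.comul (H.s b) = H.dmk (H.s b) 1 := by
  have h := H.comul_s b 1
  rw [mul_one, H.comul_one] at h
  simpa using h

theorem comul_t_one (b : B) : H.comul (H.t b) = H.dmk 1 (H.t b) := by
  have h := H.comul_t b 1
  rw [mul_one, H.comul_one] at h
  simpa using h

/-- The map `λ : x ⊗ y ↦ x₁ ◇ x₂ y`. -/
def lam : H.Bar →ₗ[k] H.Diamond :=
  H.blift (LinearMap.mk₂ k (fun x y => H.act (H.comul x) (1 : L) y)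
      (by intros; simp) (by intros; simp) (by intros; simp) (by intros; simp)) (by
    intro b x y
    simp only [LinearMap.mk₂_apply]
    rw [H.comul_mul, H.comul_t_one, H.comulAct_dmk, ← H.act_mul, one_mul])

@[simp] theorem lam_bmk (x y : L) : H.lam (H.bmk x y) = H.act (H.comul x) (1 : L) y := rfl

/-- `H` is a left Hopf algebroid. -/
def IsLeftHopf : Prop := Function.Bijective H.lam

variable {H}

/-- The translation map `X ↦ X₊ ⊗ X₋ = λ⁻¹(X ◇ 1)`. -/
noncomputable def trans (hH : H.IsLeftHopf) : L →ₗ[k] H.Bar :=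
  (LinearEquiv.ofBijective H.lam hH).symm.toLinearMap ∘ₗ H.dmk.flip (1 : L)

theorem lam_trans (hH : H.IsLeftHopf) (x : L) : H.lam (trans hH x) = H.dmk x 1 :=
  (LinearEquiv.ofBijective H.lam hH).apply_symm_apply (H.dmk x 1)

theorem lam_barR (a : L) (w : H.Bar) : H.lam (H.barR a w) = H.act (H.lam w) 1 a := by
  induction w using BeRing.bind with
  | hmk x y =>
    change H.act (H.comul x) 1 (y * a) = H.act (H.act (H.comul x) 1 y) 1 a
    rw [← H.act_mul, one_mul]
  | hadd v w hv hw => simp [hv, hw]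

theorem lam_barL_t (b : B) (w : H.Bar) : H.lam (H.barL (H.t b) w) = H.rightT b (H.lam w) := by
  induction w using BeRing.bind with
  | hmk x y => rw [BeRing.barL_bmk, lam_bmk, lam_bmk, ← ComulData.comulAct_dmk, ← ComulData.comulAct_dmk,
    H.comulAct_t]
  | hadd v w hv hw => simp [hv, hw]

theorem lam_barL_s (b : B) (w : H.Bar) : H.lam (H.barL (H.s b) w) = H.leftS b (H.lam w) := by
  induction w using BeRing.bind with
  | hmk x y => rw [BeRing.barL_bmk, lam_bmk, lam_bmk, ← ComulData.comulAct_dmk, ← ComulData.comulAct_dmk,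
    H.comulAct_s]
  | hadd v w hv hw => simp [hv, hw]

theorem lam_barS (b : B) (w : H.Bar) : H.lam (H.barS b w) = H.act (H.lam w) (H.s b) 1 := by
  induction w using BeRing.bind with
  | hmk x y =>
    change H.act (H.comul (x * H.s b)) 1 y = H.act (H.act (H.comul x) 1 y) (H.s b) 1
    rw [H.comul_mul, H.comul_s_one, H.comulAct_dmk, ← H.act_mul, ← H.act_mul]
    simp
  | hadd v w hv hw => simp [hv, hw]

/-- `\bar b X₊ ⊗ X₋ = X₊ ⊗ X₋ \bar b`. -/
theorem trans_tak (hH : H.IsLeftHopf) (b : B) (x : L) :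
    H.barL (H.t b) (trans hH x) = H.barR (H.t b) (trans hH x) := by
  apply hH.1
  rw [lam_barL_t, lam_barR, lam_trans]
  simp

theorem trans_s_mul (hH : H.IsLeftHopf) (b : B) (x : L) :
    trans hH (H.s b * x) = H.barL (H.s b) (trans hH x) := by
  apply hH.1
  rw [lam_barL_s, lam_trans, lam_trans]
  simp

theorem trans_mul_s (hH : H.IsLeftHopf) (b : B) (x : L) :
    trans hH (x * H.s b) = H.barS b (trans hH x) := by
  apply hH.1
  rw [lam_barS, lam_trans, lam_trans]
  simp

end LeftBialgebroid

end Hopf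

/-- The linear map `f : M ⊗ N → P` vanishes exactly on the relations `ρ b m ⊗ n = m ⊗ σ b n` and is
onto, i.e. it descends to the balanced tensor product `Bal ρ σ` and the descended map
`Bal ρ σ → P` is invertible. -/
def DescendsToIso {k : Type*} [Field k] {B M N P : Type*} [AddCommGroup M] [Module k M]
    [AddCommGroup N] [Module k N] [AddCommGroup P] [Module k P]
    (ρ : B → M →ₗ[k] M) (σ : B → N →ₗ[k] N) (f : M ⊗[k] N →ₗ[k] P) : Prop :=
  LinearMap.ker f = balRel ρ σ ∧ Function.Surjective f

/-! Left 2-cocycles in a left bialgebroid and Xu's twist. -/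

section Twist

variable {k B Λ : Type u} [Field k] [Ring B] [Algebra k B] [Ring Λ] [Algebra k Λ]

namespace LeftBialgebroid

variable (H : LeftBialgebroid k B Λ)

/-- `x ◇ y ↦ x₁ F^α ◇ x₂ F_α ◇ y`, so that `F` is sent to `(Δ ◇ id)(F) F¹²`. -/
def cocycleLeft (F : H.Diamond) : H.Diamond →ₗ[k] H.Diamond₃ :=
  H.dlift (H.mkLeft ∘ₗ H.comulAct.flip F) (by
    intro b x y
    change H.mkLeft (H.comulAct (H.t b * x) F) y = H.mkLeft (H.comulAct x F) (H.s b * y)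
    rw [H.comulAct_t, H.mkLeft_bal])

/-- `x ◇ y ↦ x ◇ y₁ F^α ◇ y₂ F_α`, so that `F` is sent to `(id ◇ Δ)(F) F²³`. -/
def cocycleRight (F : H.Diamond) : H.Diamond →ₗ[k] H.Diamond₃ :=
  H.dlift (H.mkRight.compl₂ (H.comulAct.flip F)) (by
    intro b x y
    change H.mkRight (H.t b * x) (H.comulAct y F) = H.mkRight x (H.comulAct (H.s b * y) F)
    rw [H.comulAct_s, H.mkRight_bal])

/-- `F` is a left 2-cocycle in `H`. -/
structure IsTwoCocycle (F : H.Diamond) : Prop where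
  counit_left : H.counitLeft F = 1
  counit_right : H.counitRight F = 1
  cocycle : (H.cocycleLeft F F : H.Diamond₃) = H.cocycleRight F F

/-- The product `a ·_F b = ε(F^α a) ε(F_α b)` on `B`. -/
def twistBaseMul (F : H.Diamond) (a b : B) : B :=
  H.dlift
    (LinearMap.mk₂ k (fun x y => H.counit (x * H.s a) * H.counit (y * H.s b))
      (by intros; simp [add_mul]) (by intros; simp)
      (by intros; simp [add_mul, mul_add]) (by intros; simp))
    (by intro c x y; simp [mul_assoc, H.counit_t, H.counit_s]) F

/-- `s^F(b) = ε(F^α b) F_α`. -/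
def twistS (F : H.Diamond) (b : B) : Λ :=
  H.dlift
    (LinearMap.mk₂ k (fun x y => H.s (H.counit (x * H.s b)) * y)
      (by intros; simp [add_mul]) (by intros; simp)
      (by intros; simp [mul_add]) (by intros; simp))
    (by intro c x y; simp [mul_assoc, H.counit_t]) F

/-- `t^F(b) = \bar{ε(F_α b)} F^α`. -/
def twistT (F : H.Diamond) (b : B) : Λ :=
  H.dlift
    (LinearMap.mk₂ k (fun x y => H.t (H.counit (y * H.s b)) * x)
      (by intros; simp [mul_add]) (by intros; simp)
      (by intros; simp [add_mul]) (by intros; simp))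
    (by intro c x y; simp [mul_assoc, H.counit_s, H.t_mul]) F

/-- `F^# : m ⊗ n ↦ F^α m ◇ F_α n`, on `M ⊗ N`. -/
def sharp (F : H.Diamond) (M N : Type u)
    [AddCommGroup M] [Module k M] [Module Λ M] [IsScalarTower k Λ M]
    [AddCommGroup N] [Module k N] [Module Λ N] [IsScalarTower k Λ N] :
    M ⊗[k] N →ₗ[k] H.MDiamond M N :=
  TensorProduct.lift (H.act F)

/-- `F` is invertible: `F^# : M ◇_{B^F} N → M ◇_B N` is invertible for all left modules `M`, `N`. -/
def IsInvertible (F : H.Diamond) : Prop :=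
  ∀ (M N : Type u) [AddCommGroup M] [Module k M] [Module Λ M] [IsScalarTower k Λ M]
    [AddCommGroup N] [Module k N] [Module Λ N] [IsScalarTower k Λ N],
    DescendsToIso (fun b : B => Algebra.lsmul k k M (H.twistT F b))
      (fun b : B => Algebra.lsmul k k N (H.twistS F b)) (H.sharp F M N)

end LeftBialgebroid

/-- `K` is Xu's twist `H^F`. Its base algebra `B'` is (a copy, via `e`, of) the vector space `B` with
the product `·_F`; algebra and counit are those of `H`, and `F^#(Δ^F(x)) = Δ(x) F`, where the
left side is computed on any representative `z` of `Δ^F(x)`. -/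
structure IsXuTwist (H : LeftBialgebroid k B Λ) (F : H.Diamond)
    {B' : Type u} [Ring B'] [Algebra k B'] (e : B ≃ₗ[k] B') (K : LeftBialgebroid k B' Λ) :
    Prop where
  base_mul : ∀ a b, e a * e b = e (H.twistBaseMul F a b)
  base_one : e 1 = 1
  source : ∀ b, K.s (e b) = H.twistS F b
  target : ∀ b, K.t (e b) = H.twistT F b
  counit : ∀ x, K.counit x = e (H.counit x)
  comul : ∀ (x : Λ) (z : Λ ⊗[k] Λ), TensorProduct.lift K.dmk z = K.comul x →
    H.sharp F Λ Λ z = H.comulAct x F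

end Twist

/-! Left 2-cocycles on a left Hopf algebroid and the cotwist. -/

section Cotwist

variable {k B L : Type u} [Field k] [Ring B] [Algebra k B] [Ring L] [Algebra k L]

/-- Elements of `Hom_{\bar B -}(L ⊗_{\bar B} L, B)`. -/
structure TwoCochain (H : LeftBialgebroid k B L) where
  form : L →ₗ[k] L →ₗ[k] B
  balanced : ∀ b x y, form (x * H.t b) y = form x (H.t b * y)
  linear : ∀ b x y, form (H.t b * x) y = form x y * b

namespace TwoCochain

variable {H : LeftBialgebroid k B L} (Γ : TwoCochain H)

/-- Auxiliary: `x₁ ◇ x₂ ↦ (y₁, y₂ ↦ Γ(x₁, y₁) m(x₂, y₂))`. -/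
def convAux (m : L →ₗ[k] L →ₗ[k] L) (h₁ : ∀ b x y, m (H.s b * x) y = H.s b * m x y) :
    H.Diamond →ₗ[k] L →ₗ[k] L →ₗ[k] L :=
  H.dlift
    (LinearMap.mk₂ k
      (fun x x' => LinearMap.mk₂ k (fun y y' => H.s (Γ.form x y) * m x' y')
        (by intros; simp [add_mul]) (by intros; simp)
        (by intros; simp [mul_add]) (by intros; simp))
      (by intros; ext; simp [add_mul]) (by intros; ext; simp)
      (by intros; ext; simp [mul_add]) (by intros; ext; simp))
    (by intro b x x'; ext y y'; simp [Γ.linear, h₁, mul_assoc])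

/-- `(x, y) ↦ Γ(x₁, y₁) m(x₂, y₂)`, for a bilinear `m` with `m(b x, y) = b m(x, y)` and
`m(x b, y) = m(x, b y)`. -/
def conv (m : L →ₗ[k] L →ₗ[k] L) (h₁ : ∀ b x y, m (H.s b * x) y = H.s b * m x y)
    (h₂ : ∀ b x y, m (x * H.s b) y = m x (H.s b * y)) : L →ₗ[k] L →ₗ[k] L :=
  (H.dliftFam
    (Γ.convAux m h₁ ∘ₗ H.comul) (by
      have e₁ : ∀ (w : H.Diamond) b y y', Γ.convAux m h₁ w (H.t b * y) y' =
          Γ.convAux m h₁ (H.act w (H.t b) (1 : L)) y y' := by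
        intro w b y y'
        induction w using BeRing.dind with
        | hmk p q =>
          change H.s (Γ.form p (H.t b * y)) * m q y' = H.s (Γ.form (p * H.t b) y) * m (q * 1) y'
          rw [Γ.balanced, mul_one]
        | hadd v w hv hw => simp [hv, hw]
      have e₂ : ∀ (w : H.Diamond) b y y', Γ.convAux m h₁ w y (H.s b * y') =
          Γ.convAux m h₁ (H.act w (1 : L) (H.s b)) y y' := by
        intro w b y y'
        induction w using BeRing.dind with
        | hmk p q =>
          change H.s (Γ.form p y) * m q (H.s b * y') = H.s (Γ.form (p * 1) y) * m (q * H.s b) y'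
          rw [h₂, mul_one]
        | hadd v w hv hw => simp [hv, hw]
      intro x b y y'
      change Γ.convAux m h₁ (H.comul x) (H.t b * y) y' = Γ.convAux m h₁ (H.comul x) y (H.s b * y')
      rw [e₁, e₂, H.takeuchi])).compl₂ H.comul

/-- `(x, y) ↦ Γ(x₁, y₁) x₂ y₂`. -/
def convMul : L →ₗ[k] L →ₗ[k] L :=
  Γ.conv (LinearMap.mul k L) (by intros; simp [mul_assoc]) (by intros; simp [mul_assoc])

/-- `Γ` is a left 2-cocycle on `H`. -/
structure IsTwoCocycle : Prop where
  cocycle : ∀ x y z, Γ.form x (Γ.convMul y z) = Γ.form (Γ.convMul x y) z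
  one_left : ∀ x, Γ.form 1 x = H.counit x
  one_right : ∀ x, Γ.form x 1 = H.counit x

/-- Auxiliary: `y₊ ⊗ y₋ ↦ (x₊, x₋ ↦ x₊ y₊ \bar{Γ(y₋, x₋)})`. -/
def rightAux : H.Bar →ₗ[k] L →ₗ[k] L →ₗ[k] L :=
  H.blift
    (LinearMap.mk₂ k
      (fun y y' => LinearMap.mk₂ k (fun x x' => x * y * H.t (Γ.form y' x'))
        (by intros; simp [add_mul]) (by intros; simp)
        (by intros; simp [mul_add]) (by intros; simp))
      (by intros; ext; simp [mul_add, add_mul]) (by intros; ext; simp)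
      (by intros; ext; simp [mul_add]) (by intros; ext; simp))
    (by intro b y y'; ext x x'; simp [Γ.linear, H.t_mul, mul_assoc])

/-- `(x, y) ↦ x₊ y₊ \bar{Γ(y₋, x₋)}`. -/
noncomputable def rightMul (hH : H.IsLeftHopf) : L →ₗ[k] L →ₗ[k] L :=
  ((H.bliftFam
    (Γ.rightAux ∘ₗ LeftBialgebroid.trans hH) (by
      have e₁ : ∀ (w : H.Bar) b x x', Γ.rightAux w (x * H.t b) x' =
          Γ.rightAux (H.barL (H.t b) w) x x' := by
        intro w b x x'
        induction w using BeRing.bind with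
        | hmk p q =>
          change x * H.t b * p * H.t (Γ.form q x') = x * (H.t b * p) * H.t (Γ.form q x')
          simp [mul_assoc]
        | hadd v w hv hw => simp [hv, hw]
      have e₂ : ∀ (w : H.Bar) b x x', Γ.rightAux w x (H.t b * x') =
          Γ.rightAux (H.barR (H.t b) w) x x' := by
        intro w b x x'
        induction w using BeRing.bind with
        | hmk p q =>
          change x * p * H.t (Γ.form q (H.t b * x')) = x * p * H.t (Γ.form (q * H.t b) x')
          rw [Γ.balanced]
        | hadd v w hv hw => simp [hv, hw]
      intro y b x x'
      change Γ.rightAux (LeftBialgebroid.trans hH y) (x * H.t b) x' =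
        Γ.rightAux (LeftBialgebroid.trans hH y) x (H.t b * x')
      rw [e₁, e₂, LeftBialgebroid.trans_tak])).compl₂ (LeftBialgebroid.trans hH)).flip

theorem rightMul_s_mul (hH : H.IsLeftHopf) (b : B) (x y : L) :
    Γ.rightMul hH (H.s b * x) y = H.s b * Γ.rightMul hH x y := by
  simp only [rightMul, LinearMap.flip_apply, LinearMap.compl₂_apply,
    LeftBialgebroid.trans_s_mul]
  induction LeftBialgebroid.trans hH x using BeRing.bind with
  | hmk p q =>
    change Γ.rightAux _ (H.s b * p) q = H.s b * Γ.rightAux _ p q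
    induction LeftBialgebroid.trans hH y using BeRing.bind with
    | hmk p' q' =>
      change H.s b * p * p' * H.t (Γ.form q' q) = H.s b * (p * p' * H.t (Γ.form q' q))
      simp [mul_assoc]
    | hadd v w hv hw => simp [hv, hw, mul_add]
  | hadd v w hv hw => simp [hv, hw, mul_add]

theorem rightMul_mul_s (hH : H.IsLeftHopf) (b : B) (x y : L) :
    Γ.rightMul hH (x * H.s b) y = Γ.rightMul hH x (H.s b * y) := by
  simp only [rightMul, LinearMap.flip_apply, LinearMap.compl₂_apply,
    LeftBialgebroid.trans_mul_s]
  induction LeftBialgebroid.trans hH x using BeRing.bind with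
  | hmk p q =>
    change Γ.rightAux (LeftBialgebroid.trans hH y) (p * H.s b) q =
      Γ.rightAux (LeftBialgebroid.trans hH (H.s b * y)) p q
    rw [LeftBialgebroid.trans_s_mul]
    induction LeftBialgebroid.trans hH y using BeRing.bind with
    | hmk p' q' =>
      change p * H.s b * p' * H.t (Γ.form q' q) = p * (H.s b * p') * H.t (Γ.form q' q)
      simp [mul_assoc]
    | hadd v w hv hw => simp [hv, hw]
  | hadd v w hv hw => simp [hv, hw]

/-- The cotwisted product `x ·_Γ y = Γ(x₁, y₁) x₂₊ y₂₊ \bar{Γ(y₂₋, x₂₋)}` on `L`. -/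
noncomputable def cotwistMul (hH : H.IsLeftHopf) : L →ₗ[k] L →ₗ[k] L :=
  Γ.conv (Γ.rightMul hH) (Γ.rightMul_s_mul hH) (Γ.rightMul_mul_s hH)

/-- The cotwisted counit `ε^Γ(x) = Γ(x₊, x₋)`. -/
noncomputable def cotwistCounit (hH : H.IsLeftHopf) : L →ₗ[k] B :=
  H.blift
    Γ.form Γ.balanced ∘ₗ LeftBialgebroid.trans hH

/-- Auxiliary: `x₊ ⊗ x₋ ↦ (y₁, y₂ ↦ x₊ \bar{Γ(x₋, y₁)} ◇ y₂)`. -/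
def sharpAux : H.Bar →ₗ[k] L →ₗ[k] L →ₗ[k] H.Diamond :=
  H.blift
    (LinearMap.mk₂ k
      (fun x x' => LinearMap.mk₂ k (fun y y' => H.dmk (x * H.t (Γ.form x' y)) y')
        (by intros; simp [mul_add]) (by intros; simp)
        (by intros; simp) (by intros; simp))
      (by intros; ext; simp [add_mul]) (by intros; ext; simp)
      (by intros; ext; simp [mul_add]) (by intros; ext; simp))
    (by intro b x x'; ext y y'; simp [Γ.linear, H.t_mul, mul_assoc])

/-- `Γ^# : x ⊗ y ↦ x₊ \bar{Γ(x₋, y₁)} ◇ y₂`, on `L ⊗ L`. -/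
noncomputable def sharp (hH : H.IsLeftHopf) : L ⊗[k] L →ₗ[k] H.Diamond :=
  TensorProduct.lift ((H.dliftFam
    (Γ.sharpAux ∘ₗ LeftBialgebroid.trans hH) (by
      have e₁ : ∀ (w : H.Bar) b y y', Γ.sharpAux w (H.t b * y) y' =
          Γ.sharpAux (H.barR (H.t b) w) y y' := by
        intro w b y y'
        induction w using BeRing.bind with
        | hmk p q =>
          change H.dmk (p * H.t (Γ.form q (H.t b * y))) y' =
            H.dmk (p * H.t (Γ.form (q * H.t b) y)) y'
          rw [Γ.balanced]
        | hadd v w hv hw => simp [hv, hw]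
      have e₂ : ∀ (w : H.Bar) b y y', Γ.sharpAux w y (H.s b * y') =
          Γ.sharpAux (H.barL (H.t b) w) y y' := by
        intro w b y y'
        induction w using BeRing.bind with
        | hmk p q =>
          change H.dmk (p * H.t (Γ.form q y)) (H.s b * y') =
            H.dmk (H.t b * p * H.t (Γ.form q y)) y'
          rw [mul_assoc, H.dmk_bal']
        | hadd v w hv hw => simp [hv, hw]
      intro x b y y'
      change Γ.sharpAux (LeftBialgebroid.trans hH x) (H.t b * y) y' =
        Γ.sharpAux (LeftBialgebroid.trans hH x) y (H.s b * y')
      rw [e₁, e₂, LeftBialgebroid.trans_tak])).compl₂ H.comul)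

end TwoCochain

/-- `K` is the cotwist `H^Γ`. Its base algebra `B'` and its algebra `L'` are (copies, via `e` and `f`,
of) the vector spaces `B` and `L` with the products `a ·_Γ b = Γ(a, b)` and `·_Γ`; source and
target are those of `H`, the counit is `ε^Γ`, the map
`Γ^# : L^Γ ◇_{B^Γ} L^Γ → L ◇_B L` is invertible, and `Γ^#(Δ^Γ(x)) = Δ(x)`, where the left side is
computed on any representative `z` of `Δ^Γ(x)`. -/
structure IsCotwist (H : LeftBialgebroid k B L) (hH : H.IsLeftHopf) (Γ : TwoCochain H)
    {B' L' : Type u} [Ring B'] [Algebra k B'] [Ring L'] [Algebra k L']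
    (e : B ≃ₗ[k] B') (f : L ≃ₗ[k] L') (K : LeftBialgebroid k B' L') : Prop where
  base_mul : ∀ a b, e a * e b = e (Γ.form (H.s a) (H.s b))
  base_one : e 1 = 1
  mul : ∀ x y, f x * f y = f (Γ.cotwistMul hH x y)
  one : f 1 = 1
  source : ∀ b, K.s (e b) = f (H.s b)
  target : ∀ b, K.t (e b) = f (H.t b)
  counit : ∀ x, K.counit (f x) = e (Γ.cotwistCounit hH x)
  sharp_iso : DescendsToIso (fun b : B => Γ.cotwistMul hH (H.t b))
    (fun b : B => Γ.cotwistMul hH (H.s b)) (Γ.sharp hH)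
  comul : ∀ (x : L) (z : L ⊗[k] L),
    TensorProduct.lift K.dmk (TensorProduct.map f.toLinearMap f.toLinearMap z) = K.comul (f x) →
      Γ.sharp hH z = H.comul x

end Cotwist

/-! Dual pairings. -/

section Pairing

variable {k B Λ L : Type u} [Field k] [Ring B] [Algebra k B] [Ring Λ] [Algebra k Λ]
  [Ring L] [Algebra k L]

/-- The bilinearity axiom of a dual pairing. -/
def IsBalancedPairing (H : LeftBialgebroid k B Λ) (K : LeftBialgebroid k B L)
    (p : Λ →ₗ[k] L →ₗ[k] B) : Prop :=
  ∀ (a b c d f : B) (α : Λ) (x : L),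
    p (H.s a * H.t b * α * H.s c * H.t d) x * f =
      a * p α (K.s c * K.t f * x * K.s d * K.t b)

namespace IsBalancedPairing

variable {H : LeftBialgebroid k B Λ} {K : LeftBialgebroid k B L} {p : Λ →ₗ[k] L →ₗ[k] B}

theorem s_left (hp : IsBalancedPairing H K p) (a : B) (α : Λ) (x : L) : p (H.s a * α) x = a * p α x := by
  simpa [H.t_one, K.t_one] using hp a 1 1 1 1 α x

theorem t_left (hp : IsBalancedPairing H K p) (b : B) (α : Λ) (x : L) : p (H.t b * α) x = p α (x * K.t b) := by
  simpa [H.t_one, K.t_one] using hp 1 b 1 1 1 α x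

theorem s_right (hp : IsBalancedPairing H K p) (c : B) (α : Λ) (x : L) : p (α * H.s c) x = p α (K.s c * x) := by
  simpa [H.t_one, K.t_one] using hp 1 1 c 1 1 α x

theorem t_right (hp : IsBalancedPairing H K p) (d : B) (α : Λ) (x : L) : p (α * H.t d) x = p α (x * K.s d) := by
  simpa [H.t_one, K.t_one] using hp 1 1 1 d 1 α x

theorem t_arg (hp : IsBalancedPairing H K p) (f : B) (α : Λ) (x : L) : p α (K.t f * x) = p α x * f := by
  simpa [H.t_one, K.t_one] using (hp 1 1 1 1 f α x).symm

/-- `⟨α₁ | x \bar{⟨α₂ | y⟩}⟩` as a linear map of `α₁ ◇ α₂`. -/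
def evalMul (hp : IsBalancedPairing H K p) (x y : L) : H.Diamond →ₗ[k] B :=
  H.dlift
    (LinearMap.mk₂ k (fun α β => p α (x * K.t (p β y)))
      (by intros; simp) (by intros; simp) (by intros; simp [mul_add]) (by intros; simp))
    (by intro b α β; simp [hp.t_left, hp.s_left, K.t_mul, mul_assoc])

/-- `⟨\bar{⟨α₂ | y⟩} α₁ | x⟩` as a linear map of `α₁ ◇ α₂`. -/
def evalMul' (hp : IsBalancedPairing H K p) (x y : L) : H.Diamond →ₗ[k] B :=
  H.dlift
    (LinearMap.mk₂ k (fun α β => p (H.t (p β y) * α) x)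
      (by intros; simp [mul_add]) (by intros; simp) (by intros; simp [add_mul]) (by intros; simp))
    (by intro b α β; simp [hp.s_left, H.t_mul, mul_assoc])

/-- `⟨α ⟨β | x₁⟩ | x₂⟩` as a linear map of `x₁ ◇ x₂`. -/
def evalComul (hp : IsBalancedPairing H K p) (α β : Λ) : K.Diamond →ₗ[k] B :=
  K.dlift
    (LinearMap.mk₂ k (fun x y => p (α * H.s (p β x)) y)
      (by intros; simp [mul_add]) (by intros; simp) (by intros; simp) (by intros; simp))
    (by intro b x y; simp [hp.t_arg, hp.s_right, mul_assoc])

/-- `⟨α | ⟨β | x₁⟩ x₂⟩` as a linear map of `x₁ ◇ x₂`. -/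
def evalComul' (hp : IsBalancedPairing H K p) (α β : Λ) : K.Diamond →ₗ[k] B :=
  K.dlift
    (LinearMap.mk₂ k (fun x y => p α (K.s (p β x) * y))
      (by intros; simp [add_mul]) (by intros; simp) (by intros; simp [mul_add]) (by intros; simp))
    (by intro b x y; simp [hp.t_arg, mul_assoc])

end IsBalancedPairing

/-- Dual pairings between the left `B`-bialgebroids `H` and `K`. -/
structure IsDualPairing (H : LeftBialgebroid k B Λ) (K : LeftBialgebroid k B L)
    (p : Λ →ₗ[k] L →ₗ[k] B) : Prop where
  balanced : IsBalancedPairing H K p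
  mul_right : ∀ α x y, p α (x * y) = balanced.evalMul x y (H.comul α)
  mul_right' : ∀ α x y, p α (x * y) = balanced.evalMul' x y (H.comul α)
  mul_left : ∀ α β x, p (α * β) x = balanced.evalComul α β (K.comul x)
  mul_left' : ∀ α β x, p (α * β) x = balanced.evalComul' α β (K.comul x)
  one_right : ∀ α, p α 1 = H.counit α
  one_left : ∀ x, p 1 x = K.counit x

namespace IsDualPairing

variable {H : LeftBialgebroid k B Λ} {K : LeftBialgebroid k B L} {p : Λ →ₗ[k] L →ₗ[k] B}

/-- `φ ◇ ψ ↦ (x, y ↦ ⟨φ | x \bar{⟨ψ | y⟩}⟩)`. -/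
def form (hp : IsDualPairing H K p) : H.Diamond →ₗ[k] L →ₗ[k] L →ₗ[k] B :=
  H.dlift
    (LinearMap.mk₂ k
      (fun φ ψ => LinearMap.mk₂ k (fun x y => p φ (x * K.t (p ψ y)))
        (by intros; simp [add_mul]) (by intros; simp)
        (by intros; simp [mul_add]) (by intros; simp))
      (by intros; ext; simp) (by intros; ext; simp)
      (by intros; ext; simp [mul_add]) (by intros; ext; simp))
    (by
      intro b φ ψ
      ext x y
      simp [mul_assoc, hp.balanced.t_left, hp.balanced.s_left, K.t_mul])

theorem form_balanced (hp : IsDualPairing H K p) (F : H.Diamond) (b : B) (x y : L) :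
    hp.form F (x * K.t b) y = hp.form F x (K.t b * y) := by
  induction F using BeRing.dind with
  | hmk φ ψ =>
    change p φ (x * K.t b * K.t (p ψ y)) = p φ (x * K.t (p ψ (K.t b * y)))
    rw [hp.balanced.t_arg, K.t_mul, mul_assoc]
  | hadd v w hv hw => simp [hv, hw]

theorem form_linear (hp : IsDualPairing H K p) (F : H.Diamond) (b : B) (x y : L) :
    hp.form F (K.t b * x) y = hp.form F x y * b := by
  induction F using BeRing.dind with
  | hmk φ ψ =>
    change p φ (K.t b * x * K.t (p ψ y)) = p φ (x * K.t (p ψ y)) * b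
    rw [← hp.balanced.t_arg, mul_assoc]
  | hadd v w hv hw => simp [hv, hw, add_mul]

/-- `Γ_F(x, y) = ⟨F^α | x \bar{⟨F_α | y⟩}⟩`. -/
def dualCochain (hp : IsDualPairing H K p) (F : H.Diamond) : TwoCochain K where
  form := hp.form F
  balanced := hp.form_balanced F
  linear := hp.form_linear F

/-- `[α | x] = ⟨F^α α | x₊ \bar{⟨F_α | x₋⟩}⟩`; here `H.act F α 1` is `F^α α ◇ F_α`. -/
noncomputable def twisted (hp : IsDualPairing H K p) (F : H.Diamond) (hK : K.IsLeftHopf) :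
    Λ →ₗ[k] L →ₗ[k] B :=
  (K.bliftFam
    (hp.form ∘ₗ (H.act (M := Λ) (N := Λ) F).flip (1 : Λ))
    (fun α => hp.form_balanced (H.act F α (1 : Λ)))).compl₂ (LeftBialgebroid.trans hK)

end IsDualPairing

end Pairing

end Bialgd

/-!
The two bialgebroids act on each other's data through the pairing. `Λ` acts on `L` in two ways,
`α ▷ x = ⟨α | x₁⟩ x₂` (`lact`) and `α ▶ x = x₊ \bar{⟨α | x₋⟩}` (`ract`). These actions commute
(`lact_ract_comm`), the product of `L` induces a `Λ`-linear map `L ◇ L → L` for `▷` and, with its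
arguments exchanged, for `▶` (`lact_mul_equivariant`, `ract_mul_equivariant`), and
`⟨· | ·⟩ : Λ ◇ L → B` is `Λ`-linear for `▶` on `L` (`pairing_equivariant`). In these terms

* `Γ_F(x, y) = ε((F^α ▷ x) (F_α ▷ y))` (`form_eq`),
* `x ·_Γ y` is the product of `L` twisted by `F` along `▷` and also along `▶`
  (`dualCochain_cotwistMul`),
* `Γ^#(x ⊗ y) = F^α ▶ x ◇ F_α ▷ y` (`dualCochain_sharp`), and
* `[α | x] = ⟨F^α α | F_α ▶ x⟩` (`twisted_eq`).

So every twisted structure map is obtained from a bilinear map `μ` of `Λ`-modules by passing to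
`μ_F(m, n) = μ(F^α m, F_α n)`. The theorem then rests on two general facts. First,
`IsEquivariant.ev_assoc`: if `μ₂(μ₁(m, n), l) = ν₂(m, ν₁(n, l))`, where `μ₁` and `ν₁` are
`Λ`-linear on `◇`-products, then the same identity holds for the four twisted maps, by the cocycle
identity for `F`. Applied to multiplications, to the actions of `B` and to the pairing, this gives
the 2-cocycle identity for `Γ_F`, associativity of `·_Γ`, the rules for `s^F` and `t^F`, and the
axioms of a dual pairing for `[· | ·]`. Secondly, `IsTensor.twist`: invertibility of `F` says that
twisting a model of `M ◇_B N` gives a model of `M ◇_{B^F} N`. As `L ◇_B L` is a model of this kind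
for `▶` on the first factor and `▷` on the second (`comul_isTensor`), `Γ^#` is well defined and
bijective, and the identities for `Δ^F` and `Δ^Γ` can be checked in `Λ ◇_B Λ` and `L ◇_B L` and
their triple analogues, where the coproducts become `Δ(α) F` and `Δ(x)`.

The single relation between the two actions and the coproduct of `L` that enters is
`γ₁ ▶ x₁ ◇ γ₂ ▷ x₂ = x₁ \bar{ε(γ)} ◇ x₂` (`tensorAct_comul`); it yields the Takeuchi condition, the
counit axioms and the multiplicativity of `Δ^Γ`.
-/

namespace Bialgd

/-! ### Balanced tensor products by their universal property -/

section Universal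

variable {k : Type*} [Field k] {B : Type*}
  {M : Type*} [AddCommGroup M] [Module k M] {N : Type*} [AddCommGroup N] [Module k N]
  {P : Type*} [AddCommGroup P] [Module k P] {Q : Type*} [AddCommGroup Q] [Module k Q]
  {ρ : B → M →ₗ[k] M} {σ : B → N →ₗ[k] N}

theorem Bal.descendsToIso : DescendsToIso ρ σ (TensorProduct.lift (Bal.mk ρ σ)) := by
  have h : TensorProduct.lift (Bal.mk ρ σ) = (balRel ρ σ).mkQ := TensorProduct.ext' fun _ _ => rfl
  rw [h]
  exact ⟨Submodule.ker_mkQ _, Submodule.mkQ_surjective _⟩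

/-- The isomorphism `Bal ρ σ ≃ P` induced by a map `M ⊗ N → P` as in `DescendsToIso`. -/
noncomputable def DescendsToIso.equiv {f : M ⊗[k] N →ₗ[k] P} (D : DescendsToIso ρ σ f) :
    Bal ρ σ ≃ₗ[k] P :=
  (Submodule.quotEquivOfEq _ _ D.1.symm).trans (f.quotKerEquivOfSurjective D.2)

theorem DescendsToIso.equiv_mk {f : M →ₗ[k] N →ₗ[k] P}
    (D : DescendsToIso ρ σ (TensorProduct.lift f)) (m : M) (n : N) :
    D.equiv (Bal.mk ρ σ m n) = f m n := rfl

theorem DescendsToIso.induction {f : M →ₗ[k] N →ₗ[k] P}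
    (D : DescendsToIso ρ σ (TensorProduct.lift f)) {p : P → Prop} (z : P)
    (hmk : ∀ m n, p (f m n)) (hadd : ∀ x y, p x → p y → p (x + y)) : p z := by
  obtain ⟨w, rfl⟩ := D.equiv.surjective z
  induction w using Bal.induction with
  | hmk m n => exact hmk m n
  | hadd x y hx hy => rw [map_add]; exact hadd _ _ hx hy

theorem DescendsToIso.balanced {f : M →ₗ[k] N →ₗ[k] P}
    (D : DescendsToIso ρ σ (TensorProduct.lift f)) (b : B) (m : M) (n : N) :
    f (ρ b m) n = f m (σ b n) := by
  rw [← D.equiv_mk, ← D.equiv_mk, Bal.mk_bal]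

/-- Descent of a balanced bilinear map along a balanced tensor product `f : M × N → P`. -/
noncomputable def DescendsToIso.desc {f : M →ₗ[k] N →ₗ[k] P}
    (D : DescendsToIso ρ σ (TensorProduct.lift f)) (g : M →ₗ[k] N →ₗ[k] Q)
    (hg : ∀ b m n, g (ρ b m) n = g m (σ b n)) : P →ₗ[k] Q :=
  Bal.lift g hg ∘ₗ D.equiv.symm.toLinearMap

@[simp] theorem DescendsToIso.desc_apply {f : M →ₗ[k] N →ₗ[k] P}
    (D : DescendsToIso ρ σ (TensorProduct.lift f)) (g : M →ₗ[k] N →ₗ[k] Q)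
    (hg : ∀ b m n, g (ρ b m) n = g m (σ b n)) (m : M) (n : N) :
    D.desc g hg (f m n) = g m n := by
  rw [← D.equiv_mk m n]
  simp [desc]

/-- The second factor of a balanced tensor product may be replaced by an isomorphic one. -/
theorem DescendsToIso.comp_right {N' : Type*} [AddCommGroup N'] [Module k N']
    {σ' : B → N' →ₗ[k] N'} {f : M →ₗ[k] N →ₗ[k] P}
    (D : DescendsToIso ρ σ (TensorProduct.lift f)) (θ : N' ≃ₗ[k] N)
    (hθ : ∀ b n, θ (σ' b n) = σ b (θ n)) :
    DescendsToIso ρ σ' (TensorProduct.lift (f.compl₂ θ.toLinearMap)) := by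
  have e : TensorProduct.lift (f.compl₂ θ.toLinearMap) =
      TensorProduct.lift f ∘ₗ (LinearEquiv.lTensor M θ).toLinearMap :=
    TensorProduct.ext' fun m n => by simp
  have hθ' : ∀ b n, θ.symm (σ b n) = σ' b (θ.symm n) := fun b n => by
    rw [LinearEquiv.symm_apply_eq, hθ, LinearEquiv.apply_symm_apply]
  have key : balRel ρ σ ≤ (balRel ρ σ').comap (LinearEquiv.lTensor M θ.symm).toLinearMap := by
    refine Submodule.span_le.2 ?_
    rintro _ ⟨b, m, n, rfl⟩
    exact Submodule.subset_span ⟨b, m, θ.symm n, by simp [hθ']⟩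
  refine ⟨le_antisymm ?_ ?_, ?_⟩
  · intro z hz
    have h1 : LinearEquiv.lTensor M θ z ∈ balRel ρ σ := by
      rw [← D.1]
      rw [e] at hz
      exact hz
    have h2 := key h1
    have h3 : LinearEquiv.lTensor M θ.symm (LinearEquiv.lTensor M θ z) = z :=
      (LinearEquiv.lTensor M θ).symm_apply_apply z
    rw [← h3]
    exact h2
  · refine Submodule.span_le.2 ?_
    rintro _ ⟨b, m, n, rfl⟩
    simp [hθ, D.balanced]
  · rw [e]
    exact D.2.comp (LinearEquiv.lTensor M θ).surjective

end Universal

/-! ### Twisting bilinear maps by a two-cocycle -/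

section Equivariant

variable {k B Λ : Type u} [Field k] [Ring B] [Algebra k B] [Ring Λ] [Algebra k Λ]
  {M : Type u} [AddCommGroup M] [Module k M] {N : Type u} [AddCommGroup N] [Module k N]
  {P : Type u} [AddCommGroup P] [Module k P] {Q : Type u} [AddCommGroup Q] [Module k Q]
  {U : Type u} [AddCommGroup U] [Module k U] {V : Type u} [AddCommGroup V] [Module k V]

theorem BeRing.exists_sum {R : BeRing k B Λ} (w : R.Diamond) :
    ∃ (n : ℕ) (x y : Fin n → Λ), w = ∑ i, R.dmk (x i) (y i) := by
  obtain ⟨z, rfl⟩ : ∃ z, Bal.proj (R.tAct Λ) (R.sAct Λ) z = w := Submodule.mkQ_surjective _ w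
  obtain ⟨n, x, y, rfl⟩ := TensorProduct.exists_sum_tmul_eq z
  exact ⟨n, x, y, by rw [map_sum]; rfl⟩

theorem BeRing.dext_apply {R : BeRing k B Λ} {f g : R.Diamond →ₗ[k] P}
    (h : ∀ x y, f (R.dmk x y) = g (R.dmk x y)) (w : R.Diamond) : f w = g w := by
  induction w using BeRing.dind with
  | hmk x y => exact h x y
  | hadd v w hv hw => rw [map_add, map_add, hv, hw]

/-- Descent from `L ◇ L ◇ L`. -/
def BeRing.lift₃ (R : BeRing k B Λ) (f : Λ →ₗ[k] Λ →ₗ[k] Λ →ₗ[k] P)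
    (h₁ : ∀ b x y z, f (R.t b * x) y z = f x (R.s b * y) z)
    (h₂ : ∀ b x y z, f x (R.t b * y) z = f x y (R.s b * z)) : R.Diamond₃ →ₗ[k] P :=
  Bal.lift (ρ := R.tAct Λ) (σ := R.leftS) (R.dliftFam f (fun x b y z => h₂ b x y z)) (by
    intro b x w
    induction w using BeRing.dind with
    | hmk y z => exact h₁ b x y z
    | hadd v w hv hw => simp only [map_add, hv, hw])

/-- Descent from `L ◇ (L ◇ L)`. -/
def BeRing.lift₃' (R : BeRing k B Λ) (f : Λ →ₗ[k] R.Diamond →ₗ[k] P)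
    (h : ∀ b x w, f (R.t b * x) w = f x (R.leftS b w)) : R.Diamond₃ →ₗ[k] P :=
  Bal.lift (ρ := R.tAct Λ) (σ := R.leftS) f h

/-- Compatibility of a bilinear map with the relation `\bar b m ⊗ n = m ⊗ b n` defining `M ◇ N`,
for actions `ρ` and `σ` of `Λ` on `M` and `N`. -/
def IsBalanced (R : BeRing k B Λ) (ρ : Λ →ₐ[k] Module.End k M) (σ : Λ →ₐ[k] Module.End k N)
    (μ : M →ₗ[k] N →ₗ[k] P) : Prop :=
  ∀ b m n, μ (ρ (R.t b) m) n = μ m (σ (R.s b) n)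

variable {R : BeRing k B Λ} {ρ : Λ →ₐ[k] Module.End k M} {σ : Λ →ₐ[k] Module.End k N}
  {τ : Λ →ₐ[k] Module.End k P} {μ : M →ₗ[k] N →ₗ[k] P}

/-- `x ◇ y ↦ (m, n ↦ μ(x m, y n))`. At `F` this is the twist of `μ` by `F`. -/
def IsBalanced.ev (h : IsBalanced R ρ σ μ) : R.Diamond →ₗ[k] M →ₗ[k] N →ₗ[k] P :=
  R.dlift
    (LinearMap.mk₂ k (fun x y => μ.compl₁₂ (ρ x) (σ y))
      (by intros; ext; simp) (by intros; ext; simp)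
      (by intros; ext; simp) (by intros; ext; simp))
    (by intro b x y; ext m n; simpa using h b _ _)

@[simp] theorem IsBalanced.ev_dmk (h : IsBalanced R ρ σ μ) (x y : Λ) (m : M) (n : N) :
    h.ev (R.dmk x y) m n = μ (ρ x m) (σ y n) := rfl

theorem IsBalanced.ev_act (h : IsBalanced R ρ σ μ) (T : R.Diamond) (x y : Λ) (m : M) (n : N) :
    h.ev (R.act T x y) m n = h.ev T (ρ x m) (σ y n) := by
  induction T using BeRing.dind with
  | hmk a b => simp
  | hadd v w hv hw => simp [hv, hw]

/-- Twisting is natural. -/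
theorem IsBalanced.ev_map {M' N' : Type u} [AddCommGroup M'] [Module k M'] [AddCommGroup N']
    [Module k N'] {ρ' : Λ →ₐ[k] Module.End k M'} {σ' : Λ →ₐ[k] Module.End k N'}
    {μ' : M' →ₗ[k] N' →ₗ[k] Q} (h : IsBalanced R ρ σ μ) (h' : IsBalanced R ρ' σ' μ')
    (a : M → M') (b : N → N') (g : P →ₗ[k] Q) (ha : ∀ x m, a (ρ x m) = ρ' x (a m))
    (hb : ∀ x n, b (σ x n) = σ' x (b n)) (hg : ∀ m n, g (μ m n) = μ' (a m) (b n))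
    (T : R.Diamond) (m : M) (n : N) : g (h.ev T m n) = h'.ev T (a m) (b n) := by
  induction T using BeRing.dind with
  | hmk x y => simp [hg, ha, hb]
  | hadd v w hv hw => simp [hv, hw]

theorem IsBalanced.leftS_ev (h : IsBalanced R ρ σ μ) (c : B)
    (hc : ∀ m n, μ (ρ (R.s c) m) n = τ (R.s c) (μ m n)) (w : R.Diamond) (m : M) (n : N) :
    h.ev (R.leftS c w) m n = τ (R.s c) (h.ev w m n) := by
  induction w using BeRing.dind with
  | hmk x y => simp [hc]
  | hadd v w hv hw => simp [hv, hw]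

/-- A balanced bilinear map that induces a `Λ`-linear map `M ◇ N → P`. -/
structure IsEquivariant (H : LeftBialgebroid k B Λ) (ρ : Λ →ₐ[k] Module.End k M)
    (σ : Λ →ₐ[k] Module.End k N) (τ : Λ →ₐ[k] Module.End k P) (μ : M →ₗ[k] N →ₗ[k] P) : Prop where
  bal : IsBalanced H.toBeRing ρ σ μ
  map_act : ∀ x m n, τ x (μ m n) = bal.ev (H.comul x) m n

variable {H : LeftBialgebroid k B Λ}

theorem IsEquivariant.map_s (h : IsEquivariant H ρ σ τ μ) (c : B) (m : M) (n : N) :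
    τ (H.s c) (μ m n) = μ (ρ (H.s c) m) n := by
  rw [h.map_act, H.comul_s_one]
  simp

theorem IsEquivariant.map_t (h : IsEquivariant H ρ σ τ μ) (c : B) (m : M) (n : N) :
    τ (H.t c) (μ m n) = μ m (σ (H.t c) n) := by
  rw [h.map_act, H.comul_t_one]
  simp

theorem IsEquivariant.ev_comulAct (h : IsEquivariant H ρ σ τ μ) (x : Λ) (w : H.Diamond)
    (m : M) (n : N) : h.bal.ev (H.comulAct x w) m n = τ x (h.bal.ev w m n) := by
  induction w using BeRing.dind with
  | hmk a b => simp [h.bal.ev_act, h.map_act]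
  | hadd v w hv hw => simp [hv, hw]

/-- The Takeuchi condition makes `(m, n) ↦ μ(x₁ m, x₂ n)` balanced. -/
theorem IsBalanced.act_swap (h : IsBalanced H.toBeRing ρ σ μ) (x : Λ) (c : B) (m : M) (n : N) :
    h.ev (H.comul x) (ρ (H.t c) m) n = h.ev (H.comul x) m (σ (H.s c) n) := by
  have h1 := h.ev_act (H.comul x) (H.t c) 1 m n
  have h2 := h.ev_act (H.comul x) 1 (H.s c) m n
  rw [H.takeuchi, h2] at h1
  simpa using h1.symm

variable {ρU : Λ →ₐ[k] Module.End k U} {ρP : Λ →ₐ[k] Module.End k P}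
  {ρV : Λ →ₐ[k] Module.End k V}

/-- The identity `μ₂(μ₁(m, n), p) = ν₂(m, ν₁(n, p))` persists after evaluation at elements `G` and
`F` with `(Δ ◇ id)(G) F¹² = (id ◇ Δ)(G) F²³`. -/
theorem IsEquivariant.ev_assoc_of_eq {F G : H.Diamond}
    (hFG : (H.cocycleLeft F G : H.Diamond₃) = H.cocycleRight F G)
    {μ₁ : M →ₗ[k] N →ₗ[k] U} {μ₂ : U →ₗ[k] P →ₗ[k] Q}
    {ν₁ : N →ₗ[k] P →ₗ[k] V} {ν₂ : M →ₗ[k] V →ₗ[k] Q}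
    (h₁ : IsEquivariant H ρ σ ρU μ₁) (h₂ : IsBalanced H.toBeRing ρU ρP μ₂)
    (h₃ : IsEquivariant H σ ρP ρV ν₁) (h₄ : IsBalanced H.toBeRing ρ ρV ν₂)
    (assoc : ∀ m n p, μ₂ (μ₁ m n) p = ν₂ m (ν₁ n p)) (m : M) (n : N) (p : P) :
    h₂.ev G (h₁.bal.ev F m n) p = h₄.ev G m (h₃.bal.ev F n p) := by
  -- both sides are values of `x ◇ y ◇ z ↦ ν₂(x m, ν₁(y n, z p)) = μ₂(μ₁(x m, y n), z p)`
  let Ψ : H.Diamond₃ →ₗ[k] Q := H.lift₃'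
    (ν₂.compl₁₂ ((LinearMap.applyₗ m) ∘ₗ ρ.toLinearMap)
      ((LinearMap.applyₗ p) ∘ₗ (LinearMap.applyₗ n) ∘ₗ h₃.bal.ev)) (by
      intro b x w
      simp only [LinearMap.compl₁₂_apply, LinearMap.comp_apply, LinearMap.applyₗ_apply_apply,
        AlgHom.toLinearMap_apply, map_mul, Module.End.mul_apply]
      rw [h₄, h₃.bal.leftS_ev (τ := ρV) b (fun m n => (h₃.map_s b m n).symm)])
  have hΨ : ∀ x w, Ψ (H.mkRight x w) = ν₂ (ρ x m) (h₃.bal.ev w n p) := fun x w => rfl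
  have hR : ∀ G : H.Diamond, Ψ (H.cocycleRight F G) = h₄.ev G m (h₃.bal.ev F n p) := by
    intro G
    induction G using BeRing.dind with
    | hmk a b =>
      change Ψ (H.mkRight a (H.comulAct b F)) = _
      rw [hΨ, h₃.ev_comulAct, h₄.ev_dmk]
    | hadd v w hv hw => simp only [map_add, hv, hw, LinearMap.add_apply]
  have hL' : ∀ (w : H.Diamond) (b : Λ), Ψ (H.mkLeft w b) = μ₂ (h₁.bal.ev w m n) (ρP b p) := by
    intro w b
    induction w using BeRing.dind with
    | hmk x y => rw [BeRing.mkLeft_dmk, hΨ]; simp [assoc]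
    | hadd v w hv hw => simp only [map_add, hv, hw, LinearMap.add_apply]
  have hL : ∀ G : H.Diamond, Ψ (H.cocycleLeft F G) = h₂.ev G (h₁.bal.ev F m n) p := by
    intro G
    induction G using BeRing.dind with
    | hmk a b =>
      change Ψ (H.mkLeft (H.comulAct a F) b) = _
      rw [hL', h₁.ev_comulAct, h₂.ev_dmk]
    | hadd v w hv hw => simp only [map_add, hv, hw, LinearMap.add_apply]
  rw [← hL, ← hR, hFG]

/-- Twisting by a 2-cocycle preserves associativity. -/
theorem IsEquivariant.ev_assoc {F : H.Diamond} (hF : H.IsTwoCocycle F)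
    {μ₁ : M →ₗ[k] N →ₗ[k] U} {μ₂ : U →ₗ[k] P →ₗ[k] Q}
    {ν₁ : N →ₗ[k] P →ₗ[k] V} {ν₂ : M →ₗ[k] V →ₗ[k] Q}
    (h₁ : IsEquivariant H ρ σ ρU μ₁) (h₂ : IsBalanced H.toBeRing ρU ρP μ₂)
    (h₃ : IsEquivariant H σ ρP ρV ν₁) (h₄ : IsBalanced H.toBeRing ρ ρV ν₂)
    (assoc : ∀ m n p, μ₂ (μ₁ m n) p = ν₂ m (ν₁ n p)) (m : M) (n : N) (p : P) :
    h₂.ev F (h₁.bal.ev F m n) p = h₄.ev F m (h₃.bal.ev F n p) :=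
  IsEquivariant.ev_assoc_of_eq hF.cocycle h₁ h₂ h₃ h₄ assoc m n p

theorem IsBalanced.ev_sum (h : IsBalanced R ρ σ μ) {n : ℕ} {T : R.Diamond} {x y : Fin n → Λ}
    (e : T = ∑ i, R.dmk (x i) (y i)) (m : M) (l : N) :
    h.ev T m l = ∑ i, μ (ρ (x i) m) (σ (y i) l) := by
  rw [e]
  simp

/-- Twisting by means of one action of `Λ` preserves equivariance for a second action that commutes
with it. -/
theorem IsEquivariant.flip_ev {ρ' : Λ →ₐ[k] Module.End k M} {σ' : Λ →ₐ[k] Module.End k N}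
    (h : IsEquivariant H ρ σ τ μ) (h' : IsBalanced H.toBeRing σ' ρ' μ.flip)
    (hρ : ∀ x y m, ρ x (ρ' y m) = ρ' y (ρ x m)) (hσ : ∀ x y n, σ x (σ' y n) = σ' y (σ x n))
    (T : H.Diamond) : IsEquivariant H ρ σ τ (h'.ev T).flip := by
  obtain ⟨n, a, b, e⟩ := BeRing.exists_sum T
  have hT : ∀ m l, (h'.ev T).flip m l = ∑ i, μ (ρ' (b i) m) (σ' (a i) l) := fun m l =>
    h'.ev_sum e l m
  have hbal : IsBalanced H.toBeRing ρ σ (h'.ev T).flip := fun c m l => by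
    rw [hT, hT]
    refine Finset.sum_congr rfl fun i _ => ?_
    rw [← hρ, h.bal, hσ]
  refine ⟨hbal, fun x m l => ?_⟩
  obtain ⟨n', a', b', e'⟩ := BeRing.exists_sum (H.comul x)
  rw [hT, map_sum, IsBalanced.ev_sum hbal e']
  simp only [hT, h.map_act, h.bal.ev_sum e', hρ, hσ]
  exact Finset.sum_comm

/-- The twists by means of two commuting pairs of actions may be formed in either order. -/
theorem IsBalanced.ev_flip_comm {ρ' : Λ →ₐ[k] Module.End k M} {σ' : Λ →ₐ[k] Module.End k N}
    (h : IsBalanced R ρ σ μ) (h' : IsBalanced R σ' ρ' μ.flip)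
    (hρ : ∀ x y m, ρ x (ρ' y m) = ρ' y (ρ x m)) (hσ : ∀ x y n, σ x (σ' y n) = σ' y (σ x n))
    (S T : R.Diamond) (hS : IsBalanced R ρ σ (h'.ev T).flip)
    (hT : IsBalanced R σ' ρ' (h.ev S).flip) (m : M) (n : N) : hS.ev S m n = hT.ev T n m := by
  obtain ⟨i, a, b, e⟩ := BeRing.exists_sum S
  obtain ⟨i', a', b', e'⟩ := BeRing.exists_sum T
  simp only [hS.ev_sum e, hT.ev_sum e', LinearMap.flip_apply, h.ev_sum e, h'.ev_sum e', hρ, hσ]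
  exact Finset.sum_comm

/-- A model `μ : M × N → P` of the tensor product `M ◇ N`. -/
def IsTensor (R : BeRing k B Λ) (ρ : Λ →ₐ[k] Module.End k M) (σ : Λ →ₐ[k] Module.End k N)
    (μ : M →ₗ[k] N →ₗ[k] P) : Prop :=
  DescendsToIso (fun b => ρ (R.t b)) (fun b => σ (R.s b)) (TensorProduct.lift μ)

theorem IsTensor.isBalanced (D : IsTensor R ρ σ μ) : IsBalanced R ρ σ μ :=
  DescendsToIso.balanced D

theorem IsTensor.induction (D : IsTensor R ρ σ μ) {p : P → Prop} (z : P)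
    (hmk : ∀ m n, p (μ m n)) (hadd : ∀ x y, p x → p y → p (x + y)) : p z :=
  DescendsToIso.induction D z hmk hadd

/-- Descent of a balanced bilinear map along a model of `M ◇ N`. -/
noncomputable def IsTensor.desc (D : IsTensor R ρ σ μ) {g : M →ₗ[k] N →ₗ[k] Q}
    (hg : IsBalanced R ρ σ g) : P →ₗ[k] Q := DescendsToIso.desc D g hg

@[simp] theorem IsTensor.desc_apply (D : IsTensor R ρ σ μ) {g : M →ₗ[k] N →ₗ[k] Q}
    (hg : IsBalanced R ρ σ g) (m : M) (n : N) : D.desc hg (μ m n) = g m n :=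
  DescendsToIso.desc_apply D g hg m n

/-- The action of an element of `Λ` on `M ◇ N`. -/
noncomputable def tensorEnd (H : LeftBialgebroid k B Λ) (D : IsTensor H.toBeRing ρ σ μ) (x : Λ) :
    P →ₗ[k] P :=
  D.desc (g := D.isBalanced.ev (H.comul x)) (D.isBalanced.act_swap x)

theorem tensorEnd_apply (D : IsTensor H.toBeRing ρ σ μ) (x : Λ) (m : M) (n : N) :
    tensorEnd H D x (μ m n) = D.isBalanced.ev (H.comul x) m n :=
  D.desc_apply _ m n

/-- The action of `Λ` on `M ◇ N`. -/
noncomputable def tensorAct (H : LeftBialgebroid k B Λ) (D : IsTensor H.toBeRing ρ σ μ) :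
    Λ →ₐ[k] Module.End k P :=
  AlgHom.ofLinearMap
    { toFun := tensorEnd H D
      map_add' := fun x y => LinearMap.ext fun z => by
        induction z using D.induction with
        | hmk m n => simp [tensorEnd_apply]
        | hadd v w hv hw => simp only [map_add, hv, hw]
      map_smul' := fun c x => LinearMap.ext fun z => by
        induction z using D.induction with
        | hmk m n => simp [tensorEnd_apply]
        | hadd v w hv hw => simp only [map_add, hv, hw] }
    (LinearMap.ext fun z => by
      change tensorEnd H D 1 z = z
      induction z using D.induction with
      | hmk m n => simp [tensorEnd_apply, H.comul_one]
      | hadd v w hv hw => simp only [map_add, hv, hw])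
    (fun x y => LinearMap.ext fun z => by
      change tensorEnd H D (x * y) z = tensorEnd H D x (tensorEnd H D y z)
      induction z using D.induction with
      | hmk m n =>
        simp only [tensorEnd_apply, H.comul_mul]
        induction H.comul y using BeRing.dind with
        | hmk a b => simp [tensorEnd_apply, IsBalanced.ev_act]
        | hadd v w hv hw => simp only [map_add, hv, hw, LinearMap.add_apply]
      | hadd v w hv hw => simp only [map_add, hv, hw])

theorem IsTensor.isEquivariant (D : IsTensor H.toBeRing ρ σ μ) :
    IsEquivariant H ρ σ (tensorAct H D) μ :=
  ⟨D.isBalanced, fun x m n => tensorEnd_apply D x m n⟩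

theorem comulAct_dmk_one (x : Λ) : H.comulAct x (H.dmk 1 1) = H.comul x := by
  rw [H.comulAct_dmk]
  have h : ∀ T : H.Diamond, H.act T (1 : Λ) (1 : Λ) = T := fun T => by
    induction T using BeRing.dind with
    | hmk a b => simp
    | hadd v w hv hw => simp only [map_add, LinearMap.add_apply, hv, hw]
  exact h _

/-- If `m, n, p ↦ ν₂(m, ν₁(n, p))` is made of `Λ`-linear maps, then the map `M ◇ N × P → Q` that it
induces is `Λ`-linear, by coassociativity. -/
theorem IsTensor.equivariant_of_assoc {τQ : Λ →ₐ[k] Module.End k Q}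
    {μ₁ : M →ₗ[k] N →ₗ[k] U} {μ₂ : U →ₗ[k] P →ₗ[k] Q}
    {ν₁ : N →ₗ[k] P →ₗ[k] V} {ν₂ : M →ₗ[k] V →ₗ[k] Q}
    (h₁ : IsTensor H.toBeRing ρ σ μ₁) (h₂ : IsBalanced H.toBeRing (tensorAct H h₁) ρP μ₂)
    (h₃ : IsEquivariant H σ ρP ρV ν₁) (h₄ : IsEquivariant H ρ ρV τQ ν₂)
    (assoc : ∀ m n p, μ₂ (μ₁ m n) p = ν₂ m (ν₁ n p)) :
    IsEquivariant H (tensorAct H h₁) ρP τQ μ₂ := by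
  have hone : ∀ {M' N' P' : Type u} [AddCommGroup M'] [Module k M'] [AddCommGroup N']
      [Module k N'] [AddCommGroup P'] [Module k P'] {α : Λ →ₐ[k] Module.End k M'}
      {β : Λ →ₐ[k] Module.End k N'} {μ' : M' →ₗ[k] N' →ₗ[k] P'}
      (h : IsBalanced H.toBeRing α β μ') (m : M') (n : N'),
      h.ev (H.dmk 1 1) m n = μ' m n := fun h m n => by simp
  refine ⟨h₂, fun x u p => ?_⟩
  induction u using h₁.induction with
  | hmk m n =>
    -- coassociativity is the identity of `ev_assoc_of_eq` with `1 ◇ 1` for `F` and `Δ(x)` for `G`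
    have hx : (H.cocycleLeft (H.dmk 1 1) (H.comul x) : H.Diamond₃) =
        H.cocycleRight (H.dmk 1 1) (H.comul x) := by
      have hl : ∀ T, H.cocycleLeft (H.dmk 1 1) T = H.comulLeft T := fun T =>
        BeRing.dext_apply (fun a b => congrArg (H.mkLeft · b) (comulAct_dmk_one a)) T
      have hr : ∀ T, H.cocycleRight (H.dmk 1 1) T = H.comulRight T := fun T =>
        BeRing.dext_apply (fun a b => congrArg (H.mkRight a) (comulAct_dmk_one b)) T
      rw [hl, hr, H.coassoc]
    have h := IsEquivariant.ev_assoc_of_eq hx h₁.isEquivariant h₂ h₃ h₄.bal assoc m n p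
    rw [hone, hone] at h
    rw [h, assoc, h₄.map_act]
  | hadd v w hv hw => simp only [map_add, LinearMap.add_apply, hv, hw]

/-- Invertibility of `F`, for an arbitrary model of `M ◇_B N`: the twist of the model by `F` is a
model of `M ◇_{B^F} N`. -/
theorem IsTensor.twist {F : H.Diamond} (hFinv : H.IsInvertible F)
    (D : IsTensor H.toBeRing ρ σ μ) :
    DescendsToIso (fun b => ρ (H.twistT F b)) (fun b => σ (H.twistS F b))
      (TensorProduct.lift (D.isBalanced.ev F)) := by
  -- `IsInvertible` speaks of modules, so the actions `ρ` and `σ` are turned into module structures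
  let _ : Module Λ M := Module.compHom M ρ.toRingHom
  let _ : Module Λ N := Module.compHom N σ.toRingHom
  have _ : IsScalarTower k Λ M := ⟨fun c x m => by
    change ρ (c • x) m = c • ρ x m
    simp⟩
  have _ : IsScalarTower k Λ N := ⟨fun c x m => by
    change σ (c • x) m = c • σ x m
    simp⟩
  have h : DescendsToIso (fun b => ρ (H.twistT F b)) (fun b => σ (H.twistS F b))
      (H.sharp F M N) := hFinv M N
  let κ : H.MDiamond M N →ₗ[k] P := H.dlift μ D.isBalanced
  have e : TensorProduct.lift (D.isBalanced.ev F) = κ ∘ₗ H.sharp F M N := by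
    refine TensorProduct.ext' fun m n => ?_
    have hT : ∀ T : H.Diamond, D.isBalanced.ev T m n = κ (H.act T m n) := fun T => by
      induction T using BeRing.dind with
      | hmk x y => rfl
      | hadd v w hv hw => simp only [map_add, LinearMap.add_apply, hv, hw]
    exact hT F
  have hκ : Function.Bijective κ := by
    have hz : ∀ z, κ z = DescendsToIso.equiv D z := fun z => by
      induction z using BeRing.dind with
      | hmk m n => rfl
      | hadd v w hv hw => rw [map_add, hv, hw]; exact (map_add (DescendsToIso.equiv D) v w).symm
    rw [show (κ : H.MDiamond M N → P) = DescendsToIso.equiv D from funext hz]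
    exact (DescendsToIso.equiv D).bijective
  rw [e]
  refine ⟨?_, hκ.2.comp h.2⟩
  rw [LinearMap.ker_comp_of_ker_eq_bot _ (LinearMap.ker_eq_bot.2 hκ.1), h.1]

end Equivariant

/-! ### The twisted source and target maps -/

section Base

variable {k B Λ : Type u} [Field k] [Ring B] [Algebra k B] [Ring Λ] [Algebra k Λ]
  (H : LeftBialgebroid k B Λ)
  {M : Type u} [AddCommGroup M] [Module k M] {N : Type u} [AddCommGroup N] [Module k N]
  {P : Type u} [AddCommGroup P] [Module k P]

theorem LeftBialgebroid.counit_s_one (b : B) : H.counit (H.s b) = b := by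
  simpa [H.counit_one] using H.counit_s b 1

theorem LeftBialgebroid.counit_t_one (b : B) : H.counit (H.t b) = b := by
  simpa [H.counit_one] using H.counit_t b 1

theorem LeftBialgebroid.counit_mul_t_eq (x : Λ) (b : B) :
    H.counit (x * H.t b) = H.counit (x * H.s b) := by
  rw [H.counit_mul_s, H.counit_t_one]

theorem LeftBialgebroid.comul_mul_s (x : Λ) (b : B) :
    H.comul (x * H.s b) = H.act (H.comul x) (H.s b) (1 : Λ) := by
  rw [H.comul_mul, H.comul_s_one, H.comulAct_dmk]

theorem LeftBialgebroid.comul_mul_t (x : Λ) (b : B) :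
    H.comul (x * H.t b) = H.act (H.comul x) (1 : Λ) (H.t b) := by
  rw [H.comul_mul, H.comul_t_one, H.comulAct_dmk]

/-- The action `x . b = ε(x b)` of `Λ` on the base algebra. -/
def baseAct : Λ →ₐ[k] Module.End k B :=
  AlgHom.ofLinearMap
    (LinearMap.mk₂ k (fun x b => H.counit (x * H.s b)) (by intros; simp [add_mul]) (by intros; simp)
      (by intros; simp [mul_add]) (by intros; simp))
    (LinearMap.ext fun b => by simp [H.counit_s_one])
    (fun x y => LinearMap.ext fun b => by
      change H.counit (x * y * H.s b) = H.counit (x * H.s (H.counit (y * H.s b)))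
      rw [mul_assoc, H.counit_mul_s])

@[simp] theorem baseAct_apply (x : Λ) (b : B) : baseAct H x b = H.counit (x * H.s b) := rfl

variable (ρ : Λ →ₐ[k] Module.End k M)

/-- `(b, m) ↦ b m`. -/
def leftBase : B →ₗ[k] M →ₗ[k] M := ρ.toLinearMap ∘ₗ H.s.toLinearMap

/-- `(m, b) ↦ \bar b m`. -/
def rightBase : M →ₗ[k] B →ₗ[k] M := (ρ.toLinearMap ∘ₗ H.t).flip

@[simp] theorem leftBase_apply (b : B) (m : M) : leftBase H ρ b m = ρ (H.s b) m := rfl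

@[simp] theorem rightBase_apply (m : M) (b : B) : rightBase H ρ m b = ρ (H.t b) m := rfl

theorem leftBase_balanced : IsBalanced H.toBeRing (baseAct H) ρ (leftBase H ρ) := by
  intro c b m
  rw [baseAct_apply, H.counit_t, H.counit_s_one]
  simp

theorem rightBase_balanced : IsBalanced H.toBeRing ρ (baseAct H) (rightBase H ρ) := by
  intro c m b
  rw [baseAct_apply, H.counit_s, H.counit_s_one]
  simp [H.t_mul]

theorem leftBase_equivariant : IsEquivariant H (baseAct H) ρ ρ (leftBase H ρ) := by
  refine ⟨leftBase_balanced H ρ, fun x b m => ?_⟩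
  have h : ∀ T : H.Diamond, (leftBase_balanced H ρ).ev T b m =
      ρ (H.counitLeft (H.act T (H.s b) (1 : Λ))) m := fun T => by
    induction T using BeRing.dind with
    | hmk x y => simp [ComulData.counitLeft]
    | hadd v w hv hw => simp [hv, hw]
  rw [h, ← H.comul_mul_s, H.counit_comul_left]
  simp

theorem rightBase_equivariant : IsEquivariant H ρ (baseAct H) ρ (rightBase H ρ) := by
  refine ⟨rightBase_balanced H ρ, fun x m b => ?_⟩
  have h : ∀ T : H.Diamond, (rightBase_balanced H ρ).ev T m b =
      ρ (H.counitRight (H.act T (1 : Λ) (H.t b))) m := fun T => by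
    induction T using BeRing.dind with
    | hmk x y => simp [ComulData.counitRight, H.counit_mul_t_eq]
    | hadd v w hv hw => simp [hv, hw]
  rw [h, ← H.comul_mul_t, H.counit_comul_right]
  simp

/-- Twisting `b, m ↦ b m` gives the action of `s^F(b)`. -/
theorem leftBase_ev (F : H.Diamond) (b : B) (m : M) :
    (leftBase_balanced H ρ).ev F b m = ρ (H.twistS F b) m := by
  have hadd : ∀ v w, H.twistS (v + w) b = H.twistS v b + H.twistS w b := fun v w => map_add _ v w
  induction F using BeRing.dind with
  | hmk x y =>
    change ρ (H.s (H.counit (x * H.s b))) (ρ y m) = ρ (H.s (H.counit (x * H.s b)) * y) m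
    simp
  | hadd v w hv hw => simp [hv, hw, hadd]

/-- Twisting `m, b ↦ \bar b m` gives the action of `t^F(b)`. -/
theorem rightBase_ev (F : H.Diamond) (b : B) (m : M) :
    (rightBase_balanced H ρ).ev F m b = ρ (H.twistT F b) m := by
  have hadd : ∀ v w, H.twistT (v + w) b = H.twistT v b + H.twistT w b := fun v w => map_add _ v w
  induction F using BeRing.dind with
  | hmk x y =>
    change ρ (H.t (H.counit (y * H.s b))) (ρ x m) = ρ (H.t (H.counit (y * H.s b)) * x) m
    simp
  | hadd v w hv hw => simp [hv, hw, hadd]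

variable {H ρ}

theorem baseAct_twistS (F : H.Diamond) (a b : B) :
    baseAct H (H.twistS F a) b = H.twistBaseMul F a b := by
  rw [← leftBase_ev]
  have hadd : ∀ v w, H.twistBaseMul (v + w) a b = H.twistBaseMul v a b + H.twistBaseMul w a b :=
    fun v w => map_add _ v w
  induction F using BeRing.dind with
  | hmk x y =>
    change H.counit (H.s (H.counit (x * H.s a)) * H.s (H.counit (y * H.s b))) =
      H.counit (x * H.s a) * H.counit (y * H.s b)
    rw [H.counit_s, H.counit_s_one]
  | hadd v w hv hw => simp only [map_add, LinearMap.add_apply, hv, hw, hadd]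

theorem baseAct_twistT (F : H.Diamond) (a b : B) :
    baseAct H (H.twistT F b) a = H.twistBaseMul F a b := by
  rw [← rightBase_ev]
  have hadd : ∀ v w, H.twistBaseMul (v + w) a b = H.twistBaseMul v a b + H.twistBaseMul w a b :=
    fun v w => map_add _ v w
  induction F using BeRing.dind with
  | hmk x y =>
    change H.counit (H.t (H.counit (y * H.s b)) * H.s (H.counit (x * H.s a))) =
      H.counit (x * H.s a) * H.counit (y * H.s b)
    rw [H.counit_t, H.counit_s_one]
  | hadd v w hv hw => simp only [map_add, LinearMap.add_apply, hv, hw, hadd]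

variable {F : H.Diamond} (hF : H.IsTwoCocycle F) {σ : Λ →ₐ[k] Module.End k N}
  {τ : Λ →ₐ[k] Module.End k P} {μ : M →ₗ[k] N →ₗ[k] P}
include hF

theorem IsEquivariant.ev_twistS (h : IsEquivariant H ρ σ τ μ) (b : B) (m : M) (n : N) :
    h.bal.ev F (ρ (H.twistS F b) m) n = τ (H.twistS F b) (h.bal.ev F m n) := by
  rw [← leftBase_ev, ← leftBase_ev]
  exact IsEquivariant.ev_assoc hF (leftBase_equivariant H ρ) h.bal h (leftBase_balanced H τ)
    (fun b m n => (h.map_s b m n).symm) b m n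

theorem IsBalanced.ev_twist (h : IsBalanced H.toBeRing ρ σ μ) (b : B) (m : M) (n : N) :
    h.ev F (ρ (H.twistT F b) m) n = h.ev F m (σ (H.twistS F b) n) := by
  rw [← leftBase_ev, ← rightBase_ev]
  exact IsEquivariant.ev_assoc hF (rightBase_equivariant H ρ) h (leftBase_equivariant H σ) h
    (fun m b n => h b m n) m b n

theorem IsEquivariant.ev_twistT (h : IsEquivariant H ρ σ τ μ) (b : B) (m : M) (n : N) :
    h.bal.ev F m (σ (H.twistT F b) n) = τ (H.twistT F b) (h.bal.ev F m n) := by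
  rw [← rightBase_ev, ← rightBase_ev]
  exact (IsEquivariant.ev_assoc hF h (rightBase_balanced H τ) (rightBase_equivariant H σ) h.bal
    (fun m n b => h.map_t b m n) m n b).symm

theorem twistS_one : H.twistS F 1 = 1 := by
  rw [← hF.counit_left]
  have h : ∀ T : H.Diamond, H.twistS T 1 = H.counitLeft T := fun T => by
    have hadd : ∀ v w, H.twistS (v + w) 1 = H.twistS v 1 + H.twistS w 1 := fun v w => map_add _ v w
    induction T using BeRing.dind with
    | hmk x y =>
      change H.s (H.counit (x * H.s 1)) * y = H.s (H.counit x) * y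
      simp
    | hadd v w hv hw => rw [hadd, map_add, hv, hw]
  exact h F

theorem twistT_one : H.twistT F 1 = 1 := by
  rw [← hF.counit_right]
  have h : ∀ T : H.Diamond, H.twistT T 1 = H.counitRight T := fun T => by
    have hadd : ∀ v w, H.twistT (v + w) 1 = H.twistT v 1 + H.twistT w 1 := fun v w => map_add _ v w
    induction T using BeRing.dind with
    | hmk x y =>
      change H.t (H.counit (y * H.s 1)) * x = H.t (H.counit y) * x
      simp
    | hadd v w hv hw => rw [hadd, map_add, hv, hw]
  exact h F

theorem twistS_mul (a b : B) :
    H.twistS F (H.twistBaseMul F a b) = H.twistS F a * H.twistS F b := by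
  have h := (leftBase_equivariant H (Algebra.lsmul k k Λ)).ev_twistS hF a b 1
  rw [baseAct_twistS, leftBase_ev, leftBase_ev] at h
  simpa using h

theorem twistT_mul (a b : B) :
    H.twistT F (H.twistBaseMul F a b) = H.twistT F b * H.twistT F a := by
  have h := (rightBase_equivariant H (Algebra.lsmul k k Λ)).ev_twistT hF b 1 a
  rw [baseAct_twistT, rightBase_ev, rightBase_ev] at h
  simpa using h

theorem twistS_twistT_comm (a b : B) :
    H.twistS F a * H.twistT F b = H.twistT F b * H.twistS F a := by
  have h := (rightBase_equivariant H (Algebra.lsmul k k Λ)).ev_twistS hF a 1 b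
  rw [rightBase_ev, rightBase_ev] at h
  simpa using h.symm

theorem twistBaseMul_one (a : B) : H.twistBaseMul F a 1 = a := by
  rw [← baseAct_twistT, twistT_one hF]
  simp

theorem one_twistBaseMul (a : B) : H.twistBaseMul F 1 a = a := by
  rw [← baseAct_twistS, twistS_one hF]
  simp

theorem twistBaseMul_assoc (a b c : B) :
    H.twistBaseMul F (H.twistBaseMul F a b) c = H.twistBaseMul F a (H.twistBaseMul F b c) := by
  simp only [← baseAct_twistS (H := H) F _ c, ← baseAct_twistS (H := H) F a]
  rw [baseAct_twistS F a b, twistS_mul hF, map_mul]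
  rfl

end Base

section TwistBase

/-- The ring structure on a vector space given by an associative unital bilinear product. -/
abbrev ringOfBilinear {k A : Type*} [Field k] [AddCommGroup A] [Module k A]
    (m : A →ₗ[k] A →ₗ[k] A) (e : A) (assoc : ∀ a b c, m (m a b) c = m a (m b c))
    (one_mul : ∀ a, m e a = a) (mul_one : ∀ a, m a e = a) : Ring A :=
  { (inferInstance : AddCommGroup A) with
    mul := fun a b => m a b
    one := e
    left_distrib := fun a b c => map_add (m a) b c
    right_distrib := fun a b c => LinearMap.map_add₂ m a b c
    zero_mul := fun a => LinearMap.map_zero₂ m a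
    mul_zero := fun a => map_zero (m a)
    mul_assoc := assoc
    one_mul := one_mul
    mul_one := mul_one }

variable {k B Λ : Type u} [Field k] [Ring B] [Algebra k B] [Ring Λ] [Algebra k Λ]
  {H : LeftBialgebroid k B Λ} {F : H.Diamond}

variable (F) in
theorem twistBaseMul_eq (a b : B) :
    (leftBase_balanced H (baseAct H)).ev F a b = H.twistBaseMul F a b := by
  rw [leftBase_ev, baseAct_twistS]

/-- The algebra `B^F`: the vector space `B` with the product `·_F`. -/
def TwistBase (_ : H.IsTwoCocycle F) : Type u := B

variable (hF : H.IsTwoCocycle F)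

instance : AddCommGroup (TwistBase hF) := inferInstanceAs (AddCommGroup B)

instance : Module k (TwistBase hF) := inferInstanceAs (Module k B)

/-- The identity map `B → B^F`. -/
def toTwistBase : B ≃ₗ[k] TwistBase hF := LinearEquiv.refl k B

/-- The product of `B^F`, as a bilinear map. -/
def twistBaseMulₗ : TwistBase hF →ₗ[k] TwistBase hF →ₗ[k] TwistBase hF :=
  (leftBase_balanced H (baseAct H)).ev F

theorem twistBaseMulₗ_apply (a b : B) :
    twistBaseMulₗ hF (toTwistBase hF a) (toTwistBase hF b) =
      toTwistBase hF (H.twistBaseMul F a b) :=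
  twistBaseMul_eq F a b

instance : Ring (TwistBase hF) :=
  ringOfBilinear (twistBaseMulₗ hF) (toTwistBase hF 1)
    (fun a b c => by
      obtain ⟨a, rfl⟩ := (toTwistBase hF).surjective a
      obtain ⟨b, rfl⟩ := (toTwistBase hF).surjective b
      obtain ⟨c, rfl⟩ := (toTwistBase hF).surjective c
      simp only [twistBaseMulₗ_apply, twistBaseMul_assoc hF])
    (fun a => by
      obtain ⟨a, rfl⟩ := (toTwistBase hF).surjective a
      simp only [twistBaseMulₗ_apply, one_twistBaseMul hF])
    (fun a => by
      obtain ⟨a, rfl⟩ := (toTwistBase hF).surjective a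
      simp only [twistBaseMulₗ_apply, twistBaseMul_one hF])

theorem toTwistBase_mul (a b : B) : toTwistBase hF a * toTwistBase hF b =
    toTwistBase hF (H.twistBaseMul F a b) := twistBaseMulₗ_apply hF a b

instance : Algebra k (TwistBase hF) :=
  Algebra.ofModule (fun c a b => LinearMap.map_smul₂ (twistBaseMulₗ hF) c a b)
    (fun c a b => map_smul (twistBaseMulₗ hF a) c b)

end TwistBase

/-! ### Xu's twist -/

section Xu

variable {k B Λ : Type u} [Field k] [Ring B] [Algebra k B] [Ring Λ] [Algebra k Λ]
  {H : LeftBialgebroid k B Λ} {F : H.Diamond} (hF : H.IsTwoCocycle F)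

theorem dmk_isTensor (R : BeRing k B Λ) :
    IsTensor R (Algebra.lsmul k k Λ) (Algebra.lsmul k k Λ) (R.dmk (M := Λ) (N := Λ)) :=
  Bal.descendsToIso

variable (F) in
/-- The source map `s^F`, as a linear map. -/
def twistSₗ : B →ₗ[k] Λ :=
  LinearMap.flip ((leftBase_balanced H (Algebra.lsmul k k Λ)).ev F) 1

variable (F) in
/-- The target map `t^F`, as a linear map. -/
def twistTₗ : B →ₗ[k] Λ := (rightBase_balanced H (Algebra.lsmul k k Λ)).ev F 1

variable (F) in
theorem twistSₗ_apply (b : B) : twistSₗ F b = H.twistS F b := by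
  change (leftBase_balanced H (Algebra.lsmul k k Λ)).ev F b 1 = _
  rw [leftBase_ev]
  simp

variable (F) in
theorem twistTₗ_apply (b : B) : twistTₗ F b = H.twistT F b := by
  change (rightBase_balanced H (Algebra.lsmul k k Λ)).ev F 1 b = _
  rw [rightBase_ev]
  simp

/-- The ring `Λ` over `B^F`. -/
noncomputable def xuBeRing : BeRing k (TwistBase hF) Λ where
  s := AlgHom.ofLinearMap (twistSₗ F ∘ₗ (toTwistBase hF).symm.toLinearMap)
    ((twistSₗ_apply F 1).trans (twistS_one hF))
    (fun a b => by
      obtain ⟨a, rfl⟩ := (toTwistBase hF).surjective a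
      obtain ⟨b, rfl⟩ := (toTwistBase hF).surjective b
      simp [toTwistBase_mul, twistSₗ_apply, twistS_mul hF])
  t := twistTₗ F ∘ₗ (toTwistBase hF).symm.toLinearMap
  t_one := (twistTₗ_apply F 1).trans (twistT_one hF)
  t_mul := fun a b => by
    obtain ⟨a, rfl⟩ := (toTwistBase hF).surjective a
    obtain ⟨b, rfl⟩ := (toTwistBase hF).surjective b
    simp [toTwistBase_mul, twistTₗ_apply, twistT_mul hF]
  comm := fun a b => by
    obtain ⟨a, rfl⟩ := (toTwistBase hF).surjective a
    obtain ⟨b, rfl⟩ := (toTwistBase hF).surjective b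
    change twistSₗ F a * twistTₗ F b = twistTₗ F b * twistSₗ F a
    simp only [twistSₗ_apply, twistTₗ_apply, twistS_twistT_comm hF]

theorem xuBeRing_s (b : B) : (xuBeRing hF).s (toTwistBase hF b) = H.twistS F b :=
  twistSₗ_apply F b

theorem xuBeRing_t (b : B) : (xuBeRing hF).t (toTwistBase hF b) = H.twistT F b :=
  twistTₗ_apply F b

theorem xuBeRing_tAct : (xuBeRing hF).tAct Λ = fun b : B => Algebra.lsmul k k Λ (H.twistT F b) :=
  funext fun b => congrArg (Algebra.lsmul k k Λ) (xuBeRing_t hF b)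

theorem xuBeRing_sAct : (xuBeRing hF).sAct Λ = fun b : B => Algebra.lsmul k k Λ (H.twistS F b) :=
  funext fun b => congrArg (Algebra.lsmul k k Λ) (xuBeRing_s hF b)

variable (hFinv : H.IsInvertible F)

theorem xu_descendsToIso (hFinv : H.IsInvertible F) :
    DescendsToIso ((xuBeRing hF).tAct Λ) ((xuBeRing hF).sAct Λ)
      (TensorProduct.lift (H.act (M := Λ) (N := Λ) F)) := by
  rw [xuBeRing_tAct, xuBeRing_sAct]
  exact hFinv Λ Λ

/-- The isomorphism `F^# : Λ ◇_{B^F} Λ → Λ ◇_B Λ`. -/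
noncomputable def xuEquiv : (xuBeRing hF).Diamond ≃ₗ[k] H.Diamond :=
  (xu_descendsToIso hF hFinv).equiv

theorem xuEquiv_dmk (x y : Λ) : xuEquiv hF hFinv ((xuBeRing hF).dmk x y) = H.act F x y := rfl

theorem xuEquiv_lift (z : Λ ⊗[k] Λ) :
    xuEquiv hF hFinv (TensorProduct.lift (xuBeRing hF).dmk z) = H.sharp F Λ Λ z := by
  induction z with
  | zero => simp
  | tmul x y => rfl
  | add v w hv hw => simp only [map_add, hv, hw]

theorem act_eq_ev (T : H.Diamond) (x y : Λ) :
    H.act T x y = (dmk_isTensor H.toBeRing).isBalanced.ev T x y := by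
  induction T using BeRing.dind with
  | hmk a b => rfl
  | hadd v w hv hw => simp only [map_add, LinearMap.add_apply, hv, hw]

theorem tensorAct_dmk (x : Λ) (w : H.Diamond) :
    tensorAct H (dmk_isTensor H.toBeRing) x w = H.comulAct x w := by
  induction w using BeRing.dind with
  | hmk a b =>
    rw [H.comulAct_dmk, act_eq_ev]
    exact tensorEnd_apply _ _ _ _
  | hadd v w hv hw => simp only [map_add, hv, hw]

theorem xuEquiv_leftS (b : B) (w : (xuBeRing hF).Diamond) :
    xuEquiv hF hFinv ((xuBeRing hF).leftS (toTwistBase hF b) w) =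
      H.comulAct (H.twistS F b) (xuEquiv hF hFinv w) := by
  induction w using BeRing.dind with
  | hmk x y =>
    rw [BeRing.leftS_dmk, xuEquiv_dmk, xuEquiv_dmk, xuBeRing_s, act_eq_ev, act_eq_ev,
      ← tensorAct_dmk]
    exact (dmk_isTensor H.toBeRing).isEquivariant.ev_twistS hF b x y
  | hadd v w hv hw => simp only [map_add, hv, hw]

theorem xuEquiv_rightT (b : B) (w : (xuBeRing hF).Diamond) :
    xuEquiv hF hFinv ((xuBeRing hF).rightT (toTwistBase hF b) w) =
      H.comulAct (H.twistT F b) (xuEquiv hF hFinv w) := by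
  induction w using BeRing.dind with
  | hmk x y =>
    rw [BeRing.rightT_dmk, xuEquiv_dmk, xuEquiv_dmk, xuBeRing_t, act_eq_ev, act_eq_ev,
      ← tensorAct_dmk]
    exact (dmk_isTensor H.toBeRing).isEquivariant.ev_twistT hF b x y
  | hadd v w hv hw => simp only [map_add, hv, hw]

theorem comulAct_mul (x y : Λ) (w : H.Diamond) :
    H.comulAct (x * y) w = H.comulAct x (H.comulAct y w) := by
  simp only [← tensorAct_dmk, map_mul, Module.End.mul_apply]

theorem comulAct_one (w : H.Diamond) : H.comulAct 1 w = w := by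
  simp only [← tensorAct_dmk, map_one, Module.End.one_apply]

theorem act_comulAct (x : Λ) (T : H.Diamond) (a b : Λ) :
    H.act (H.comulAct x T) a b = H.comulAct x (H.act T a b) := by
  induction T using BeRing.dind with
  | hmk y z =>
    rw [H.comulAct_dmk, BeRing.act_dmk, H.comulAct_dmk]
    exact (H.act_mul (H.comul x) y z a b).symm
  | hadd v w hv hw => simp only [map_add, LinearMap.add_apply, hv, hw]

/-- `Δ^F(x) = (F^#)⁻¹(Δ(x) F)`. -/
noncomputable def xuComul : Λ →ₗ[k] (xuBeRing hF).Diamond :=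
  (xuEquiv hF hFinv).symm.toLinearMap ∘ₗ H.comulAct.flip F

theorem xuEquiv_comul (x : Λ) : xuEquiv hF hFinv (xuComul hF hFinv x) = H.comulAct x F :=
  (xuEquiv hF hFinv).apply_symm_apply _

theorem xuEquiv_act (T : (xuBeRing hF).Diamond) (a b : Λ) :
    xuEquiv hF hFinv ((xuBeRing hF).act T a b) = H.act (xuEquiv hF hFinv T) a b := by
  induction T using BeRing.dind with
  | hmk x y =>
    rw [BeRing.act_dmk, xuEquiv_dmk, xuEquiv_dmk]
    exact H.act_mul F x y a b
  | hadd v w hv hw => simp only [map_add, LinearMap.add_apply, hv, hw]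

/-- Comultiplication and counit of `Λ^F`. -/
noncomputable def xuComulData : ComulData k (TwistBase hF) Λ where
  toBeRing := xuBeRing hF
  comul := xuComul hF hFinv
  counit := (toTwistBase hF).toLinearMap ∘ₗ H.counit
  comul_s := fun b x => by
    obtain ⟨b, rfl⟩ := (toTwistBase hF).surjective b
    apply (xuEquiv hF hFinv).injective
    rw [xuEquiv_leftS, xuEquiv_comul, xuEquiv_comul, xuBeRing_s, comulAct_mul]
  comul_t := fun b x => by
    obtain ⟨b, rfl⟩ := (toTwistBase hF).surjective b
    apply (xuEquiv hF hFinv).injective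
    rw [xuEquiv_rightT, xuEquiv_comul, xuEquiv_comul, xuBeRing_t, comulAct_mul]
  takeuchi := fun x b => by
    apply (xuEquiv hF hFinv).injective
    rw [xuEquiv_act, xuEquiv_act, xuEquiv_comul, act_comulAct, act_comulAct, ← xuEquiv_dmk hF hFinv,
      ← xuEquiv_dmk hF hFinv]
    have h := (xuBeRing hF).dmk_bal' b 1 1
    rw [mul_one, mul_one] at h
    rw [h]
  counit_s := fun b x => by
    obtain ⟨b, rfl⟩ := (toTwistBase hF).surjective b
    change toTwistBase hF (H.counit _) = toTwistBase hF b * toTwistBase hF (H.counit x)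
    rw [xuBeRing_s, toTwistBase_mul, ← baseAct_twistS, baseAct_apply, H.counit_mul_s]
  counit_t := fun b x => by
    obtain ⟨b, rfl⟩ := (toTwistBase hF).surjective b
    change toTwistBase hF (H.counit _) = toTwistBase hF (H.counit x) * toTwistBase hF b
    rw [xuBeRing_t, toTwistBase_mul, ← baseAct_twistT, baseAct_apply, H.counit_mul_s]

theorem xu_comulAct (x : Λ) (w : (xuBeRing hF).Diamond) :
    xuEquiv hF hFinv ((xuComulData hF hFinv).comulAct x w) =
      H.comulAct x (xuEquiv hF hFinv w) := by
  let f : (xuBeRing hF).Diamond →ₗ[k] (xuBeRing hF).Diamond := (xuComulData hF hFinv).comulAct x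
  refine BeRing.dext_apply (f := (xuEquiv hF hFinv).toLinearMap ∘ₗ f)
    (g := H.comulAct x ∘ₗ (xuEquiv hF hFinv).toLinearMap) (fun y z => ?_) w
  change xuEquiv hF hFinv ((xuBeRing hF).act (xuComul hF hFinv x) y z) = _
  rw [xuEquiv_act, xuEquiv_comul, act_comulAct]
  rfl

/-- `Λ ◇ Λ ◇ Λ` is a model of `Λ ◇ (Λ ◇ Λ)`, with the diagonal action of `Λ` on the
second factor. -/
theorem mkRight_isTensor : IsTensor H.toBeRing (Algebra.lsmul k k Λ)
    (tensorAct H (dmk_isTensor H.toBeRing)) H.mkRight := by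
  have h : (fun b => tensorAct H (dmk_isTensor H.toBeRing) (H.s b)) = H.leftS :=
    funext fun b => LinearMap.ext fun w => by
      rw [tensorAct_dmk, ← mul_one (H.s b), H.comulAct_s, comulAct_one]
  rw [IsTensor, h]
  exact Bal.descendsToIso

/-- The isomorphism `Λ ◇_{B^F} Λ ◇_{B^F} Λ → Λ ◇_B Λ ◇_B Λ`, `x ◇ w ↦ F^#(x ⊗ F^#(w))`. -/
noncomputable def xuEquiv₃ : (xuBeRing hF).Diamond₃ ≃ₗ[k] H.Diamond₃ := by
  refine DescendsToIso.equiv (ρ := (xuBeRing hF).tAct Λ) (σ := (xuBeRing hF).leftS)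
    (f := TensorProduct.lift ((mkRight_isTensor.isBalanced.ev F).compl₂
      (xuEquiv hF hFinv).toLinearMap)) ?_
  rw [xuBeRing_tAct]
  exact (mkRight_isTensor.twist hFinv).comp_right (xuEquiv hF hFinv) fun b w => by
    rw [tensorAct_dmk]
    exact xuEquiv_leftS hF hFinv b w

theorem xuEquiv₃_mkRight (x : Λ) (w : (xuBeRing hF).Diamond) :
    xuEquiv₃ hF hFinv ((xuBeRing hF).mkRight x w) =
      mkRight_isTensor.isBalanced.ev F x (xuEquiv hF hFinv w) := rfl

theorem mkLeft_balanced : IsBalanced H.toBeRing (tensorAct H (dmk_isTensor H.toBeRing))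
    (Algebra.lsmul k k Λ) H.mkLeft := by
  intro b w z
  rw [tensorAct_dmk, ← mul_one (H.t b), H.comulAct_t, comulAct_one]
  exact H.mkLeft_bal b w z

/-- Right multiplication of `Λ ◇ Λ ◇ Λ` by `a ⊗ b ⊗ c`. -/
def BeRing.act₃ (R : BeRing k B Λ) (a b c : Λ) : R.Diamond₃ →ₗ[k] R.Diamond₃ := R.lift₃
  (LinearMap.mk₂ k (fun x y => R.mkRight (x * a) ∘ₗ R.dmk (y * b) ∘ₗ LinearMap.mulRight k c)
    (by intros; ext; simp [add_mul]) (by intros; ext; simp)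
    (by intros; ext; simp [add_mul]) (by intros; ext; simp))
  (fun d x y z => by simp [mul_assoc, R.mkRight_bal])
  (fun d x y z => by simp [mul_assoc, R.dmk_bal'])

theorem BeRing.act₃_mkRight (R : BeRing k B Λ) (a b c x : Λ) (w : R.Diamond) :
    R.act₃ a b c (R.mkRight x w) = R.mkRight (x * a) (R.act w b c) := by
  induction w using BeRing.dind with
  | hmk y z => rfl
  | hadd v w hv hw => simp only [map_add, LinearMap.add_apply, hv, hw]

theorem BeRing.act₃_mkLeft (R : BeRing k B Λ) (a b c : Λ) (w : R.Diamond) (z : Λ) :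
    R.act₃ a b c (R.mkLeft w z) = R.mkLeft (R.act w a b) (z * c) := by
  induction w using BeRing.dind with
  | hmk x y => rfl
  | hadd v w hv hw => simp only [map_add, LinearMap.add_apply, hv, hw]

theorem mkLeft_equivariant : IsEquivariant H (tensorAct H (dmk_isTensor H.toBeRing))
    (Algebra.lsmul k k Λ) (tensorAct H mkRight_isTensor) H.mkLeft := by
  refine ⟨mkLeft_balanced, fun x w c => ?_⟩
  induction w using BeRing.dind with
  | hmk a b =>
    have h₁ : ∀ T : H.Diamond, mkRight_isTensor.isBalanced.ev T a (H.dmk b c) =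
        H.act₃ a b c (H.comulRight T) := fun T => by
      induction T using BeRing.dind with
      | hmk y z =>
        rw [IsBalanced.ev_dmk, tensorAct_dmk, H.comulAct_dmk]
        exact (H.act₃_mkRight a b c y (H.comul z)).symm
      | hadd v w hv hw => simp only [map_add, LinearMap.add_apply, hv, hw]
    have h₂ : ∀ T : H.Diamond, mkLeft_balanced.ev T (H.dmk a b) c =
        H.act₃ a b c (H.comulLeft T) := fun T => by
      induction T using BeRing.dind with
      | hmk y z =>
        rw [IsBalanced.ev_dmk, tensorAct_dmk, H.comulAct_dmk]
        exact (H.act₃_mkLeft a b c (H.comul y) z).symm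
      | hadd v w hv hw => simp only [map_add, LinearMap.add_apply, hv, hw]
    rw [BeRing.mkLeft_dmk, mkRight_isTensor.isEquivariant.map_act, h₁, h₂, H.coassoc]
  | hadd v w hv hw => simp only [map_add, LinearMap.add_apply, hv, hw]

theorem cocycleRight_act (T : H.Diamond) (x y : Λ) :
    H.cocycleRight F (H.act T x y) =
      mkRight_isTensor.isBalanced.ev T x (H.comulAct y F) := by
  induction T using BeRing.dind with
  | hmk a b =>
    change H.mkRight (a * x) (H.comulAct (b * y) F) = _
    rw [comulAct_mul, IsBalanced.ev_dmk, tensorAct_dmk]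
    rfl
  | hadd v w hv hw => simp only [map_add, LinearMap.add_apply, hv, hw]

theorem cocycleLeft_act (T : H.Diamond) (x y : Λ) :
    H.cocycleLeft F (H.act T x y) = mkLeft_balanced.ev T (H.comulAct x F) y := by
  induction T using BeRing.dind with
  | hmk a b =>
    change H.mkLeft (H.comulAct (a * x) F) (b * y) = _
    rw [comulAct_mul, IsBalanced.ev_dmk, tensorAct_dmk]
    rfl
  | hadd v w hv hw => simp only [map_add, LinearMap.add_apply, hv, hw]

theorem cocycleRight_comulAct (x : Λ) (G : H.Diamond) :
    H.cocycleRight F (H.comulAct x G) = tensorAct H mkRight_isTensor x (H.cocycleRight F G) := by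
  induction G using BeRing.dind with
  | hmk a b =>
    rw [H.comulAct_dmk, cocycleRight_act]
    exact (mkRight_isTensor.isEquivariant.map_act x a (H.comulAct b F)).symm
  | hadd v w hv hw => simp only [map_add, hv, hw]

theorem cocycleLeft_comulAct (x : Λ) (G : H.Diamond) :
    H.cocycleLeft F (H.comulAct x G) = tensorAct H mkRight_isTensor x (H.cocycleLeft F G) := by
  induction G using BeRing.dind with
  | hmk a b =>
    rw [H.comulAct_dmk, cocycleLeft_act]
    exact (mkLeft_equivariant.map_act x (H.comulAct a F) b).symm
  | hadd v w hv hw => simp only [map_add, hv, hw]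

/-- By the cocycle identity, `xuEquiv₃` has the same form for the other bracketing of the triple
product. -/
theorem xuEquiv₃_mkLeft (w : (xuBeRing hF).Diamond) (z : Λ) :
    xuEquiv₃ hF hFinv ((xuBeRing hF).mkLeft w z) =
      mkLeft_balanced.ev F (xuEquiv hF hFinv w) z := by
  induction w using BeRing.dind with
  | hmk x y =>
    rw [BeRing.mkLeft_dmk, xuEquiv₃_mkRight, xuEquiv_dmk, xuEquiv_dmk, act_eq_ev, act_eq_ev]
    exact (IsEquivariant.ev_assoc hF (dmk_isTensor H.toBeRing).isEquivariant mkLeft_balanced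
      (dmk_isTensor H.toBeRing).isEquivariant mkRight_isTensor.isBalanced
      (fun _ _ _ => rfl) x y z).symm
  | hadd v w hv hw => simp only [map_add, LinearMap.add_apply, hv, hw]

theorem xuEquiv₃_comulLeft (T : (xuBeRing hF).Diamond) :
    xuEquiv₃ hF hFinv ((xuComulData hF hFinv).comulLeft T) =
      H.cocycleLeft F (xuEquiv hF hFinv T) := by
  let f : (xuBeRing hF).Diamond →ₗ[k] (xuBeRing hF).Diamond₃ := (xuComulData hF hFinv).comulLeft
  refine BeRing.dext_apply (f := (xuEquiv₃ hF hFinv).toLinearMap ∘ₗ f)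
    (g := H.cocycleLeft F ∘ₗ (xuEquiv hF hFinv).toLinearMap) (fun x y => ?_) T
  change xuEquiv₃ hF hFinv ((xuBeRing hF).mkLeft (xuComul hF hFinv x) y) =
    H.cocycleLeft F (xuEquiv hF hFinv ((xuBeRing hF).dmk x y))
  rw [xuEquiv₃_mkLeft, xuEquiv_comul, xuEquiv_dmk, cocycleLeft_act]

theorem xuEquiv₃_comulRight (T : (xuBeRing hF).Diamond) :
    xuEquiv₃ hF hFinv ((xuComulData hF hFinv).comulRight T) =
      H.cocycleRight F (xuEquiv hF hFinv T) := by
  let f : (xuBeRing hF).Diamond →ₗ[k] (xuBeRing hF).Diamond₃ := (xuComulData hF hFinv).comulRight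
  refine BeRing.dext_apply (f := (xuEquiv₃ hF hFinv).toLinearMap ∘ₗ f)
    (g := H.cocycleRight F ∘ₗ (xuEquiv hF hFinv).toLinearMap) (fun x y => ?_) T
  change xuEquiv₃ hF hFinv ((xuBeRing hF).mkRight x (xuComul hF hFinv y)) =
    H.cocycleRight F (xuEquiv hF hFinv ((xuBeRing hF).dmk x y))
  rw [xuEquiv₃_mkRight, xuEquiv_comul, xuEquiv_dmk, cocycleRight_act]

theorem xu_counitLeft (T : (xuBeRing hF).Diamond) :
    (xuComulData hF hFinv).counitLeft T = H.counitLeft (xuEquiv hF hFinv T) := by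
  let f : (xuBeRing hF).Diamond →ₗ[k] Λ := (xuComulData hF hFinv).counitLeft
  refine BeRing.dext_apply (f := f)
    (g := H.counitLeft ∘ₗ (xuEquiv hF hFinv).toLinearMap) (fun x y => ?_) T
  change (xuBeRing hF).s (toTwistBase hF (H.counit x)) * y = H.counitLeft (H.act F x y)
  have h : ∀ G : H.Diamond, H.counitLeft (H.act G x y) =
      (leftBase_balanced H (Algebra.lsmul k k Λ)).ev G (H.counit x) y := fun G => by
    induction G using BeRing.dind with
    | hmk a b =>
      change H.s (H.counit (a * x)) * (b * y) = H.s (H.counit (a * H.s (H.counit x))) * (b * y)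
      rw [H.counit_mul_s]
    | hadd v w hv hw => simp only [map_add, LinearMap.add_apply, hv, hw]
  rw [h, leftBase_ev, xuBeRing_s]
  rfl

theorem xu_counitRight (T : (xuBeRing hF).Diamond) :
    (xuComulData hF hFinv).counitRight T = H.counitRight (xuEquiv hF hFinv T) := by
  let f : (xuBeRing hF).Diamond →ₗ[k] Λ := (xuComulData hF hFinv).counitRight
  refine BeRing.dext_apply (f := f)
    (g := H.counitRight ∘ₗ (xuEquiv hF hFinv).toLinearMap) (fun x y => ?_) T
  change (xuBeRing hF).t (toTwistBase hF (H.counit y)) * x = H.counitRight (H.act F x y)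
  have h : ∀ G : H.Diamond, H.counitRight (H.act G x y) =
      (rightBase_balanced H (Algebra.lsmul k k Λ)).ev G x (H.counit y) := fun G => by
    induction G using BeRing.dind with
    | hmk a b =>
      change H.t (H.counit (b * y)) * (a * x) = H.t (H.counit (b * H.s (H.counit y))) * (a * x)
      rw [H.counit_mul_s]
    | hadd v w hv hw => simp only [map_add, LinearMap.add_apply, hv, hw]
  rw [h, rightBase_ev, xuBeRing_t]
  rfl

theorem counitLeft_comulAct (x : Λ) (G : H.Diamond) :
    H.counitLeft (H.comulAct x G) = x * H.counitLeft G := by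
  induction G using BeRing.dind with
  | hmk c d =>
    have h : ∀ T : H.Diamond, H.counitLeft (H.act T c d) =
        H.counitLeft (H.act T (H.s (H.counit c)) (1 : Λ)) * d := fun T => by
      induction T using BeRing.dind with
      | hmk a b =>
        change H.s (H.counit (a * c)) * (b * d) =
          H.s (H.counit (a * H.s (H.counit c))) * (b * 1) * d
        rw [H.counit_mul_s, mul_one, mul_assoc]
      | hadd v w hv hw => simp only [map_add, LinearMap.add_apply, hv, hw, add_mul]
    rw [H.comulAct_dmk, h, ← H.comul_mul_s, H.counit_comul_left, mul_assoc]
    rfl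
  | hadd v w hv hw => simp only [map_add, hv, hw, mul_add]

theorem counitRight_comulAct (x : Λ) (G : H.Diamond) :
    H.counitRight (H.comulAct x G) = x * H.counitRight G := by
  induction G using BeRing.dind with
  | hmk c d =>
    have h : ∀ T : H.Diamond, H.counitRight (H.act T c d) =
        H.counitRight (H.act T (1 : Λ) (H.t (H.counit d))) * c := fun T => by
      induction T using BeRing.dind with
      | hmk a b =>
        change H.t (H.counit (b * d)) * (a * c) =
          H.t (H.counit (b * H.t (H.counit d))) * (a * 1) * c
        rw [H.counit_mul_t, mul_one, mul_assoc]
      | hadd v w hv hw => simp only [map_add, LinearMap.add_apply, hv, hw, add_mul]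
    rw [H.comulAct_dmk, h, ← H.comul_mul_t, H.counit_comul_right, mul_assoc]
    rfl
  | hadd v w hv hw => simp only [map_add, hv, hw, mul_add]

theorem act_one_one (T : H.Diamond) : H.act T (1 : Λ) (1 : Λ) = T := by
  induction T using BeRing.dind with
  | hmk a b => simp
  | hadd v w hv hw => simp only [map_add, LinearMap.add_apply, hv, hw]

include hF in
theorem counit_twistS (b : B) : H.counit (H.twistS F b) = b := by
  simpa using (baseAct_twistS F b 1).trans (twistBaseMul_one hF b)

include hF in
theorem counit_twistT (b : B) : H.counit (H.twistT F b) = b := by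
  simpa using (baseAct_twistT F 1 b).trans (one_twistBaseMul hF b)

/-- Xu's twist `Λ^F`. -/
noncomputable def xuTwist : LeftBialgebroid k (TwistBase hF) Λ where
  toComulData := xuComulData hF hFinv
  coassoc := fun x => by
    apply (xuEquiv₃ hF hFinv).injective
    refine (xuEquiv₃_comulLeft hF hFinv _).trans ?_
    refine Eq.trans ?_ (xuEquiv₃_comulRight hF hFinv _).symm
    change H.cocycleLeft F (xuEquiv hF hFinv (xuComul hF hFinv x)) =
      H.cocycleRight F (xuEquiv hF hFinv (xuComul hF hFinv x))
    rw [xuEquiv_comul, cocycleLeft_comulAct, cocycleRight_comulAct, hF.cocycle]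
  counit_comul_left := fun x => by
    refine (xu_counitLeft hF hFinv _).trans ?_
    change H.counitLeft (xuEquiv hF hFinv (xuComul hF hFinv x)) = x
    rw [xuEquiv_comul, counitLeft_comulAct, hF.counit_left, mul_one]
  counit_comul_right := fun x => by
    refine (xu_counitRight hF hFinv _).trans ?_
    change H.counitRight (xuEquiv hF hFinv (xuComul hF hFinv x)) = x
    rw [xuEquiv_comul, counitRight_comulAct, hF.counit_right, mul_one]
  comul_one := by
    apply (xuEquiv hF hFinv).injective
    refine (xuEquiv_comul hF hFinv 1).trans ?_
    rw [comulAct_one]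
    refine Eq.trans ?_ (xuEquiv_dmk hF hFinv 1 1).symm
    rw [act_one_one]
  comul_mul := fun x y => by
    apply (xuEquiv hF hFinv).injective
    refine (xuEquiv_comul hF hFinv _).trans ?_
    refine Eq.trans ?_ (xu_comulAct hF hFinv x _).symm
    rw [comulAct_mul]
    exact congrArg _ (xuEquiv_comul hF hFinv y).symm
  counit_one := congrArg (toTwistBase hF) H.counit_one
  counit_mul_s := fun x y => by
    change toTwistBase hF (H.counit (x * y)) =
      toTwistBase hF (H.counit (x * (xuBeRing hF).s (toTwistBase hF (H.counit y))))
    rw [xuBeRing_s, H.counit_mul_s x (H.twistS F _), counit_twistS hF]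
    exact congrArg _ (H.counit_mul_s x y)
  counit_mul_t := fun x y => by
    change toTwistBase hF (H.counit (x * y)) =
      toTwistBase hF (H.counit (x * (xuBeRing hF).t (toTwistBase hF (H.counit y))))
    rw [xuBeRing_t, H.counit_mul_s x (H.twistT F _), counit_twistT hF]
    exact congrArg _ (H.counit_mul_s x y)

theorem xuTwist_isXuTwist : IsXuTwist H F (toTwistBase hF) (xuTwist hF hFinv) where
  base_mul := toTwistBase_mul hF
  base_one := rfl
  source := xuBeRing_s hF
  target := xuBeRing_t hF
  counit := fun _ => rfl
  comul := fun x z hz => by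
    rw [← xuEquiv_lift hF hFinv]
    exact (congrArg (xuEquiv hF hFinv) hz).trans (xuEquiv_comul hF hFinv x)

end Xu

/-! ### The translation map -/

section Translation

variable {k B L : Type u} [Field k] [Ring B] [Algebra k B] [Ring L] [Algebra k L]
  {K : LeftBialgebroid k B L} (hK : K.IsLeftHopf)

theorem BeRing.exists_sum_bar {R : BeRing k B L} (w : R.Bar) :
    ∃ (n : ℕ) (x y : Fin n → L), w = ∑ i, R.bmk (x i) (y i) := by
  obtain ⟨z, rfl⟩ : ∃ z, Bal.proj R.mulT R.tMul z = w := Submodule.mkQ_surjective _ w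
  obtain ⟨n, x, y, rfl⟩ := TensorProduct.exists_sum_tmul_eq z
  exact ⟨n, x, y, by rw [map_sum]; rfl⟩

theorem comulAct_s_eq (b : B) (w : K.Diamond) : K.comulAct (K.s b) w = K.leftS b w := by
  rw [← mul_one (K.s b), K.comulAct_s, comulAct_one]

theorem comulAct_t_eq (b : B) (w : K.Diamond) : K.comulAct (K.t b) w = K.rightT b w := by
  rw [← mul_one (K.t b), K.comulAct_t, comulAct_one]

/-- The inverse of `λ`, with `λ⁻¹(x ◇ y) = x₊ ⊗ x₋ y`. -/
noncomputable def lamInv : K.Diamond ≃ₗ[k] K.Bar := (LinearEquiv.ofBijective K.lam hK).symm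

theorem lamInv_lam (w : K.Bar) : lamInv hK (K.lam w) = w :=
  (LinearEquiv.ofBijective K.lam hK).symm_apply_apply w

theorem lamInv_dmk (x y : L) :
    lamInv hK (K.dmk x y) = K.barR y (LeftBialgebroid.trans hK x) := by
  rw [← lamInv_lam hK (K.barR y _), LeftBialgebroid.lam_barR, LeftBialgebroid.lam_trans]
  simp

theorem lamInv_leftS (b : B) (w : K.Diamond) :
    lamInv hK (K.leftS b w) = K.barL (K.s b) (lamInv hK w) := by
  obtain ⟨v, rfl⟩ := hK.2 w
  rw [← LeftBialgebroid.lam_barL_s, lamInv_lam, lamInv_lam]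

theorem lamInv_comul (x : L) : lamInv hK (K.comul x) = K.bmk x 1 := by
  rw [← lamInv_lam hK (K.bmk x 1), LeftBialgebroid.lam_bmk, act_one_one]

theorem barR_mul (a b : L) (w : K.Bar) : K.barR (a * b) w = K.barR b (K.barR a w) := by
  induction w using BeRing.bind with
  | hmk x y => simp [mul_assoc]
  | hadd v w hv hw => simp only [map_add, hv, hw]

theorem barL_barR (a b : L) (w : K.Bar) : K.barL a (K.barR b w) = K.barR b (K.barL a w) := by
  induction w using BeRing.bind with
  | hmk x y => simp
  | hadd v w hv hw => simp only [map_add, hv, hw]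

theorem trans_t_mul (b : B) (x : L) : LeftBialgebroid.trans hK (K.t b * x) =
    K.barR (K.s b) (LeftBialgebroid.trans hK x) := by
  apply hK.1
  rw [LeftBialgebroid.lam_barR, LeftBialgebroid.lam_trans, LeftBialgebroid.lam_trans, K.dmk_bal']
  simp

theorem trans_one : LeftBialgebroid.trans hK 1 = K.bmk 1 1 := by
  apply hK.1
  rw [LeftBialgebroid.lam_trans, LeftBialgebroid.lam_bmk, act_one_one, K.comul_one]

theorem trans_t (b : B) : LeftBialgebroid.trans hK (K.t b) = K.bmk 1 (K.s b) := by
  simpa [trans_one] using trans_t_mul hK b 1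

theorem trans_s (b : B) : LeftBialgebroid.trans hK (K.s b) = K.bmk (K.s b) 1 := by
  simpa [trans_one] using LeftBialgebroid.trans_s_mul hK b 1

theorem lam_barL (a : L) (w : K.Bar) : K.lam (K.barL a w) = K.comulAct a (K.lam w) := by
  induction w using BeRing.bind with
  | hmk x y =>
    rw [BeRing.barL_bmk, LeftBialgebroid.lam_bmk, LeftBialgebroid.lam_bmk, ← K.comulAct_dmk,
      ← K.comulAct_dmk, comulAct_mul]
  | hadd v w hv hw => simp only [map_add, hv, hw]

/-- `(x y)₊ ⊗ (x y)₋ = x₊ y₊ ⊗ y₋ x₋`. -/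
theorem trans_mul {n : ℕ} {u v : Fin n → L} {x : L}
    (hx : LeftBialgebroid.trans hK x = ∑ i, K.bmk (u i) (v i)) (y : L) :
    LeftBialgebroid.trans hK (x * y) =
      ∑ i, K.barL (u i) (K.barR (v i) (LeftBialgebroid.trans hK y)) := by
  apply hK.1
  have h : K.act (K.lam (LeftBialgebroid.trans hK x)) y (1 : L) = K.dmk (x * y) 1 := by
    rw [LeftBialgebroid.lam_trans, BeRing.act_dmk, smul_eq_mul, smul_eq_mul, mul_one]
  rw [hx] at h
  simp only [map_sum, LinearMap.sum_apply, LeftBialgebroid.lam_bmk, ← K.act_mul, one_mul,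
    mul_one] at h
  rw [LeftBialgebroid.lam_trans, map_sum]
  simp only [lam_barL, LeftBialgebroid.lam_barR, LeftBialgebroid.lam_trans, BeRing.act_dmk,
    K.comulAct_dmk]
  simpa using h.symm

theorem trans_mul_t {n : ℕ} {u v : Fin n → L} {x : L}
    (hx : LeftBialgebroid.trans hK x = ∑ i, K.bmk (u i) (v i)) (b : B) :
    LeftBialgebroid.trans hK (x * K.t b) = ∑ i, K.bmk (u i) (K.s b * v i) := by
  rw [trans_mul hK hx]
  simp [trans_t]

/-- Both sides are `u₁ ◇ u₂ b ◇ u₃ v`. -/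
theorem cocycleRight_comul (b v u : L) : K.cocycleRight (K.dmk b v) (K.comul u) =
    K.cocycleLeft (K.dmk 1 b) (K.act (K.comul u) (1 : L) v) := by
  have h₁ : ∀ T : K.Diamond, K.cocycleRight (K.dmk b v) T = K.act₃ 1 b v (K.comulRight T) :=
    fun T => by
      refine BeRing.dext_apply (g := K.act₃ 1 b v ∘ₗ K.comulRight) (fun x y => ?_) T
      change K.mkRight x (K.comulAct y (K.dmk b v)) = K.act₃ 1 b v (K.mkRight x (K.comul y))
      rw [K.act₃_mkRight, mul_one, K.comulAct_dmk]
  have h₂ : ∀ T : K.Diamond, K.cocycleLeft (K.dmk 1 b) (K.act T (1 : L) v) =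
      K.act₃ 1 b v (K.comulLeft T) := fun T => by
    induction T using BeRing.dind with
    | hmk x y =>
      change K.mkLeft (K.comulAct (x * 1) (K.dmk 1 b)) (y * v) =
        K.act₃ 1 b v (K.mkLeft (K.comul x) y)
      rw [K.act₃_mkLeft, mul_one, K.comulAct_dmk]
    | hadd v w hv hw => simp only [map_add, LinearMap.add_apply, hv, hw]
  rw [h₁, h₂, K.coassoc]

end Translation

/-! ### The two actions of `Λ` on `L` -/

section Actions

variable {k B Λ L : Type u} [Field k] [Ring B] [Algebra k B] [Ring Λ] [Algebra k Λ]
  [Ring L] [Algebra k L] {H : LeftBialgebroid k B Λ} {K : LeftBialgebroid k B L}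
  {p : Λ →ₗ[k] L →ₗ[k] B} (hp : IsDualPairing H K p) (hK : K.IsLeftHopf)

/-- `x ◇ y ↦ ⟨α | x⟩ y`. -/
def contractLeft : Λ →ₗ[k] K.Diamond →ₗ[k] L :=
  K.dliftFam (p.compr₂ (LinearMap.mul k L ∘ₗ K.s.toLinearMap)) (fun α b x y => by
    simp [hp.balanced.t_arg, mul_assoc])

@[simp] theorem contractLeft_dmk (α : Λ) (x y : L) :
    contractLeft hp α (K.dmk x y) = K.s (p α x) * y := rfl

theorem contractLeft_s_mul (b : B) (α : Λ) (w : K.Diamond) :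
    contractLeft hp (H.s b * α) w = K.s b * contractLeft hp α w := by
  induction w using BeRing.dind with
  | hmk x y => simp [hp.balanced.s_left, mul_assoc]
  | hadd v w hv hw => simp only [map_add, mul_add, hv, hw]

theorem contractLeft_t_mul (b : B) (α : Λ) (w : K.Diamond) :
    contractLeft hp (H.t b * α) w = contractLeft hp α (K.act w (K.t b) (1 : L)) := by
  induction w using BeRing.dind with
  | hmk x y => simp [hp.balanced.t_left]
  | hadd v w hv hw => simp only [map_add, LinearMap.add_apply, hv, hw]

theorem contractLeft_mul_s (b : B) (α : Λ) (w : K.Diamond) :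
    contractLeft hp (α * H.s b) w = contractLeft hp α (K.leftS b w) := by
  induction w using BeRing.dind with
  | hmk x y => simp [hp.balanced.s_right]
  | hadd v w hv hw => simp only [map_add, hv, hw]

theorem contractLeft_act (α : Λ) (w : K.Diamond) (y : L) :
    contractLeft hp α (K.act w (1 : L) y) = contractLeft hp α w * y := by
  induction w using BeRing.dind with
  | hmk a b => simp [mul_assoc]
  | hadd v w hv hw => simp only [map_add, LinearMap.add_apply, add_mul, hv, hw]

theorem contractLeft_rightT (α : Λ) (b : B) (w : K.Diamond) :
    contractLeft hp α (K.rightT b w) = K.t b * contractLeft hp α w := by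
  induction w using BeRing.dind with
  | hmk x y => simp [← mul_assoc, K.comm]
  | hadd v w hv hw => simp only [map_add, mul_add, hv, hw]

/-- The action `α ▷ x = ⟨α | x₁⟩ x₂` of `Λ` on `L`. -/
def lact : Λ →ₐ[k] Module.End k L :=
  AlgHom.ofLinearMap ((contractLeft hp).compl₂ K.comul)
    (LinearMap.ext fun x => by
      have h : ∀ w, contractLeft hp 1 w = K.counitLeft w := fun w =>
        BeRing.dext_apply (fun x y => by simp [ComulData.counitLeft, hp.one_left]) w
      change contractLeft hp 1 (K.comul x) = x
      rw [h, K.counit_comul_left])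
    (fun α β => LinearMap.ext fun x => by
      change contractLeft hp (α * β) (K.comul x) =
        contractLeft hp α (K.comul (contractLeft hp β (K.comul x)))
      -- contraction of `x₁ ◇ x₂ ◇ x₃` to `⟨α | ⟨β | x₁⟩ x₂⟩ x₃`
      let Ψ : K.Diamond₃ →ₗ[k] L := K.lift₃'
        (contractLeft hp ∘ₗ LinearMap.mulLeft k α ∘ₗ H.s.toLinearMap ∘ₗ p β) (fun b x w => by
          simp [hp.balanced.t_arg, ← mul_assoc, contractLeft_mul_s])
      have hΨ : ∀ x w, Ψ (K.mkRight x w) = contractLeft hp (α * H.s (p β x)) w := fun _ _ => rfl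
      have h₁ : ∀ w, contractLeft hp α (K.comul (contractLeft hp β w)) = Ψ (K.comulRight w) :=
        fun w => by
          induction w using BeRing.dind with
          | hmk x y =>
            refine Eq.trans ?_ (hΨ x (K.comul y)).symm
            rw [contractLeft_dmk, K.comul_s, contractLeft_mul_s]
          | hadd v w hv hw => simp only [map_add, hv, hw]
      have h₂ : ∀ w y, Ψ (K.mkLeft w y) = K.s (hp.balanced.evalComul α β w) * y := fun w y => by
        induction w using BeRing.dind with
        | hmk a b =>
          rw [BeRing.mkLeft_dmk, hΨ]
          rfl
        | hadd v w hv hw => simp only [map_add, LinearMap.add_apply, add_mul, hv, hw]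
      have h₃ : ∀ w, contractLeft hp (α * β) w = Ψ (K.comulLeft w) := fun w => by
        refine BeRing.dext_apply (g := Ψ ∘ₗ K.comulLeft) (fun x y => ?_) w
        refine Eq.trans ?_ (h₂ (K.comul x) y).symm
        rw [contractLeft_dmk, hp.mul_left]
      rw [h₁, h₃, K.coassoc])

theorem lact_apply (α : Λ) (x : L) : lact hp α x = contractLeft hp α (K.comul x) := rfl

theorem lact_s_mul (b : B) (α : Λ) (x : L) : lact hp (H.s b * α) x = K.s b * lact hp α x :=
  contractLeft_s_mul hp b α _

theorem lact_t_mul (b : B) (α : Λ) (x : L) : lact hp (H.t b * α) x = lact hp α x * K.s b := by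
  rw [lact_apply, contractLeft_t_mul, K.takeuchi, contractLeft_act, lact_apply]

theorem lact_s (b : B) (x : L) : lact hp (H.s b) x = K.s b * x := by
  simpa using lact_s_mul hp b 1 x

theorem lact_t (b : B) (x : L) : lact hp (H.t b) x = x * K.s b := by
  simpa using lact_t_mul hp b 1 x

theorem lact_t_arg (α : Λ) (b : B) (x : L) : lact hp α (K.t b * x) = K.t b * lact hp α x := by
  rw [lact_apply, K.comul_t, contractLeft_rightT, lact_apply]

theorem lact_arg_t (α : Λ) (b : B) (x : L) : lact hp α (x * K.t b) = lact hp α x * K.t b := by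
  rw [lact_apply, K.comul_mul_t, contractLeft_act, lact_apply]

theorem lact_s_base (α : Λ) (b : B) : lact hp α (K.s b) = K.s (baseAct H α b) := by
  rw [lact_apply, K.comul_s_one, contractLeft_dmk, baseAct_apply, ← hp.one_right,
    hp.balanced.s_right]
  simp

theorem lact_t_base (α : Λ) (b : B) : lact hp α (K.t b) = K.s (H.counit α) * K.t b := by
  rw [lact_apply, K.comul_t_one, contractLeft_dmk, hp.one_right]

theorem counit_contractLeft (α : Λ) (w : K.Diamond) :
    K.counit (contractLeft hp α w) = p α (K.counitRight w) := by
  induction w using BeRing.dind with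
  | hmk x y =>
    rw [contractLeft_dmk, K.counit_s, ← hp.balanced.t_arg]
    rfl
  | hadd v w hv hw => simp only [map_add, hv, hw]

theorem counit_lact (α : Λ) (x : L) : K.counit (lact hp α x) = p α x := by
  rw [lact_apply, counit_contractLeft, K.counit_comul_right]

theorem pairing_mul (α β : Λ) (x : L) : p (α * β) x = p α (lact hp β x) := by
  rw [← counit_lact hp, map_mul, ← counit_lact hp α]
  rfl

/-- `x ◇ y ↦ α ▷ x ◇ y`. -/
def lactLeft (α : Λ) : K.Diamond →ₗ[k] K.Diamond :=
  K.dlift (K.dmk ∘ₗ lact hp α) (fun b x y => by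
    simp [lact_t_arg, K.dmk_bal'])

@[simp] theorem lactLeft_dmk (α : Λ) (x y : L) :
    lactLeft hp α (K.dmk x y) = K.dmk (lact hp α x) y := rfl

theorem comul_lact (α : Λ) (x : L) :
    K.comul (lact hp α x) = lactLeft hp α (K.comul x) := by
  -- contraction of `x₁ ◇ x₂ ◇ x₃` to `⟨α | x₁⟩ x₂ ◇ x₃`
  let E : K.Diamond₃ →ₗ[k] K.Diamond := K.lift₃
    ((LinearMap.mul k L ∘ₗ K.s.toLinearMap ∘ₗ p α).compr₂ K.dmk)
    (fun b x y z => by simp [hp.balanced.t_arg, mul_assoc])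
    (fun b x y z => by
      simp only [LinearMap.compr₂_apply, LinearMap.comp_apply, LinearMap.mul_apply',
        AlgHom.toLinearMap_apply]
      rw [← mul_assoc, K.comm, mul_assoc, K.dmk_bal'])
  have h₁ : ∀ x w, E (K.mkRight x w) = K.leftS (p α x) w := fun x w => by
    refine BeRing.dext_apply (f := E ∘ₗ K.mkRight x) (fun y z => rfl) w
  have h₂ : ∀ w z, E (K.mkLeft w z) = K.dmk (contractLeft hp α w) z := fun w z => by
    induction w using BeRing.dind with
    | hmk x y => rfl
    | hadd v w hv hw => simp only [map_add, LinearMap.add_apply, hv, hw]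
  have h₃ : ∀ w, K.comul (contractLeft hp α w) = E (K.comulRight w) := fun w => by
    refine BeRing.dext_apply (f := K.comul ∘ₗ contractLeft hp α) (g := E ∘ₗ K.comulRight)
      (fun x y => ?_) w
    refine Eq.trans ?_ (h₁ x (K.comul y)).symm
    exact K.comul_s _ _
  have h₄ : ∀ w, lactLeft hp α w = E (K.comulLeft w) := fun w =>
    BeRing.dext_apply (g := E ∘ₗ K.comulLeft) (fun x y => (h₂ (K.comul x) y).symm) w
  rw [lact_apply, h₃, h₄, K.coassoc]

theorem lact_balanced : IsBalanced H.toBeRing (lact hp) (lact hp) (LinearMap.mul k L) := by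
  intro b x y
  simp [lact_t, lact_s, mul_assoc]

/-- `α ▷ (x y) = (α₁ ▷ x) (α₂ ▷ y)`, by the second axiom of a dual pairing and the
Takeuchi condition. -/
theorem lact_mul_equivariant :
    IsEquivariant H (lact hp) (lact hp) (lact hp) (LinearMap.mul k L) := by
  refine ⟨lact_balanced hp, fun α x y => ?_⟩
  obtain ⟨n, a, b, e⟩ := BeRing.exists_sum (H.comul α)
  have hA : ∀ c d : L, p α (c * d) = ∑ i, p (a i) (c * K.t (p (b i) d)) := fun c d => by
    rw [hp.mul_right, e, map_sum]
    rfl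
  have h₁ : ∀ (V : K.Diamond) (c d : L), contractLeft hp α (K.act V c d) =
      ∑ i, contractLeft hp (a i) (K.act V (K.t (p (b i) c)) d) := fun V c d => by
    induction V using BeRing.dind with
    | hmk u v => simp [hA, Finset.sum_mul]
    | hadd v w hv hw =>
      simp only [map_add, LinearMap.add_apply, hv, hw, Finset.sum_add_distrib]
  have h₂ : ∀ w, contractLeft hp α (K.comulAct x w) =
      ∑ i, lact hp (a i) x * contractLeft hp (b i) w := fun w => by
    induction w using BeRing.dind with
    | hmk c d =>
      rw [K.comulAct_dmk, h₁]
      refine Finset.sum_congr rfl fun i _ => ?_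
      have h := K.takeuchi' x (p (b i) c) 1 d
      rw [mul_one] at h
      rw [h, contractLeft_act]
      rfl
    | hadd v w hv hw => simp only [map_add, hv, hw, mul_add, Finset.sum_add_distrib]
  change contractLeft hp α (K.comul (x * y)) = _
  rw [K.comul_mul, h₂, e]
  simp [lact_apply]

/-- `x ⊗ y ↦ x \bar{⟨α | y⟩}`. -/
def contractRight : Λ →ₗ[k] K.Bar →ₗ[k] L :=
  K.bliftFam ((LinearMap.lflip (R₀ := k)).toLinearMap ∘ₗ p.compr₂ ((LinearMap.mul k L).flip ∘ₗ K.t))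
    (fun α b x y => by simp [hp.balanced.t_arg, K.t_mul, mul_assoc])

@[simp] theorem contractRight_bmk (α : Λ) (x y : L) :
    contractRight hp α (K.bmk x y) = x * K.t (p α y) := rfl

theorem contractRight_barL (α : Λ) (c : L) (w : K.Bar) :
    contractRight hp α (K.barL c w) = c * contractRight hp α w := by
  induction w using BeRing.bind with
  | hmk x y => simp [mul_assoc]
  | hadd v w hv hw => simp only [map_add, mul_add, hv, hw]

theorem contractRight_barS (α : Λ) (b : B) (w : K.Bar) :
    contractRight hp α (K.barS b w) = contractRight hp α w * K.s b := by
  induction w using BeRing.bind with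
  | hmk x y => simp [mul_assoc, K.comm]
  | hadd v w hv hw => simp only [map_add, add_mul, hv, hw]

theorem contractRight_s_mul (b : B) (α : Λ) (w : K.Bar) :
    contractRight hp (H.s b * α) w = contractRight hp α w * K.t b := by
  induction w using BeRing.bind with
  | hmk x y => simp [hp.balanced.s_left, K.t_mul, mul_assoc]
  | hadd v w hv hw => simp only [map_add, add_mul, hv, hw]

theorem contractRight_t_mul (b : B) (α : Λ) (w : K.Bar) :
    contractRight hp (H.t b * α) w = contractRight hp α (K.barR (K.t b) w) := by
  induction w using BeRing.bind with
  | hmk x y => simp [hp.balanced.t_left]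
  | hadd v w hv hw => simp only [map_add, hv, hw]

/-- The map `α ▶ x = x₊ \bar{⟨α | x₋⟩}`. -/
noncomputable def ractLin : Λ →ₗ[k] Module.End k L :=
  (contractRight hp).compl₂ (LeftBialgebroid.trans hK)

theorem ractLin_apply (α : Λ) (x : L) :
    ractLin hp hK α x = contractRight hp α (LeftBialgebroid.trans hK x) := rfl

/-- `x ◇ y ↦ x ◇ α ▶ y`. -/
noncomputable def ractRight (α : Λ) : K.Diamond →ₗ[k] K.Diamond :=
  K.dlift (K.dmk.compl₂ (ractLin hp hK α)) (fun b x y => by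
    simp [ractLin_apply, LeftBialgebroid.trans_s_mul, contractRight_barL, K.dmk_bal'])

@[simp] theorem ractRight_dmk (α : Λ) (x y : L) :
    ractRight hp hK α (K.dmk x y) = K.dmk x (ractLin hp hK α y) := rfl

/-- The functional form of `x₊₁ ◇ x₊₂ ⊗ x₋ = x₁ ◇ x₂₊ ⊗ x₂₋`. -/
theorem comul_ractLin (α : Λ) (x : L) :
    K.comul (ractLin hp hK α x) = ractRight hp hK α (K.comul x) := by
  -- the map `x ◇ w ↦ x ◇ c(w)`, where `c(y ◇ z) = y₊ \bar{⟨α | y₋ z⟩}`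
  let E : K.Diamond₃ →ₗ[k] K.Diamond := K.lift₃'
    (K.dmk.compl₂ (contractRight hp α ∘ₗ (lamInv hK).toLinearMap)) (fun b x w => by
      simp [lamInv_leftS, contractRight_barL, K.dmk_bal'])
  have hE : ∀ x w, E (K.mkRight x w) = K.dmk x (contractRight hp α (lamInv hK w)) :=
    fun x w => rfl
  have h₁ : ∀ w, E (K.mkLeft w 1) = ractRight hp hK α w := fun w =>
    BeRing.dext_apply (f := E ∘ₗ K.mkLeft.flip 1) (g := ractRight hp hK α) (fun x y => rfl) w
  have h₂ : ∀ W, E (K.comulLeft (K.lam W)) = K.comul (contractRight hp α W) := fun W => by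
    induction W using BeRing.bind with
    | hmk a b =>
      have h₃ : ∀ T, K.comulLeft (K.act T (1 : L) b) = K.act₃ 1 1 b (K.comulLeft T) := fun T => by
        induction T using BeRing.dind with
        | hmk x y =>
          change K.mkLeft (K.comul (x * 1)) (y * b) = K.act₃ 1 1 b (K.mkLeft (K.comul x) y)
          rw [K.act₃_mkLeft, act_one_one, mul_one]
        | hadd v w hv hw => simp only [map_add, LinearMap.add_apply, hv, hw]
      have h₄ : ∀ T, E (K.act₃ 1 1 b (K.comulRight T)) = K.act T (1 : L) (K.t (p α b)) :=
        fun T => by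
          induction T using BeRing.dind with
          | hmk x y =>
            change E (K.act₃ 1 1 b (K.mkRight x (K.comul y))) = _
            rw [K.act₃_mkRight, hE, ← LeftBialgebroid.lam_bmk, lamInv_lam]
            rfl
          | hadd v w hv hw => simp only [map_add, LinearMap.add_apply, hv, hw]
      rw [LeftBialgebroid.lam_bmk, h₃, K.coassoc, h₄, contractRight_bmk, K.comul_mul_t]
    | hadd v w hv hw => simp only [map_add, hv, hw]
  rw [ractLin_apply, ← h₂, LeftBialgebroid.lam_trans, ← h₁]
  rfl

/-- `v ◇ w ↦ (x ⊗ y ↦ x \bar{⟨α | ⟨β | y₁ v⟩ y₂ w⟩})`. -/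
def contractRight₂ (α β : Λ) : K.Diamond →ₗ[k] K.Bar →ₗ[k] L :=
  K.bliftFam ((LinearMap.lflip (R₀ := k)).toLinearMap ∘ₗ
    (K.comulAct.flip.compr₂ ((LinearMap.mul k L).flip ∘ₗ K.t ∘ₗ hp.balanced.evalComul' α β)))
    (fun W b x y => by
      have h : ∀ w, hp.balanced.evalComul' α β (K.rightT b w) =
          hp.balanced.evalComul' α β w * b := fun w => by
        induction w using BeRing.dind with
        | hmk c d =>
          change p α (K.s (p β c) * (K.t b * d)) = p α (K.s (p β c) * d) * b
          rw [← mul_assoc, K.comm, mul_assoc, hp.balanced.t_arg]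
        | hadd v w hv hw => simp only [map_add, add_mul, hv, hw]
      simp [comulAct_mul, comulAct_t_eq, h, K.t_mul, mul_assoc])

theorem contractRight₂_bmk (α β : Λ) (w : K.Diamond) (x y : L) :
    contractRight₂ hp α β w (K.bmk x y) =
      x * K.t (hp.balanced.evalComul' α β (K.comulAct y w)) := rfl

theorem contractRight₂_barR (α β : Λ) (w : K.Diamond) (c : L) (W : K.Bar) :
    contractRight₂ hp α β w (K.barR c W) = contractRight₂ hp α β (K.comulAct c w) W := by
  induction W using BeRing.bind with
  | hmk x y => simp only [BeRing.barR_bmk, contractRight₂_bmk, comulAct_mul]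
  | hadd v w hv hw => simp only [map_add, hv, hw]

/-- The functional form of `x₊ ⊗ x₋₁ ◇ x₋₂ = x₊₊ ⊗ x₋ ◇ x₊₋`, which follows from the invertibility
of `u ⊗ (v ◇ w) ↦ u₁ ◇ u₂ v ◇ u₃ w`. -/
theorem ractLin_mul (α β : Λ) (x : L) :
    ractLin hp hK (α * β) x = ractLin hp hK α (ractLin hp hK β x) := by
  -- contraction with the inverse `u ◇ (v ◇ w) ↦ u₊ ⊗ u₋ (v ◇ w)`
  let E : K.Diamond₃ →ₗ[k] L := K.lift₃'
    ((contractRight₂ hp α β).flip ∘ₗ LeftBialgebroid.trans hK) (fun b x w => by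
      simp [trans_t_mul, contractRight₂_barR, comulAct_s_eq])
  have hE : ∀ x w, E (K.mkRight x w) =
      contractRight₂ hp α β w (LeftBialgebroid.trans hK x) := fun x w => rfl
  have h₁ : ∀ w T, E (K.cocycleRight w T) = contractRight₂ hp α β w (lamInv hK T) := fun w T => by
    refine BeRing.dext_apply (f := E ∘ₗ K.cocycleRight w)
      (g := contractRight₂ hp α β w ∘ₗ (lamInv hK).toLinearMap) (fun x y => ?_) T
    refine (hE x (K.comulAct y w)).trans ?_
    rw [← contractRight₂_barR, ← lamInv_dmk]
    rfl
  have h₂ : ∀ w u, E (K.cocycleRight w (K.comul u)) =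
      u * K.t (hp.balanced.evalComul' α β w) := fun w u => by
    rw [h₁, lamInv_comul, contractRight₂_bmk, comulAct_one]
  have h₃ : ∀ W, ractLin hp hK α (contractRight hp β W) = E (K.mkLeft (K.lam W) 1) := fun W => by
    induction W using BeRing.bind with
    | hmk a b =>
      obtain ⟨n, u, v, e⟩ := BeRing.exists_sum_bar (LeftBialgebroid.trans hK a)
      have h₄ : ∑ i, K.cocycleRight (K.dmk b (v i)) (K.comul (u i)) =
          K.mkLeft (K.act (K.comul a) (1 : L) b) 1 := by
        simp only [cocycleRight_comul, ← map_sum]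
        have h₅ : ∑ i, K.act (K.comul (u i)) (1 : L) (v i) = K.dmk a 1 := by
          rw [← LeftBialgebroid.lam_trans hK, e, map_sum]
          simp
        rw [h₅]
        rfl
      rw [LeftBialgebroid.lam_bmk, ← h₄, map_sum, contractRight_bmk, ractLin_apply,
        trans_mul_t hK e, map_sum]
      simp only [h₂]
      rfl
    | hadd v w hv hw => simp only [map_add, LinearMap.add_apply, hv, hw]
  have h₆ : ∀ W, contractRight hp (α * β) W = contractRight₂ hp α β (K.dmk 1 1) W := fun W => by
    induction W using BeRing.bind with
    | hmk a b => rw [contractRight_bmk, contractRight₂_bmk, comulAct_dmk_one, hp.mul_left']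
    | hadd v w hv hw => simp only [map_add, hv, hw]
  rw [ractLin_apply, h₆, ← hE, ractLin_apply hp hK β, h₃, LeftBialgebroid.lam_trans]
  rfl

/-- The action `α ▶ x = x₊ \bar{⟨α | x₋⟩}` of `Λ` on `L`. -/
noncomputable def ract : Λ →ₐ[k] Module.End k L :=
  AlgHom.ofLinearMap (ractLin hp hK)
    (LinearMap.ext fun x => by
      have h : ∀ W, contractRight hp 1 W = K.counitRight (K.lam W) := fun W => by
        induction W using BeRing.bind with
        | hmk a b =>
          have h' : ∀ T, K.counitRight (K.act T (1 : L) b) =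
              K.counitRight (K.act T (1 : L) (K.t (K.counit b))) := fun T => by
            induction T using BeRing.dind with
            | hmk c d =>
              change K.t (K.counit (d * b)) * (c * 1) =
                K.t (K.counit (d * K.t (K.counit b))) * (c * 1)
              rw [K.counit_mul_t]
            | hadd v w hv hw => simp only [map_add, LinearMap.add_apply, hv, hw]
          rw [LeftBialgebroid.lam_bmk, h', ← K.comul_mul_t, K.counit_comul_right,
            contractRight_bmk, hp.one_left]
        | hadd v w hv hw => simp only [map_add, hv, hw]
      rw [ractLin_apply, h, LeftBialgebroid.lam_trans]
      change K.t (K.counit 1) * x = x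
      rw [K.counit_one, K.t_one, one_mul])
    (fun α β => LinearMap.ext fun x => ractLin_mul hp hK α β x)

theorem ract_apply (α : Λ) (x : L) :
    ract hp hK α x = contractRight hp α (LeftBialgebroid.trans hK x) := rfl

theorem ract_s_mul (b : B) (α : Λ) (x : L) :
    ract hp hK (H.s b * α) x = ract hp hK α x * K.t b :=
  contractRight_s_mul hp b α _

theorem ract_t_mul (b : B) (α : Λ) (x : L) :
    ract hp hK (H.t b * α) x = K.t b * ract hp hK α x := by
  rw [ract_apply, contractRight_t_mul, ← LeftBialgebroid.trans_tak, contractRight_barL, ract_apply]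

theorem ract_s (b : B) (x : L) : ract hp hK (H.s b) x = x * K.t b := by
  simpa using ract_s_mul hp hK b 1 x

theorem ract_t (b : B) (x : L) : ract hp hK (H.t b) x = K.t b * x := by
  simpa using ract_t_mul hp hK b 1 x

theorem ract_s_arg (α : Λ) (b : B) (x : L) :
    ract hp hK α (K.s b * x) = K.s b * ract hp hK α x := by
  rw [ract_apply, LeftBialgebroid.trans_s_mul, contractRight_barL, ract_apply]

theorem ract_arg_s (α : Λ) (b : B) (x : L) :
    ract hp hK α (x * K.s b) = ract hp hK α x * K.s b := by
  rw [ract_apply, LeftBialgebroid.trans_mul_s, contractRight_barS, ract_apply]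

theorem ract_t_base (α : Λ) (b : B) : ract hp hK α (K.t b) = K.t (baseAct H α b) := by
  rw [ract_apply, trans_t, contractRight_bmk, one_mul, baseAct_apply, ← hp.one_right,
    hp.balanced.s_right, mul_one]

theorem ract_one (α : Λ) : ract hp hK α 1 = K.t (H.counit α) := by
  rw [ract_apply, trans_one, contractRight_bmk, one_mul, hp.one_right]

theorem ract_s_base (α : Λ) (b : B) : ract hp hK α (K.s b) = K.s b * K.t (H.counit α) := by
  rw [ract_apply, trans_s, contractRight_bmk, hp.one_right]

theorem comul_ract (α : Λ) (x : L) :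
    K.comul (ract hp hK α x) = ractRight hp hK α (K.comul x) := comul_ractLin hp hK α x

theorem lact_ract_comm (α β : Λ) (x : L) :
    lact hp α (ract hp hK β x) = ract hp hK β (lact hp α x) := by
  have h : ∀ w, contractLeft hp α (ractRight hp hK β w) = ract hp hK β (contractLeft hp α w) :=
    fun w => by
      refine BeRing.dext_apply (f := contractLeft hp α ∘ₗ ractRight hp hK β)
        (g := ract hp hK β ∘ₗ contractLeft hp α) (fun x y => ?_) w
      exact (ract_s_arg hp hK β _ y).symm
  rw [lact_apply, comul_ract, h, lact_apply]

theorem ract_balanced :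
    IsBalanced H.toBeRing (ract hp hK) (ract hp hK) (LinearMap.mul k L).flip := by
  intro b x y
  simp [ract_t, ract_s, mul_assoc]

theorem contractRight_sum {α : Λ} {n : ℕ} {a b : Fin n → Λ}
    (e : H.comul α = ∑ i, H.dmk (a i) (b i)) (v : L) (W : K.Bar) :
    contractRight hp α (K.barR v W) =
      ∑ i, contractRight hp (a i) (K.barR (K.t (p (b i) v)) W) := by
  induction W using BeRing.bind with
  | hmk x y =>
    have h : p α (y * v) = ∑ i, p (a i) (y * K.t (p (b i) v)) := by
      rw [hp.mul_right, e, map_sum]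
      rfl
    simp [h, Finset.mul_sum]
  | hadd v w hv hw => simp only [map_add, hv, hw, Finset.sum_add_distrib]

/-- `α ▶ (x y) = (α₂ ▶ x) (α₁ ▶ y)`, since `(x y)₊ ⊗ (x y)₋ = x₊ y₊ ⊗ y₋ x₋`. -/
theorem ract_mul_equivariant :
    IsEquivariant H (ract hp hK) (ract hp hK) (ract hp hK) (LinearMap.mul k L).flip := by
  refine ⟨ract_balanced hp hK, fun α y x => ?_⟩
  obtain ⟨n, a, b, e⟩ := BeRing.exists_sum (H.comul α)
  obtain ⟨m, u, v, eu⟩ := BeRing.exists_sum_bar (LeftBialgebroid.trans hK x)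
  change contractRight hp α (LeftBialgebroid.trans hK (x * y)) = _
  rw [trans_mul hK eu, e, map_sum, map_sum, LinearMap.sum_apply, LinearMap.sum_apply]
  simp only [contractRight_barL, contractRight_sum hp e, ← LeftBialgebroid.trans_tak,
    Finset.mul_sum]
  rw [Finset.sum_comm]
  refine Finset.sum_congr rfl fun i _ => ?_
  rw [IsBalanced.ev_dmk, LinearMap.flip_apply, LinearMap.mul_apply', ract_apply hp hK (b i), eu]
  simp [Finset.sum_mul, ract_apply, mul_assoc]

/-- `L ◇ L` is a model of the tensor product of `L` with the action `▶` and `L` with the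
action `▷`. -/
theorem comul_isTensor : IsTensor H.toBeRing (ract hp hK) (lact hp) (K.dmk (M := L) (N := L)) := by
  have h₁ : (fun b => ract hp hK (H.t b)) = K.tAct L :=
    funext fun b => LinearMap.ext fun x => ract_t hp hK b x
  have h₂ : (fun b => lact hp (H.s b)) = K.sAct L :=
    funext fun b => LinearMap.ext fun x => lact_s hp b x
  rw [IsTensor, h₁, h₂]
  exact Bal.descendsToIso

/-- `γ₁ ▶ x₁ ◇ γ₂ ▷ x₂ = x₁ \bar{ε(γ)} ◇ x₂`. -/
theorem tensorAct_comul (γ : Λ) (x : L) : tensorAct H (comul_isTensor hp hK) γ (K.comul x) =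
    K.act (K.comul x) (K.t (H.counit γ)) (1 : L) := by
  -- the map `x ◇ y ◇ z ↦ x₊ \bar{⟨γ | x₋ y⟩} ◇ z`
  let E : K.Diamond₃ →ₗ[k] K.Diamond := K.lift₃
    ((K.dmk.compr₂ (contractRight hp γ ∘ₗ (lamInv hK).toLinearMap)).compr₂ K.dmk)
    (fun b x y z => by simp [K.dmk_bal'])
    (fun b x y z => by
      simp [lamInv_dmk, barR_mul, ← LeftBialgebroid.trans_tak, ← barL_barR, contractRight_barL,
        K.dmk_bal'])
  have hE : ∀ w z, E (K.mkLeft w z) = K.dmk (contractRight hp γ (lamInv hK w)) z := fun w z => by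
    induction w using BeRing.dind with
    | hmk x y => rfl
    | hadd v w hv hw => simp only [map_add, LinearMap.add_apply, hv, hw]
  obtain ⟨n, a, b, e⟩ := BeRing.exists_sum (H.comul γ)
  have hE' : ∀ x w, E (K.mkRight x w) =
      ∑ i, K.dmk (ract hp hK (a i) x) (contractLeft hp (b i) w) := fun x w => by
    induction w using BeRing.dind with
    | hmk c d =>
      change K.dmk (contractRight hp γ (lamInv hK (K.dmk x c))) d = _
      rw [lamInv_dmk, contractRight_sum hp e, map_sum, LinearMap.sum_apply]
      refine Finset.sum_congr rfl fun i _ => ?_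
      rw [← LeftBialgebroid.trans_tak, contractRight_barL, K.dmk_bal']
      rfl
    | hadd v w hv hw => simp only [map_add, hv, hw, Finset.sum_add_distrib]
  have h₁ : ∀ T, tensorAct H (comul_isTensor hp hK) γ T = E (K.comulRight T) := fun T => by
    refine BeRing.dext_apply (g := E ∘ₗ K.comulRight) (fun x y => ?_) T
    refine Eq.trans ?_ (hE' x (K.comul y)).symm
    refine (tensorEnd_apply (comul_isTensor hp hK) γ x y).trans ?_
    rw [e]
    simp [lact_apply]
  have h₂ : ∀ T, K.act T (K.t (H.counit γ)) (1 : L) = E (K.comulLeft T) := fun T => by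
    refine BeRing.dext_apply (f := (K.act.flip (K.t (H.counit γ))).flip 1)
      (g := E ∘ₗ K.comulLeft) (fun x y => ?_) T
    refine Eq.trans ?_ (hE (K.comul x) y).symm
    rw [lamInv_comul, contractRight_bmk, hp.one_right]
    simp
  rw [h₁, h₂, K.coassoc]

/-- The pairing induces a `Λ`-linear map `Λ ◇ L → B` for the action `▶` on `L`. -/
theorem pairing_equivariant :
    IsEquivariant H (Algebra.lsmul k k Λ) (ract hp hK) (baseAct H) p := by
  refine ⟨fun b α x => ?_, fun γ α x => ?_⟩
  · rw [ract_s]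
    exact hp.balanced.t_left b α x
  obtain ⟨n, a, b, e⟩ := BeRing.exists_sum (H.comul γ)
  have h₁ : ∀ (V : K.Diamond) (d : L),
      ∑ i, hp.balanced.evalComul' (H.t (p (b i) d) * a i) α V =
        p γ (contractLeft hp α (K.act V (1 : L) d)) := fun V d => by
    induction V using BeRing.dind with
    | hmk x y =>
      change ∑ i, p (H.t (p (b i) d) * a i) (K.s (p α x) * y) =
        p γ (K.s (p α (x * 1)) * (y * d))
      rw [← mul_assoc, hp.mul_right', e, map_sum, mul_one]
      rfl
    | hadd v w hv hw => simp only [map_add, LinearMap.add_apply, Finset.sum_add_distrib, hv, hw]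
  have h₂ : ∀ W, ∑ i, p (a i * α) (contractRight hp (b i) W) =
      p γ (contractLeft hp α (K.lam W)) := fun W => by
    induction W using BeRing.bind with
    | hmk c d =>
      rw [LeftBialgebroid.lam_bmk, ← h₁]
      refine Finset.sum_congr rfl fun i _ => ?_
      rw [contractRight_bmk, ← hp.mul_left', mul_assoc, hp.balanced.t_left]
    | hadd v w hv hw => simp only [map_add, Finset.sum_add_distrib, hv, hw]
  have h₃ := h₂ (LeftBialgebroid.trans hK x)
  rw [LeftBialgebroid.lam_trans, contractLeft_dmk, mul_one] at h₃
  rw [e, baseAct_apply, ← hp.one_right, hp.balanced.s_right, mul_one, ← h₃, map_sum,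
    LinearMap.sum_apply, LinearMap.sum_apply]
  rfl

end Actions

/-! ### The dual 2-cocycle and the twisted products on `L` -/

section Products

variable {k B Λ L : Type u} [Field k] [Ring B] [Algebra k B] [Ring Λ] [Algebra k Λ]
  [Ring L] [Algebra k L] {H : LeftBialgebroid k B Λ} {K : LeftBialgebroid k B L}
  {p : Λ →ₗ[k] L →ₗ[k] B} (hp : IsDualPairing H K p) (hK : K.IsLeftHopf)

/-- The twist `Σ (F^α ▷ x) (F_α ▷ y)` of the product of `L` by means of `▷`. -/
def leftTwist (F : H.Diamond) : L →ₗ[k] L →ₗ[k] L := (lact_balanced hp).ev F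

/-- The twist `Σ (F_α ▶ x) (F^α ▶ y)` of the product of `L` by means of `▶`. -/
noncomputable def rightTwist (F : H.Diamond) : L →ₗ[k] L →ₗ[k] L :=
  ((ract_balanced hp hK).ev F).flip

theorem rightTwist_equivariant (F : H.Diamond) :
    IsEquivariant H (lact hp) (lact hp) (lact hp) (rightTwist hp hK F) :=
  (lact_mul_equivariant hp).flip_ev (ract_balanced hp hK)
    (lact_ract_comm hp hK) (lact_ract_comm hp hK) F

theorem leftTwist_equivariant (F : H.Diamond) :
    IsEquivariant H (ract hp hK) (ract hp hK) (ract hp hK) (leftTwist hp F).flip :=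
  (ract_mul_equivariant hp hK).flip_ev (μ := (LinearMap.mul k L).flip) (lact_balanced hp)
    (fun x y m => (lact_ract_comm hp hK y x m).symm)
    (fun x y m => (lact_ract_comm hp hK y x m).symm) F

/-- The product `Σ (F^α ▷ F_β ▶ x) (F_α ▷ F^β ▶ y)` on `L`. -/
noncomputable def twistProd (F : H.Diamond) : L →ₗ[k] L →ₗ[k] L :=
  (rightTwist_equivariant hp hK F).bal.ev F

/-- `twistProd` may be formed by first twisting along `▷` and then along `▶`. -/
theorem twistProd_eq (F : H.Diamond) (x y : L) :
    twistProd hp hK F x y = (leftTwist_equivariant hp hK F).bal.ev F y x :=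
  (lact_balanced hp).ev_flip_comm (ract_balanced hp hK)
    (lact_ract_comm hp hK) (lact_ract_comm hp hK) F F _ _ x y

variable {F : H.Diamond}

/-- `Γ_F` is the counit of the twist of the product of `L` along `▷`. -/
theorem form_eq (x y : L) : hp.form F x y = K.counit (leftTwist hp F x y) := by
  obtain ⟨n, a, b, e⟩ := BeRing.exists_sum F
  rw [leftTwist, IsBalanced.ev_sum _ e, e]
  simp only [map_sum, LinearMap.sum_apply, LinearMap.mul_apply']
  refine Finset.sum_congr rfl fun i _ => ?_
  rw [K.counit_mul_t, counit_lact, ← lact_arg_t, counit_lact]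
  rfl

theorem form_sum {n : ℕ} {a b : Fin n → Λ} (e : F = ∑ i, H.dmk (a i) (b i)) (x y : L) :
    hp.form F x y = ∑ i, p (a i) (x * K.t (p (b i) y)) := by
  rw [e, map_sum, LinearMap.sum_apply, LinearMap.sum_apply]
  rfl

/-- `Γ_F(x₁, y₁) m(x₂, y₂)` is the twist of `m` by `F`. -/
theorem dualCochain_conv (m : L →ₗ[k] L →ₗ[k] L)
    (h₁ : ∀ b x y, m (K.s b * x) y = K.s b * m x y)
    (h₂ : ∀ b x y, m (x * K.s b) y = m x (K.s b * y))
    (hm : IsBalanced H.toBeRing (lact hp) (lact hp) m) (x y : L) :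
    (hp.dualCochain F).conv m h₁ h₂ x y = hm.ev F x y := by
  obtain ⟨n, a, b, e⟩ := BeRing.exists_sum F
  have hV : ∀ V c d, (hp.dualCochain F).convAux m h₁ V c d =
      ∑ i, m (contractLeft hp (a i) (K.act V (K.t (p (b i) c)) (1 : L))) d := fun V c d => by
    induction V using BeRing.dind with
    | hmk u v =>
      change K.s (hp.form F u c) * m v d = _
      rw [form_sum hp e, map_sum, Finset.sum_mul]
      refine Finset.sum_congr rfl fun i _ => ?_
      rw [← h₁]
      simp
    | hadd v w hv hw => simp only [map_add, LinearMap.add_apply, hv, hw, Finset.sum_add_distrib]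
  have hw : ∀ w, K.dliftFam ((hp.dualCochain F).convAux m h₁ ∘ₗ K.comul)
      (fun x b y z => by
        change (hp.dualCochain F).convAux m h₁ (K.comul x) (K.t b * y) z =
          (hp.dualCochain F).convAux m h₁ (K.comul x) y (K.s b * z)
        rw [hV, hV]
        refine Finset.sum_congr rfl fun i _ => ?_
        rw [hp.balanced.t_arg, K.takeuchi, K.takeuchi, contractLeft_act, contractLeft_act,
          map_mul K.s, ← mul_assoc, h₂]) x w =
      ∑ i, m (lact hp (a i) x) (contractLeft hp (b i) w) := fun w => by
    induction w using BeRing.dind with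
    | hmk c d =>
      change (hp.dualCochain F).convAux m h₁ (K.comul x) c d = _
      rw [hV]
      refine Finset.sum_congr rfl fun i _ => ?_
      rw [K.takeuchi, contractLeft_act, h₂]
      rfl
    | hadd v w hv hw => simp only [map_add, hv, hw, Finset.sum_add_distrib]
  rw [hm.ev_sum e]
  exact hw (K.comul y)

theorem dualCochain_convMul (x y : L) :
    (hp.dualCochain F).convMul x y = leftTwist hp F x y :=
  dualCochain_conv hp _ _ _ (lact_balanced hp) x y

theorem dualCochain_rightMul : (hp.dualCochain F).rightMul hK = rightTwist hp hK F := by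
  refine LinearMap.ext fun x => LinearMap.ext fun y => ?_
  obtain ⟨n, a, b, e⟩ := BeRing.exists_sum F
  have hV : ∀ V u u', (hp.dualCochain F).rightAux V u u' =
      ∑ i, u * contractRight hp (a i) (K.barR (K.t (p (b i) u')) V) := fun V u u' => by
    induction V using BeRing.bind with
    | hmk v v' =>
      change u * v * K.t (hp.form F v' u') = _
      simp [form_sum hp e, Finset.mul_sum, mul_assoc]
    | hadd v w hv hw => simp only [map_add, LinearMap.add_apply, hv, hw, mul_add,
        Finset.sum_add_distrib]
  have hc : ∀ u u', (hp.dualCochain F).rightAux (LeftBialgebroid.trans hK y) u u' =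
      ∑ i, u * K.t (p (b i) u') * ract hp hK (a i) y := fun u u' => by
    rw [hV]
    refine Finset.sum_congr rfl fun i _ => ?_
    rw [← LeftBialgebroid.trans_tak, contractRight_barL, mul_assoc]
    rfl
  have hW : ∀ W : K.Bar, K.blift ((hp.dualCochain F).rightAux (LeftBialgebroid.trans hK y))
      (fun c u u' => by simp [hc, hp.balanced.t_arg, K.t_mul, mul_assoc]) W =
      ∑ i, contractRight hp (b i) W * ract hp hK (a i) y := fun W => by
    induction W using BeRing.bind with
    | hmk u u' =>
      exact hc u u'
    | hadd v w hv hw => simp only [map_add, hv, hw, add_mul, Finset.sum_add_distrib]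
  rw [rightTwist, LinearMap.flip_apply, IsBalanced.ev_sum _ e]
  exact hW (LeftBialgebroid.trans hK x)

theorem dualCochain_cotwistMul (x y : L) :
    (hp.dualCochain F).cotwistMul hK x y = twistProd hp hK F x y := by
  have h : ∀ (m : L →ₗ[k] L →ₗ[k] L) (_ : m = rightTwist hp hK F)
      (h₁ : ∀ b x y, m (K.s b * x) y = K.s b * m x y)
      (h₂ : ∀ b x y, m (x * K.s b) y = m x (K.s b * y)),
      (hp.dualCochain F).conv m h₁ h₂ x y = twistProd hp hK F x y := by
    rintro _ rfl h₁ h₂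
    exact dualCochain_conv hp _ h₁ h₂ _ x y
  exact h _ (dualCochain_rightMul hp hK) _ _

theorem dualCochain_sharp : (hp.dualCochain F).sharp hK =
    TensorProduct.lift ((comul_isTensor hp hK).isBalanced.ev F) := by
  refine TensorProduct.ext' fun x y => ?_
  obtain ⟨n, a, b, e⟩ := BeRing.exists_sum F
  have hV : ∀ V c d, (hp.dualCochain F).sharpAux V c d =
      ∑ i, K.dmk (contractRight hp (a i) (K.barR (K.t (p (b i) c)) V)) d := fun V c d => by
    induction V using BeRing.bind with
    | hmk v v' =>
      change K.dmk (v * K.t (hp.form F v' c)) d = _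
      simp [form_sum hp e, Finset.mul_sum]
    | hadd v w hv hw => simp only [map_add, LinearMap.add_apply, hv, hw, Finset.sum_add_distrib]
  have hc : ∀ c d, (hp.dualCochain F).sharpAux (LeftBialgebroid.trans hK x) c d =
      ∑ i, K.dmk (ract hp hK (a i) x) (K.s (p (b i) c) * d) := fun c d => by
    rw [hV]
    refine Finset.sum_congr rfl fun i _ => ?_
    rw [← LeftBialgebroid.trans_tak, contractRight_barL, K.dmk_bal']
    rfl
  have hw : ∀ w, K.dlift ((hp.dualCochain F).sharpAux (LeftBialgebroid.trans hK x))
      (fun c u v => by simp [hc, hp.balanced.t_arg, mul_assoc]) w =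
      ∑ i, K.dmk (ract hp hK (a i) x) (contractLeft hp (b i) w) := fun w => by
    induction w using BeRing.dind with
    | hmk c d => exact hc c d
    | hadd v w hv hw => simp only [map_add, hv, hw, Finset.sum_add_distrib]
  rw [TensorProduct.lift.tmul, IsBalanced.ev_sum _ e]
  exact hw (K.comul y)

/-- The bilinear map `[α | x] = ⟨F^α α | F_α ▶ x⟩`. -/
noncomputable def twistPair (F : H.Diamond) : Λ →ₗ[k] L →ₗ[k] B :=
  (pairing_equivariant hp hK).bal.ev F

theorem twisted_eq (α : Λ) (x : L) : hp.twisted F hK α x = twistPair hp hK F α x := by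
  obtain ⟨n, a, b, e⟩ := BeRing.exists_sum F
  have h : ∀ W : K.Bar, K.bliftFam (hp.form ∘ₗ (H.act (M := Λ) (N := Λ) F).flip (1 : Λ))
      (fun α => hp.form_balanced (H.act F α (1 : Λ))) α W =
      ∑ i, p (a i * α) (contractRight hp (b i) W) := fun W => by
    induction W using BeRing.bind with
    | hmk u v =>
      change hp.form (H.act F α (1 : Λ)) u v = _
      rw [form_sum hp (a := fun i => a i * α) (b := b) (by simp [e])]
      rfl
    | hadd v w hv hw => simp only [map_add, hv, hw, Finset.sum_add_distrib]
  rw [twistPair, IsBalanced.ev_sum _ e]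
  exact h (LeftBialgebroid.trans hK x)

theorem dualCochain_cotwistCounit (x : L) :
    (hp.dualCochain F).cotwistCounit hK x = twistPair hp hK F 1 x := by
  have h : ∀ W : K.Bar, K.blift (hp.dualCochain F).form (hp.dualCochain F).balanced W =
      K.bliftFam (hp.form ∘ₗ (H.act (M := Λ) (N := Λ) F).flip (1 : Λ))
        (fun α => hp.form_balanced (H.act F α (1 : Λ))) 1 W := fun W => by
    induction W using BeRing.bind with
    | hmk u v =>
      change hp.form F u v = hp.form (H.act F 1 (1 : Λ)) u v
      rw [act_one_one]
    | hadd v w hv hw => simp only [map_add, hv, hw]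
  rw [← twisted_eq]
  exact h (LeftBialgebroid.trans hK x)

theorem ev_counitLeft {M : Type u} [AddCommGroup M] [Module k M] (ρ : Λ →ₐ[k] Module.End k M)
    {n : ℕ} {a b : Fin n → Λ} (e : F = ∑ i, H.dmk (a i) (b i)) (m : M) :
    ∑ i, ρ (H.s (H.counit (a i))) (ρ (b i) m) = ρ (H.counitLeft F) m := by
  rw [e, map_sum, map_sum, LinearMap.sum_apply]
  refine Finset.sum_congr rfl fun i _ => ?_
  rw [← Module.End.mul_apply, ← map_mul]
  rfl

theorem ev_counitRight {M : Type u} [AddCommGroup M] [Module k M] (ρ : Λ →ₐ[k] Module.End k M)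
    {n : ℕ} {a b : Fin n → Λ} (e : F = ∑ i, H.dmk (a i) (b i)) (m : M) :
    ∑ i, ρ (H.t (H.counit (b i))) (ρ (a i) m) = ρ (H.counitRight F) m := by
  rw [e, map_sum, map_sum, LinearMap.sum_apply]
  refine Finset.sum_congr rfl fun i _ => ?_
  rw [← Module.End.mul_apply, ← map_mul]
  rfl

variable (hF : H.IsTwoCocycle F)
include hF

theorem leftTwist_t_left (c : B) (y : L) : leftTwist hp F (K.t c) y = K.t c * y := by
  obtain ⟨n, a, b, e⟩ := BeRing.exists_sum F
  have h := ev_counitLeft (lact hp) e (K.t c * y)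
  rw [hF.counit_left, map_one, Module.End.one_apply] at h
  rw [leftTwist, IsBalanced.ev_sum _ e, ← h]
  simp only [lact_t_base, lact_s, lact_t_arg, LinearMap.mul_apply', ← mul_assoc, K.comm]

theorem leftTwist_t_right (c : B) (x : L) : leftTwist hp F x (K.t c) = x * K.t c := by
  obtain ⟨n, a, b, e⟩ := BeRing.exists_sum F
  have h := ev_counitRight (lact hp) e (x * K.t c)
  rw [hF.counit_right, map_one, Module.End.one_apply] at h
  rw [leftTwist, IsBalanced.ev_sum _ e, ← h]
  simp only [lact_t_base, lact_t, lact_arg_t, LinearMap.mul_apply', mul_assoc, K.comm]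

theorem rightTwist_s_left (c : B) (y : L) : rightTwist hp hK F (K.s c) y = K.s c * y := by
  obtain ⟨n, a, b, e⟩ := BeRing.exists_sum F
  have h := ev_counitRight (ract hp hK) e (K.s c * y)
  rw [hF.counit_right, map_one, Module.End.one_apply] at h
  rw [rightTwist, LinearMap.flip_apply, IsBalanced.ev_sum _ e, ← h]
  simp only [ract_s_base, ract_t, ract_s_arg, LinearMap.mul_apply', LinearMap.flip_apply,
    ← mul_assoc, K.comm]

theorem rightTwist_s_right (c : B) (x : L) : rightTwist hp hK F x (K.s c) = x * K.s c := by
  obtain ⟨n, a, b, e⟩ := BeRing.exists_sum F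
  have h := ev_counitLeft (ract hp hK) e (x * K.s c)
  rw [hF.counit_left, map_one, Module.End.one_apply] at h
  rw [rightTwist, LinearMap.flip_apply, IsBalanced.ev_sum _ e, ← h]
  simp only [ract_s_base, ract_s, ract_arg_s, LinearMap.mul_apply', LinearMap.flip_apply,
    mul_assoc, K.comm]

theorem dualCochain_isTwoCocycle : (hp.dualCochain F).IsTwoCocycle where
  cocycle := fun x y z => by
    rw [dualCochain_convMul, dualCochain_convMul]
    change hp.form F x (leftTwist hp F y z) = hp.form F (leftTwist hp F x y) z
    rw [form_eq, form_eq]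
    exact congrArg K.counit (IsEquivariant.ev_assoc hF (lact_mul_equivariant hp)
      (lact_balanced hp) (lact_mul_equivariant hp) (lact_balanced hp) mul_assoc x y z).symm
  one_left := fun x => by
    change hp.form F 1 x = _
    rw [form_eq, ← K.t_one, leftTwist_t_left hp hF, K.t_one, one_mul]
  one_right := fun x => by
    change hp.form F x 1 = _
    rw [form_eq, ← K.t_one, leftTwist_t_right hp hF, K.t_one, mul_one]

theorem twistProd_assoc (x y z : L) : twistProd hp hK F (twistProd hp hK F x y) z =
    twistProd hp hK F x (twistProd hp hK F y z) := by
  have h : ∀ x y z, rightTwist hp hK F (rightTwist hp hK F x y) z =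
      rightTwist hp hK F x (rightTwist hp hK F y z) := fun x y z =>
    (IsEquivariant.ev_assoc hF (ract_mul_equivariant hp hK) (ract_balanced hp hK)
      (ract_mul_equivariant hp hK) (ract_balanced hp hK)
      (fun a b c => (mul_assoc c b a).symm) z y x).symm
  exact IsEquivariant.ev_assoc hF (rightTwist_equivariant hp hK F)
    (rightTwist_equivariant hp hK F).bal (rightTwist_equivariant hp hK F)
    (rightTwist_equivariant hp hK F).bal h x y z

theorem twistProd_s_left (c : B) (y : L) :
    twistProd hp hK F (K.s c) y = lact hp (H.twistS F c) y := by
  rw [← leftBase_ev]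
  exact ((leftBase_balanced H (lact hp)).ev_map (rightTwist_equivariant hp hK F).bal K.s id
    LinearMap.id (fun α b => (lact_s_base hp α b).symm) (fun _ _ => rfl)
    (fun b m => by simp [lact_s, rightTwist_s_left hp hK hF]) F c y).symm

theorem twistProd_s_right (c : B) (x : L) :
    twistProd hp hK F x (K.s c) = lact hp (H.twistT F c) x := by
  rw [← rightBase_ev]
  exact ((rightBase_balanced H (lact hp)).ev_map (rightTwist_equivariant hp hK F).bal id K.s
    LinearMap.id (fun _ _ => rfl) (fun α b => (lact_s_base hp α b).symm)
    (fun b m => by simp [lact_t, rightTwist_s_right hp hK hF]) F x c).symm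

theorem twistProd_t_left (c : B) (y : L) :
    twistProd hp hK F (K.t c) y = ract hp hK (H.twistT F c) y := by
  rw [← rightBase_ev, twistProd_eq]
  exact ((rightBase_balanced H (ract hp hK)).ev_map (leftTwist_equivariant hp hK F).bal id K.t
    LinearMap.id (fun _ _ => rfl) (fun α b => (ract_t_base hp hK α b).symm)
    (fun b m => by simp [ract_t, leftTwist_t_left hp hF]) F y c).symm

theorem twistProd_t_right (c : B) (x : L) :
    twistProd hp hK F x (K.t c) = ract hp hK (H.twistS F c) x := by
  rw [← leftBase_ev, twistProd_eq]
  exact ((leftBase_balanced H (ract hp hK)).ev_map (leftTwist_equivariant hp hK F).bal K.t id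
    LinearMap.id (fun α b => (ract_t_base hp hK α b).symm) (fun _ _ => rfl)
    (fun b m => by simp [ract_s, leftTwist_t_right hp hF]) F c x).symm

theorem one_twistProd (x : L) : twistProd hp hK F 1 x = x := by
  rw [← map_one K.s, twistProd_s_left hp hK hF, twistS_one hF]
  simp

theorem twistProd_one (x : L) : twistProd hp hK F x 1 = x := by
  rw [← map_one K.s, twistProd_s_right hp hK hF, twistT_one hF]
  simp

omit hF in
theorem form_s (a b : B) : hp.form F (K.s a) (K.s b) = H.twistBaseMul F a b := by
  have h := (leftBase_balanced H (baseAct H)).ev_map (lact_balanced hp) K.s K.s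
    K.s.toLinearMap (fun α b => (lact_s_base hp α b).symm) (fun α b => (lact_s_base hp α b).symm)
    (fun a b => by simp [H.counit_s, H.counit_s_one]) F a b
  rw [twistBaseMul_eq] at h
  rw [form_eq, leftTwist, ← h]
  exact K.counit_s_one _

/-! ### The twisted pairing -/

theorem twistPair_twistS (b : B) (α : Λ) (x : L) :
    twistPair hp hK F (H.twistS F b * α) x = H.twistBaseMul F b (twistPair hp hK F α x) := by
  rw [← baseAct_twistS]
  exact (pairing_equivariant hp hK).ev_twistS hF b α x

theorem twistPair_twistT (b : B) (α : Λ) (x : L) :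
    twistPair hp hK F (H.twistT F b * α) x = twistPair hp hK F α (ract hp hK (H.twistS F b) x) :=
  (pairing_equivariant hp hK).bal.ev_twist hF b α x

theorem twistPair_ract_twistT (b : B) (α : Λ) (x : L) :
    twistPair hp hK F α (ract hp hK (H.twistT F b) x) =
      H.twistBaseMul F (twistPair hp hK F α x) b := by
  rw [← baseAct_twistT]
  exact (pairing_equivariant hp hK).ev_twistT hF b α x

omit hF in
theorem twistPair_mul (α β : Λ) (x : L) :
    twistPair hp hK F (α * β) x = twistPair hp hK F α (lact hp β x) := by
  obtain ⟨n, a, b, e⟩ := BeRing.exists_sum F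
  rw [twistPair, IsBalanced.ev_sum _ e, IsBalanced.ev_sum _ e]
  simp [← lact_ract_comm, ← pairing_mul, mul_assoc]

theorem twistPair_s_mul (b : B) (α : Λ) (x : L) :
    twistPair hp hK F α (twistProd hp hK F (K.s b) x) =
      twistPair hp hK F (α * H.twistS F b) x := by
  rw [twistProd_s_left hp hK hF, twistPair_mul]

theorem twistPair_t_mul (b : B) (α : Λ) (x : L) :
    twistPair hp hK F α (twistProd hp hK F (K.t b) x) =
      H.twistBaseMul F (twistPair hp hK F α x) b := by
  rw [twistProd_t_left hp hK hF, twistPair_ract_twistT hp hK hF]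

theorem twistPair_mul_s (b : B) (α : Λ) (x : L) :
    twistPair hp hK F α (twistProd hp hK F x (K.s b)) =
      twistPair hp hK F (α * H.twistT F b) x := by
  rw [twistProd_s_right hp hK hF, twistPair_mul]

theorem twistPair_mul_t (b : B) (α : Λ) (x : L) :
    twistPair hp hK F α (twistProd hp hK F x (K.t b)) =
      twistPair hp hK F (H.twistT F b * α) x := by
  rw [twistProd_t_right hp hK hF, twistPair_twistT hp hK hF]

theorem twistPair_one_right (α : Λ) : twistPair hp hK F α 1 = H.counit α := by
  obtain ⟨n, a, b, e⟩ := BeRing.exists_sum F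
  have h := ev_counitRight (Algebra.lsmul k k Λ) e α
  rw [hF.counit_right, map_one, Module.End.one_apply] at h
  rw [twistPair, IsBalanced.ev_sum _ e, ← hp.one_right]
  conv_rhs => rw [← h]
  simp [ract_one, hp.balanced.t_left, map_sum]

end Products

/-! ### The cotwist -/

section Cotwist

variable {k B Λ L : Type u} [Field k] [Ring B] [Algebra k B] [Ring Λ] [Algebra k Λ]
  [Ring L] [Algebra k L] {H : LeftBialgebroid k B Λ} {K : LeftBialgebroid k B L}
  {p : Λ →ₗ[k] L →ₗ[k] B} {F : H.Diamond}

/-- The algebra `L^Γ`: the vector space `L` with the product `twistProd`. -/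
def Cotwist (_ : IsDualPairing H K p) (_ : K.IsLeftHopf) (_ : H.IsTwoCocycle F) : Type u := L

variable (hp : IsDualPairing H K p) (hK : K.IsLeftHopf) (hF : H.IsTwoCocycle F)

instance : AddCommGroup (Cotwist hp hK hF) := inferInstanceAs (AddCommGroup L)

instance : Module k (Cotwist hp hK hF) := inferInstanceAs (Module k L)

/-- The identity map `L → L^Γ`. -/
def toCotwist : L ≃ₗ[k] Cotwist hp hK hF := LinearEquiv.refl k L

/-- The product of `L^Γ`, as a bilinear map. -/
noncomputable def cotwistMulₗ :
    Cotwist hp hK hF →ₗ[k] Cotwist hp hK hF →ₗ[k] Cotwist hp hK hF :=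
  show L →ₗ[k] L →ₗ[k] L from twistProd hp hK F

noncomputable instance : Ring (Cotwist hp hK hF) :=
  ringOfBilinear (cotwistMulₗ hp hK hF) (toCotwist hp hK hF 1)
    (fun x y z : L => twistProd_assoc hp hK hF x y z) (fun x : L => one_twistProd hp hK hF x)
    (fun x : L => twistProd_one hp hK hF x)

theorem toCotwist_mul (x y : L) : toCotwist hp hK hF x * toCotwist hp hK hF y =
    toCotwist hp hK hF (twistProd hp hK F x y) := rfl

noncomputable instance : Algebra k (Cotwist hp hK hF) :=
  Algebra.ofModule (fun c a b => LinearMap.map_smul₂ (cotwistMulₗ hp hK hF) c a b)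
    (fun c a b => map_smul (cotwistMulₗ hp hK hF a) c b)

/-- The ring `L^Γ` over `B^F`. -/
noncomputable def cotwistBeRing : BeRing k (TwistBase hF) (Cotwist hp hK hF) where
  s := AlgHom.ofLinearMap ((toCotwist hp hK hF).toLinearMap ∘ₗ K.s.toLinearMap ∘ₗ
      (toTwistBase hF).symm.toLinearMap)
    (congrArg (toCotwist hp hK hF) (map_one K.s))
    (fun a b => by
      obtain ⟨a, rfl⟩ := (toTwistBase hF).surjective a
      obtain ⟨b, rfl⟩ := (toTwistBase hF).surjective b
      rw [toTwistBase_mul]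
      change toCotwist hp hK hF (K.s _) = toCotwist hp hK hF (twistProd hp hK F (K.s a) (K.s b))
      rw [twistProd_s_left hp hK hF, lact_s_base, baseAct_twistS]
      rfl)
  t := (toCotwist hp hK hF).toLinearMap ∘ₗ K.t ∘ₗ (toTwistBase hF).symm.toLinearMap
  t_one := congrArg (toCotwist hp hK hF) K.t_one
  t_mul := fun a b => by
    obtain ⟨a, rfl⟩ := (toTwistBase hF).surjective a
    obtain ⟨b, rfl⟩ := (toTwistBase hF).surjective b
    rw [toTwistBase_mul]
    change toCotwist hp hK hF (K.t _) = toCotwist hp hK hF (twistProd hp hK F (K.t b) (K.t a))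
    rw [twistProd_t_left hp hK hF, ract_t_base, baseAct_twistT]
    rfl
  comm := fun a b => by
    obtain ⟨a, rfl⟩ := (toTwistBase hF).surjective a
    obtain ⟨b, rfl⟩ := (toTwistBase hF).surjective b
    change toCotwist hp hK hF (twistProd hp hK F (K.s a) (K.t b)) =
      toCotwist hp hK hF (twistProd hp hK F (K.t b) (K.s a))
    rw [twistProd_s_left hp hK hF, twistProd_t_left hp hK hF, lact_t_base, ract_s_base,
      counit_twistS hF, counit_twistT hF]

theorem cotwistBeRing_s (b : B) :
    (cotwistBeRing hp hK hF).s (toTwistBase hF b) = toCotwist hp hK hF (K.s b) := rfl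

theorem cotwistBeRing_t (b : B) :
    (cotwistBeRing hp hK hF).t (toTwistBase hF b) = toCotwist hp hK hF (K.t b) := rfl

theorem cotwistBeRing_tAct : (cotwistBeRing hp hK hF).tAct (Cotwist hp hK hF) =
    fun b : B => ract hp hK (H.twistT F b) :=
  funext fun b => LinearMap.ext fun x : L => twistProd_t_left hp hK hF b x

theorem cotwistBeRing_sAct : (cotwistBeRing hp hK hF).sAct (Cotwist hp hK hF) =
    fun b : B => lact hp (H.twistS F b) :=
  funext fun b => LinearMap.ext fun x : L => twistProd_s_left hp hK hF b x

variable {hp hK hF} in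
theorem cotwist_dind {P : (cotwistBeRing hp hK hF).Diamond → Prop}
    (w : (cotwistBeRing hp hK hF).Diamond)
    (hmk : ∀ x y : L, P ((cotwistBeRing hp hK hF).dmk (toCotwist hp hK hF x)
      (toCotwist hp hK hF y)))
    (hadd : ∀ v w, P v → P w → P (v + w)) : P w :=
  BeRing.dind w (fun x y => hmk x y) hadd

/-- The map `x, y ↦ F^α ▶ x ◇ F_α ▷ y`. -/
noncomputable def twistDmk (F : H.Diamond) : L →ₗ[k] L →ₗ[k] K.Diamond :=
  (comul_isTensor hp hK).isBalanced.ev F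

variable (hFinv : H.IsInvertible F)

/-- The isomorphism `L^Γ ◇ L^Γ → L ◇ L`, `x ◇ y ↦ F^α ▶ x ◇ F_α ▷ y`. -/
noncomputable def cotwistEquiv : (cotwistBeRing hp hK hF).Diamond ≃ₗ[k] K.Diamond := by
  refine DescendsToIso.equiv (ρ := (cotwistBeRing hp hK hF).tAct (Cotwist hp hK hF))
    (σ := (cotwistBeRing hp hK hF).sAct (Cotwist hp hK hF))
    (f := TensorProduct.lift (M := Cotwist hp hK hF) (N := Cotwist hp hK hF)
      (show L →ₗ[k] L →ₗ[k] K.Diamond from twistDmk hp hK F)) ?_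
  rw [cotwistBeRing_tAct, cotwistBeRing_sAct]
  exact (comul_isTensor hp hK).twist hFinv

theorem cotwistEquiv_dmk (x y : L) : cotwistEquiv hp hK hF hFinv ((cotwistBeRing hp hK hF).dmk
    (toCotwist hp hK hF x) (toCotwist hp hK hF y)) = twistDmk hp hK F x y := rfl

/-- `cotwistEquiv` is the map induced by `Γ^#`. -/
theorem cotwistEquiv_lift (z : L ⊗[k] L) :
    cotwistEquiv hp hK hF hFinv (TensorProduct.lift (cotwistBeRing hp hK hF).dmk
      (TensorProduct.map (toCotwist hp hK hF).toLinearMap (toCotwist hp hK hF).toLinearMap z)) =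
      (hp.dualCochain F).sharp hK z := by
  rw [dualCochain_sharp]
  induction z with
  | zero => simp
  | tmul x y => rfl
  | add v w hv hw => simp only [map_add, hv, hw]

/-- `Δ^Γ`, the composite of `Δ` with the inverse of `cotwistEquiv`. -/
noncomputable def cotwistComul : Cotwist hp hK hF →ₗ[k] (cotwistBeRing hp hK hF).Diamond :=
  (cotwistEquiv hp hK hF hFinv).symm.toLinearMap ∘ₗ K.comul ∘ₗ
    (toCotwist hp hK hF).symm.toLinearMap

theorem cotwistEquiv_comul (x : L) : cotwistEquiv hp hK hF hFinv
    (cotwistComul hp hK hF hFinv (toCotwist hp hK hF x)) = K.comul x :=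
  (cotwistEquiv hp hK hF hFinv).apply_symm_apply _

theorem twistDmk_lact_left (α : Λ) (x y : L) :
    twistDmk hp hK F (lact hp α x) y = lactLeft hp α (twistDmk hp hK F x y) := by
  exact ((comul_isTensor hp hK).isBalanced.ev_map (comul_isTensor hp hK).isBalanced (lact hp α) id
    (lactLeft hp α) (fun β x => lact_ract_comm hp hK α β x) (fun _ _ => rfl) (fun _ _ => rfl)
    F x y).symm

theorem twistDmk_ract_right (α : Λ) (x y : L) :
    twistDmk hp hK F x (ract hp hK α y) = ractRight hp hK α (twistDmk hp hK F x y) := by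
  exact ((comul_isTensor hp hK).isBalanced.ev_map (comul_isTensor hp hK).isBalanced id
    (ract hp hK α) (ractRight hp hK α) (fun _ _ => rfl)
    (fun β x => (lact_ract_comm hp hK β α x).symm) (fun _ _ => rfl) F x y).symm

theorem cotwistEquiv_leftS (b : B) (w : (cotwistBeRing hp hK hF).Diamond) :
    cotwistEquiv hp hK hF hFinv ((cotwistBeRing hp hK hF).leftS (toTwistBase hF b) w) =
      lactLeft hp (H.twistS F b) (cotwistEquiv hp hK hF hFinv w) := by
  induction w using cotwist_dind with
  | hmk x y =>
    change twistDmk hp hK F (twistProd hp hK F (K.s b) x) y = lactLeft hp _ (twistDmk hp hK F x y)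
    rw [twistProd_s_left hp hK hF, twistDmk_lact_left]
  | hadd v w hv hw => simp only [map_add, hv, hw]

theorem cotwistEquiv_rightT (b : B) (w : (cotwistBeRing hp hK hF).Diamond) :
    cotwistEquiv hp hK hF hFinv ((cotwistBeRing hp hK hF).rightT (toTwistBase hF b) w) =
      ractRight hp hK (H.twistT F b) (cotwistEquiv hp hK hF hFinv w) := by
  induction w using cotwist_dind with
  | hmk x y =>
    change twistDmk hp hK F x (twistProd hp hK F (K.t b) y) =
      ractRight hp hK _ (twistDmk hp hK F x y)
    rw [twistProd_t_left hp hK hF, twistDmk_ract_right]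
  | hadd v w hv hw => simp only [map_add, hv, hw]

theorem cotwistEquiv_act_t (b : B) (w : (cotwistBeRing hp hK hF).Diamond) :
    cotwistEquiv hp hK hF hFinv ((cotwistBeRing hp hK hF).act w
      (toCotwist hp hK hF (K.t b)) (1 : Cotwist hp hK hF)) =
    tensorAct H (comul_isTensor hp hK) (H.twistS F b) (cotwistEquiv hp hK hF hFinv w) := by
  induction w using cotwist_dind with
  | hmk x y =>
    rw [BeRing.act_dmk, smul_eq_mul, smul_eq_mul, mul_one]
    change twistDmk hp hK F (twistProd hp hK F x (K.t b)) y = _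
    rw [twistProd_t_right hp hK hF]
    exact (comul_isTensor hp hK).isEquivariant.ev_twistS hF b x y
  | hadd v w hv hw => simp only [map_add, LinearMap.add_apply, hv, hw]

theorem cotwistEquiv_act_s (b : B) (w : (cotwistBeRing hp hK hF).Diamond) :
    cotwistEquiv hp hK hF hFinv ((cotwistBeRing hp hK hF).act w
      (1 : Cotwist hp hK hF) (toCotwist hp hK hF (K.s b))) =
    tensorAct H (comul_isTensor hp hK) (H.twistT F b) (cotwistEquiv hp hK hF hFinv w) := by
  induction w using cotwist_dind with
  | hmk x y =>
    rw [BeRing.act_dmk, smul_eq_mul, smul_eq_mul, mul_one]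
    change twistDmk hp hK F x (twistProd hp hK F y (K.s b)) = _
    rw [twistProd_s_right hp hK hF]
    exact (comul_isTensor hp hK).isEquivariant.ev_twistT hF b x y
  | hadd v w hv hw => simp only [map_add, LinearMap.add_apply, hv, hw]

/-- The twisted pairing, on `Λ^F` and `L^Γ`. -/
noncomputable def cotwistPair : Λ →ₗ[k] Cotwist hp hK hF →ₗ[k] TwistBase hF :=
  show Λ →ₗ[k] L →ₗ[k] B from twistPair hp hK F

theorem cotwistPair_apply (α : Λ) (x : L) : cotwistPair hp hK hF α (toCotwist hp hK hF x) =
    toTwistBase hF (twistPair hp hK F α x) := rfl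

/-- Comultiplication and counit of `L^Γ`. -/
noncomputable def cotwistComulData : ComulData k (TwistBase hF) (Cotwist hp hK hF) where
  toBeRing := cotwistBeRing hp hK hF
  comul := cotwistComul hp hK hF hFinv
  counit := cotwistPair hp hK hF 1
  comul_s := fun b x => by
    obtain ⟨b, rfl⟩ := (toTwistBase hF).surjective b
    obtain ⟨x, rfl⟩ := (toCotwist hp hK hF).surjective x
    apply (cotwistEquiv hp hK hF hFinv).injective
    rw [cotwistEquiv_leftS, cotwistBeRing_s, toCotwist_mul, cotwistEquiv_comul, cotwistEquiv_comul,
      twistProd_s_left hp hK hF, comul_lact]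
  comul_t := fun b x => by
    obtain ⟨b, rfl⟩ := (toTwistBase hF).surjective b
    obtain ⟨x, rfl⟩ := (toCotwist hp hK hF).surjective x
    apply (cotwistEquiv hp hK hF hFinv).injective
    rw [cotwistEquiv_rightT, cotwistBeRing_t, toCotwist_mul, cotwistEquiv_comul,
      cotwistEquiv_comul, twistProd_t_left hp hK hF, comul_ract]
  takeuchi := fun x b => by
    obtain ⟨b, rfl⟩ := (toTwistBase hF).surjective b
    obtain ⟨x, rfl⟩ := (toCotwist hp hK hF).surjective x
    apply (cotwistEquiv hp hK hF hFinv).injective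
    rw [cotwistBeRing_s, cotwistBeRing_t, cotwistEquiv_act_t, cotwistEquiv_act_s,
      cotwistEquiv_comul, tensorAct_comul, tensorAct_comul, counit_twistS hF, counit_twistT hF]
  counit_s := fun b x => by
    obtain ⟨b, rfl⟩ := (toTwistBase hF).surjective b
    obtain ⟨x, rfl⟩ := (toCotwist hp hK hF).surjective x
    rw [cotwistBeRing_s, toCotwist_mul, cotwistPair_apply, cotwistPair_apply, toTwistBase_mul,
      twistPair_s_mul hp hK hF, one_mul, ← mul_one (H.twistS F b), twistPair_twistS hp hK hF]
  counit_t := fun b x => by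
    obtain ⟨b, rfl⟩ := (toTwistBase hF).surjective b
    obtain ⟨x, rfl⟩ := (toCotwist hp hK hF).surjective x
    rw [cotwistBeRing_t, toCotwist_mul, cotwistPair_apply, cotwistPair_apply, toTwistBase_mul,
      twistPair_t_mul hp hK hF]

end Cotwist

/-! ### Coassociativity and counitality of the cotwist -/

section Coassoc

variable {k B Λ L : Type u} [Field k] [Ring B] [Algebra k B] [Ring Λ] [Algebra k Λ]
  [Ring L] [Algebra k L] {H : LeftBialgebroid k B Λ} {K : LeftBialgebroid k B L}
  {p : Λ →ₗ[k] L →ₗ[k] B} {F : H.Diamond}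
  (hp : IsDualPairing H K p) (hK : K.IsLeftHopf)

theorem lactLeft_s (b : B) (w : K.Diamond) : lactLeft hp (H.s b) w = K.leftS b w := by
  induction w using BeRing.dind with
  | hmk x y => simp [lact_s]
  | hadd v w hv hw => simp only [map_add, hv, hw]

theorem ractRight_t (b : B) (w : K.Diamond) : ractRight hp hK (H.t b) w = K.rightT b w := by
  induction w using BeRing.dind with
  | hmk x y => exact congrArg (K.dmk x) (ract_t hp hK b y)
  | hadd v w hv hw => simp only [map_add, hv, hw]

/-- The action of `Λ` on `L ◇ L` by `▷` on the first factor. -/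
def lactLeftAct : Λ →ₐ[k] Module.End k K.Diamond :=
  AlgHom.ofLinearMap
    { toFun := lactLeft hp
      map_add' := fun α β => LinearMap.ext fun w => by
        refine BeRing.dext_apply (g := lactLeft hp α + lactLeft hp β) (fun x y => ?_) w
        simp
      map_smul' := fun c α => LinearMap.ext fun w => by
        refine BeRing.dext_apply (g := c • lactLeft hp α) (fun x y => ?_) w
        simp }
    (LinearMap.ext fun w => by
      refine BeRing.dext_apply (f := lactLeft hp 1) (g := LinearMap.id) (fun x y => ?_) w
      simp)
    (fun α β => LinearMap.ext fun w => by
      refine BeRing.dext_apply (f := lactLeft hp (α * β)) (g := lactLeft hp α ∘ₗ lactLeft hp β)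
        (fun x y => ?_) w
      simp)

/-- The action of `Λ` on `L ◇ L` by `▶` on the second factor. -/
noncomputable def ractRightAct : Λ →ₐ[k] Module.End k K.Diamond :=
  AlgHom.ofLinearMap
    { toFun := ractRight hp hK
      map_add' := fun α β => LinearMap.ext fun w => by
        refine BeRing.dext_apply (g := ractRight hp hK α + ractRight hp hK β) (fun x y => ?_) w
        simp
      map_smul' := fun c α => LinearMap.ext fun w => by
        refine BeRing.dext_apply (g := c • ractRight hp hK α) (fun x y => ?_) w
        simp }
    (LinearMap.ext fun w => by
      refine BeRing.dext_apply (f := ractRight hp hK 1) (g := LinearMap.id) (fun x y => ?_) w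
      exact congrArg (K.dmk x) (LinearMap.congr_fun (map_one (ract hp hK)) y))
    (fun α β => LinearMap.ext fun w => by
      refine BeRing.dext_apply (f := ractRight hp hK (α * β))
        (g := ractRight hp hK α ∘ₗ ractRight hp hK β) (fun x y => ?_) w
      exact congrArg (K.dmk x) (LinearMap.congr_fun (map_mul (ract hp hK) α β) y))

/-- `L ◇ L ◇ L` is a model of the tensor product of `L` (action `▶`) and `L ◇ L` (action `▷`
on the left). -/
theorem mkRight_isTensor_act :
    IsTensor H.toBeRing (ract hp hK) (lactLeftAct hp) K.mkRight := by
  have h₁ : (fun b => ract hp hK (H.t b)) = K.tAct L :=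
    funext fun b => LinearMap.ext fun x => ract_t hp hK b x
  have h₂ : (fun b => lactLeftAct hp (H.s b)) = K.leftS :=
    funext fun b => LinearMap.ext fun w => lactLeft_s hp b w
  rw [IsTensor, h₁, h₂]
  exact Bal.descendsToIso

theorem mkLeft_balanced_act :
    IsBalanced H.toBeRing (ractRightAct hp hK) (lact hp) K.mkLeft := by
  intro b w z
  rw [lact_s]
  refine Eq.trans ?_ (K.mkLeft_bal b w z)
  exact congrArg (K.mkLeft · z) (ractRight_t hp hK b w)

variable (F) in
/-- Both sides are `Σ F^α ▶ x ◇ F_α ▷ F^β ▶ y ◇ F_β ▷ z`. -/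
theorem mkRight_ev_twistDmk (x y z : L) :
    (mkRight_isTensor_act hp hK).isBalanced.ev F x (twistDmk hp hK F y z) =
      (mkLeft_balanced_act hp hK).ev F (twistDmk hp hK F x y) z := by
  obtain ⟨n, a, b, e⟩ := BeRing.exists_sum F
  have h : ∀ x y, twistDmk hp hK F x y = ∑ i, K.dmk (ract hp hK (a i) x) (lact hp (b i) y) :=
    fun x y => (comul_isTensor hp hK).isBalanced.ev_sum e x y
  rw [IsBalanced.ev_sum _ e, IsBalanced.ev_sum _ e, h, h]
  simp only [map_sum, LinearMap.sum_apply]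
  rw [Finset.sum_comm]
  refine Finset.sum_congr rfl fun j _ => Finset.sum_congr rfl fun i _ => ?_
  change K.mkRight _ (K.dmk (lact hp (b i) (ract hp hK (a j) y)) _) =
    K.mkRight _ (K.dmk (ract hp hK (a j) (lact hp (b i) y)) _)
  rw [lact_ract_comm]

variable (hF : H.IsTwoCocycle F) (hFinv : H.IsInvertible F)

/-- The isomorphism `L^Γ ◇ L^Γ ◇ L^Γ → L ◇ L ◇ L`. -/
noncomputable def cotwistEquiv₃ : (cotwistBeRing hp hK hF).Diamond₃ ≃ₗ[k] K.Diamond₃ := by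
  refine DescendsToIso.equiv (ρ := (cotwistBeRing hp hK hF).tAct (Cotwist hp hK hF))
    (σ := (cotwistBeRing hp hK hF).leftS)
    (f := TensorProduct.lift (M := Cotwist hp hK hF)
      (show L →ₗ[k] (cotwistBeRing hp hK hF).Diamond →ₗ[k] K.Diamond₃ from
        ((mkRight_isTensor_act hp hK).isBalanced.ev F).compl₂
          (cotwistEquiv hp hK hF hFinv).toLinearMap)) ?_
  rw [cotwistBeRing_tAct]
  exact ((mkRight_isTensor_act hp hK).twist hFinv).comp_right (cotwistEquiv hp hK hF hFinv)
    fun b w => cotwistEquiv_leftS hp hK hF hFinv b w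

theorem cotwistEquiv₃_mkRight (x : L) (w : (cotwistBeRing hp hK hF).Diamond) :
    cotwistEquiv₃ hp hK hF hFinv ((cotwistBeRing hp hK hF).mkRight (toCotwist hp hK hF x) w) =
      (mkRight_isTensor_act hp hK).isBalanced.ev F x (cotwistEquiv hp hK hF hFinv w) := rfl

theorem cotwistEquiv₃_mkLeft (w : (cotwistBeRing hp hK hF).Diamond) (z : L) :
    cotwistEquiv₃ hp hK hF hFinv ((cotwistBeRing hp hK hF).mkLeft w (toCotwist hp hK hF z)) =
      (mkLeft_balanced_act hp hK).ev F (cotwistEquiv hp hK hF hFinv w) z := by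
  induction w using cotwist_dind with
  | hmk x y =>
    rw [BeRing.mkLeft_dmk, cotwistEquiv₃_mkRight, cotwistEquiv_dmk, cotwistEquiv_dmk,
      mkRight_ev_twistDmk]
  | hadd v w hv hw => simp only [map_add, LinearMap.add_apply, hv, hw]

theorem cotwistEquiv₃_comulRight (T : (cotwistBeRing hp hK hF).Diamond) :
    cotwistEquiv₃ hp hK hF hFinv ((cotwistComulData hp hK hF hFinv).comulRight T) =
      K.comulRight (cotwistEquiv hp hK hF hFinv T) := by
  let f : (cotwistBeRing hp hK hF).Diamond →ₗ[k] (cotwistBeRing hp hK hF).Diamond₃ :=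
    (cotwistComulData hp hK hF hFinv).comulRight
  have hf : ∀ T, cotwistEquiv₃ hp hK hF hFinv (f T) =
      K.comulRight (cotwistEquiv hp hK hF hFinv T) := fun T => by
    induction T using cotwist_dind with
    | hmk x y =>
      change cotwistEquiv₃ hp hK hF hFinv ((cotwistBeRing hp hK hF).mkRight (toCotwist hp hK hF x)
        (cotwistComul hp hK hF hFinv (toCotwist hp hK hF y))) = _
      rw [cotwistEquiv₃_mkRight, cotwistEquiv_comul, cotwistEquiv_dmk]
      exact ((comul_isTensor hp hK).isBalanced.ev_map (mkRight_isTensor_act hp hK).isBalanced id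
        K.comul K.comulRight (fun _ _ => rfl) (fun α y => comul_lact hp α y) (fun _ _ => rfl)
        F x y).symm
    | hadd v w hv hw => simp only [map_add, hv, hw]
  exact hf T

theorem cotwistEquiv₃_comulLeft (T : (cotwistBeRing hp hK hF).Diamond) :
    cotwistEquiv₃ hp hK hF hFinv ((cotwistComulData hp hK hF hFinv).comulLeft T) =
      K.comulLeft (cotwistEquiv hp hK hF hFinv T) := by
  let f : (cotwistBeRing hp hK hF).Diamond →ₗ[k] (cotwistBeRing hp hK hF).Diamond₃ :=
    (cotwistComulData hp hK hF hFinv).comulLeft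
  have hf : ∀ T, cotwistEquiv₃ hp hK hF hFinv (f T) =
      K.comulLeft (cotwistEquiv hp hK hF hFinv T) := fun T => by
    induction T using cotwist_dind with
    | hmk x y =>
      change cotwistEquiv₃ hp hK hF hFinv ((cotwistBeRing hp hK hF).mkLeft
        (cotwistComul hp hK hF hFinv (toCotwist hp hK hF x)) (toCotwist hp hK hF y)) = _
      rw [cotwistEquiv₃_mkLeft, cotwistEquiv_comul, cotwistEquiv_dmk]
      exact ((comul_isTensor hp hK).isBalanced.ev_map (mkLeft_balanced_act hp hK) K.comul id
        K.comulLeft (fun α x => comul_ract hp hK α x) (fun _ _ => rfl) (fun _ _ => rfl)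
        F x y).symm
    | hadd v w hv hw => simp only [map_add, hv, hw]
  exact hf T

/-! ### Counits of the cotwist -/

theorem tensorAct_comul_s (b : B) (w : K.Diamond) :
    tensorAct H (comul_isTensor hp hK) (H.s b) w = K.act w (K.t b) (1 : L) := by
  induction w using BeRing.dind with
  | hmk x y =>
    rw [(comul_isTensor hp hK).isEquivariant.map_s, ract_s]
    simp
  | hadd v w hv hw => simp only [map_add, LinearMap.add_apply, hv, hw]

theorem contractLeft_balanced : IsBalanced H.toBeRing (Algebra.lsmul k k Λ)
    (tensorAct H (comul_isTensor hp hK)) (contractLeft hp) := by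
  intro b α w
  rw [tensorAct_comul_s]
  exact contractLeft_t_mul hp b α w

include hF

/-- The action of `s^F([α | x])` is the twist by `F` of `(α, x ◇ y) ↦ ⟨α | x⟩ y`. -/
theorem lact_twistS_twistPair (α : Λ) (x y : L) :
    lact hp (H.twistS F (twistPair hp hK F α x)) y =
      (contractLeft_balanced hp hK).ev F α (twistDmk hp hK F x y) := by
  rw [← leftBase_ev]
  exact IsEquivariant.ev_assoc hF (pairing_equivariant hp hK) (leftBase_balanced H (lact hp))
    (comul_isTensor hp hK).isEquivariant (contractLeft_balanced hp hK)
    (fun α x y => lact_s hp _ y) α x y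

/-- `[α | x₁] x₂`, formed in `Λ^F` and `L^Γ`, is again `α ▷ x`. -/
theorem contractLeft_ev_comul (α : Λ) (x : L) :
    (contractLeft_balanced hp hK).ev F α (K.comul x) = lact hp α x := by
  obtain ⟨n, a, b, e⟩ := BeRing.exists_sum F
  have h := ev_counitRight (Algebra.lsmul k k Λ) e α
  rw [hF.counit_right, map_one, Module.End.one_apply] at h
  rw [IsBalanced.ev_sum _ e, lact_apply]
  conv_rhs => rw [← h]
  simp only [tensorAct_comul, ← contractLeft_t_mul, map_sum, LinearMap.sum_apply]
  rfl

omit hF in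
/-- A model of the tensor product of `L` with the action `▶` and `Λ`. -/
theorem canonical_isTensor : IsTensor H.toBeRing (ract hp hK) (Algebra.lsmul k k Λ)
    (Bal.mk (fun b => ract hp hK (H.t b)) (fun b => Algebra.lsmul k k Λ (H.s b))) :=
  Bal.descendsToIso

omit hF in
/-- `(x ◇ α, y) ↦ \bar{⟨α | y⟩} x`. -/
theorem exists_contract : ∃ ν : Bal (fun b => ract hp hK (H.t b))
      (fun b => Algebra.lsmul k k Λ (H.s b)) →ₗ[k] L →ₗ[k] L,
    ∀ x α y, ν (Bal.mk _ _ x α) y = K.t (p α y) * x := by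
  refine ⟨Bal.lift (LinearMap.mk₂ k (fun x α => (LinearMap.mulRight k x) ∘ₗ K.t ∘ₗ p α)
    (by intros; ext; simp [mul_add]) (by intros; ext; simp) (by intros; ext; simp [add_mul])
    (by intros; ext; simp)) ?_, fun x α y => rfl⟩
  intro b x α
  ext y
  simp [ract_t, hp.balanced.s_left, K.t_mul, mul_assoc]

/-- The left side is `(id ◇ ε^Γ)(x ◇ y)` in `L^Γ`; the right side is a function of the image of
`x ◇ y` in `L ◇_B L`. -/
theorem ract_twistT_twistPair {n : ℕ} {a b : Fin n → Λ} (e : F = ∑ i, H.dmk (a i) (b i))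
    (x y : L) :
    ract hp hK (H.twistT F (twistPair hp hK F 1 y)) x =
      ∑ i, K.counitRight (tensorAct H (comul_isTensor hp hK) (a i)
        (ractRight hp hK (b i) (twistDmk hp hK F x y))) := by
  obtain ⟨ν, hν⟩ := exists_contract hp hK
  have D := canonical_isTensor hp hK
  have hν' : ∀ γ x α y, ν (tensorAct H D γ (Bal.mk _ _ x α)) y =
      K.counitRight (tensorAct H (comul_isTensor hp hK) γ (K.dmk x (lact hp α y))) := by
    intro γ x α y
    obtain ⟨m, c, d, e'⟩ := BeRing.exists_sum (H.comul γ)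
    rw [D.isEquivariant.map_act, (comul_isTensor hp hK).isEquivariant.map_act,
      IsBalanced.ev_sum _ e', IsBalanced.ev_sum _ e']
    simp only [map_sum, LinearMap.sum_apply, hν]
    refine Finset.sum_congr rfl fun i _ => ?_
    change _ = K.t (K.counit _) * _
    rw [counit_lact, ← pairing_mul]
    rfl
  have hbal : IsBalanced H.toBeRing (tensorAct H D) (ract hp hK) ν := by
    intro c u y
    induction u using Bal.induction with
    | hmk x α =>
      rw [D.isEquivariant.map_t, hν, hν, ract_s]
      exact congrArg (fun z => K.t z * x) (hp.balanced.t_left c α y)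
    | hadd v w hv hw => simp only [map_add, LinearMap.add_apply, hv, hw]
  have h := IsEquivariant.ev_assoc hF D.isEquivariant hbal (pairing_equivariant hp hK)
    (rightBase_balanced H (ract hp hK))
    (fun x α y => (hν x α y).trans (ract_t hp hK _ x).symm) x 1 y
  rw [rightBase_ev] at h
  refine h.symm.trans ?_
  rw [IsBalanced.ev_sum _ e]
  refine Finset.sum_congr rfl fun i _ => ?_
  rw [IsBalanced.ev_sum _ e, ← twistDmk_ract_right, twistDmk, IsBalanced.ev_sum _ e]
  simp only [map_sum, LinearMap.sum_apply, hν', Algebra.lsmul_coe, smul_eq_mul, mul_one]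

theorem sum_counitRight_tensorAct_comul {n : ℕ} {a b : Fin n → Λ}
    (e : F = ∑ i, H.dmk (a i) (b i)) (x : L) :
    ∑ i, K.counitRight (tensorAct H (comul_isTensor hp hK) (a i)
        (ractRight hp hK (b i) (K.comul x))) = x := by
  have hc : ∀ c (w : K.Diamond), K.counitRight (K.act w (K.t c) (1 : L)) =
      K.counitRight w * K.t c := fun c w => by
    induction w using BeRing.dind with
    | hmk x y =>
      change K.t (K.counit (y * 1)) * (x * K.t c) = K.t (K.counit y) * x * K.t c
      rw [mul_one, mul_assoc]
    | hadd v w hv hw => simp only [map_add, LinearMap.add_apply, add_mul, hv, hw]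
  have h := ev_counitLeft (ract hp hK) e x
  rw [hF.counit_left, map_one, Module.End.one_apply] at h
  conv_rhs => rw [← h]
  refine Finset.sum_congr rfl fun i _ => ?_
  rw [← comul_ract, tensorAct_comul, hc, K.counit_comul_right, ract_s]

theorem twistDmk_one : twistDmk hp hK F 1 1 = K.dmk 1 1 := by
  obtain ⟨n, a, b, e⟩ := BeRing.exists_sum F
  have h := ev_counitLeft (lact hp) e 1
  rw [hF.counit_left, map_one (lact hp), Module.End.one_apply] at h
  rw [twistDmk, IsBalanced.ev_sum _ e, ← congrArg (K.dmk 1) h, map_sum]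
  refine Finset.sum_congr rfl fun i _ => ?_
  rw [ract_one, lact_s, ← K.dmk_bal', mul_one]

end Coassoc

/-! ### Multiplicativity of the cotwisted coproduct -/

section Mult

variable {k B Λ L : Type u} [Field k] [Ring B] [Algebra k B] [Ring Λ] [Algebra k Λ]
  [Ring L] [Algebra k L] {H : LeftBialgebroid k B Λ} {K : LeftBialgebroid k B L}
  {p : Λ →ₗ[k] L →ₗ[k] B} (F : H.Diamond)
  (hp : IsDualPairing H K p) (hK : K.IsLeftHopf)

/-- `(c, u ◇ v) ↦ m_F(u, c) ◇ v`, where `m_F` is `leftTwist`. -/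
def mulFirst : L →ₗ[k] K.Diamond →ₗ[k] K.Diamond :=
  K.dliftFam ((leftTwist hp F).flip.compr₂ K.dmk) (fun c b u v => by
    have h : leftTwist hp F (K.t b * u) c = K.t b * leftTwist hp F u c :=
      ((lact_balanced hp).ev_map (lact_balanced hp) (fun u => K.t b * u) id
        (LinearMap.mulLeft k (K.t b)) (fun α u => (lact_t_arg hp α b u).symm) (fun _ _ => rfl)
        (fun u c => (mul_assoc _ _ _).symm) F u c).symm
    simp [h, K.dmk_bal'])

theorem mulFirst_dmk (c u v : L) :
    mulFirst F hp c (K.dmk u v) = K.dmk (leftTwist hp F u c) v := rfl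

/-- `(u ◇ v, d) ↦ u ◇ m^F(v, d)`, where `m^F` is `rightTwist`. -/
noncomputable def mulSecond : K.Diamond →ₗ[k] L →ₗ[k] K.Diamond :=
  K.dlift (LinearMap.mk₂ k (fun u v => K.dmk u ∘ₗ rightTwist hp hK F v)
    (by intros; ext; simp) (by intros; ext; simp) (by intros; ext; simp) (by intros; ext; simp))
    (fun b u v => by
      have h : ∀ d, rightTwist hp hK F (K.s b * v) d = K.s b * rightTwist hp hK F v d := fun d =>
        ((ract_balanced hp hK).ev_map (ract_balanced hp hK) id (fun u => K.s b * u)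
          (LinearMap.mulLeft k (K.s b)) (fun _ _ => rfl)
          (fun α u => (ract_s_arg hp hK α b u).symm)
          (fun u c => (mul_assoc _ _ _).symm) F d v).symm
      ext d
      simp [h, K.dmk_bal'])

theorem mulSecond_dmk (u v d : L) :
    mulSecond F hp hK (K.dmk u v) d = K.dmk u (rightTwist hp hK F v d) := rfl

theorem mulFirst_balanced : IsBalanced H.toBeRing (ract hp hK)
    (tensorAct H (comul_isTensor hp hK)) (mulFirst F hp) := by
  intro b c w
  rw [tensorAct_comul_s]
  induction w using BeRing.dind with
  | hmk u v =>
    have h := (leftTwist_equivariant hp hK F).bal b c u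
    rw [BeRing.act_dmk, mulFirst_dmk, mulFirst_dmk, smul_eq_mul, smul_eq_mul, mul_one,
      ← ract_s hp hK]
    exact congrArg (K.dmk · v) h
  | hadd v w hv hw => simp only [map_add, LinearMap.add_apply, hv, hw]

theorem mulSecond_balanced : IsBalanced H.toBeRing (tensorAct H (comul_isTensor hp hK))
    (lact hp) (mulSecond F hp hK) := by
  intro b w d
  induction w using BeRing.dind with
  | hmk u v =>
    rw [(comul_isTensor hp hK).isEquivariant.map_t]
    exact congrArg (K.dmk u) ((rightTwist_equivariant hp hK F).bal b v d)
  | hadd v w hv hw => simp only [map_add, LinearMap.add_apply, hv, hw]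

theorem mulSecond_equivariant : IsEquivariant H (tensorAct H (comul_isTensor hp hK))
    (lact hp) (tensorAct H (comul_isTensor hp hK)) (mulSecond F hp hK) :=
  (comul_isTensor hp hK).equivariant_of_assoc (mulSecond_balanced F hp hK)
    (rightTwist_equivariant hp hK F) (comul_isTensor hp hK).isEquivariant (fun _ _ _ => rfl)

/-- By `tensorAct_comul`, an element `T` of `Λ ◇ Λ` acts on `(Δ(x), d)` through `(ε ◇ id)(T)`. -/
theorem mulSecond_ev_comul (T : H.Diamond) (x d : L) :
    (mulSecond_balanced F hp hK).ev T (K.comul x) d =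
      mulSecond F hp hK (K.comul x) (lact hp (H.counitLeft T) d) := by
  induction T using BeRing.dind with
  | hmk a b =>
    have h := mulSecond_balanced F hp hK (H.counit a) (K.comul x) (lact hp b d)
    have ht : ∀ c w, tensorAct H (comul_isTensor hp hK) (H.t c) w = K.act w (1 : L) (K.s c) :=
      fun c w => by
        induction w using BeRing.dind with
        | hmk x y =>
          rw [(comul_isTensor hp hK).isEquivariant.map_t, lact_t]
          simp
        | hadd v w hv hw => simp only [map_add, LinearMap.add_apply, hv, hw]
    rw [ht] at h
    rw [IsBalanced.ev_dmk, tensorAct_comul, K.takeuchi, h, ← Module.End.mul_apply, ← map_mul]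
    rfl
  | hadd v w hv hw => simp only [map_add, LinearMap.add_apply, hv, hw]

/-- The map `c ◇ d ↦ m_F(x₁, c) ◇ m^F(x₂, d)`. -/
noncomputable def mulComul (x : L) : K.Diamond →ₗ[k] K.Diamond :=
  K.dlift ((mulFirst F hp).compl₂ (mulSecond F hp hK (K.comul x))) (fun b c d => by
    have h₁ := mulFirst_balanced F hp hK b c (mulSecond F hp hK (K.comul x) d)
    rw [(mulSecond_equivariant F hp hK).map_act, mulSecond_ev_comul, H.counit_comul_left, ract_t,
      lact_s] at h₁
    exact h₁)

theorem mulComul_dmk (x c d : L) : mulComul F hp hK x (K.dmk c d) =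
    mulFirst F hp c (mulSecond F hp hK (K.comul x) d) := rfl

/-- `Δ(m^F(x, y)) = x₁ y₁ ◇ m^F(x₂, y₂)`, where `m^F` is `rightTwist`. -/
theorem comul_rightTwist {x y : L} {n : ℕ} {c d : Fin n → L}
    (hy : K.comul y = ∑ j, K.dmk (c j) (d j)) :
    K.comul (rightTwist hp hK F x y) =
      ∑ j, mulSecond F hp hK (K.act (K.comul x) (c j) (1 : L)) (d j) := by
  obtain ⟨m, a, b, e⟩ := BeRing.exists_sum F
  have h : ∀ u v, rightTwist hp hK F u v = ∑ i, ract hp hK (b i) u * ract hp hK (a i) v :=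
    fun u v => (ract_balanced hp hK).ev_sum e v u
  have hw : ∀ (w : K.Diamond) c d, mulSecond F hp hK (K.act w c (1 : L)) d =
      ∑ i, K.act (ractRight hp hK (b i) w) c (ract hp hK (a i) d) := fun w c d => by
    induction w using BeRing.dind with
    | hmk u v =>
      rw [BeRing.act_dmk, smul_eq_mul, smul_eq_mul, mul_one, mulSecond_dmk, h, map_sum]
      rfl
    | hadd v w hv hw => simp only [map_add, LinearMap.add_apply, hv, hw, Finset.sum_add_distrib]
  simp only [hw, h, map_sum, K.comul_mul, comul_ract, hy]
  rw [Finset.sum_comm]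
  refine Finset.sum_congr rfl fun i _ => Finset.sum_congr rfl fun j _ => ?_
  rw [← comul_ract, ractRight_dmk, K.comulAct_dmk]
  rfl

/-- `Δ(x ·_Γ y) = m_F(x₁, y₁) ◇ m^F(x₂, y₂)`. -/
theorem comul_twistProd (x y : L) :
    K.comul (twistProd hp hK F x y) = mulComul F hp hK x (K.comul y) := by
  obtain ⟨m, a, b, e⟩ := BeRing.exists_sum F
  obtain ⟨n, c, d, hy⟩ := BeRing.exists_sum (K.comul y)
  have hy' : ∀ i, K.comul (lact hp (b i) y) = ∑ j, K.dmk (lact hp (b i) (c j)) (d j) := fun i => by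
    rw [comul_lact, hy, map_sum]
    rfl
  have h : ∀ u v, leftTwist hp F u v = ∑ i, lact hp (a i) u * lact hp (b i) v :=
    fun u v => (lact_balanced hp).ev_sum e u v
  have hw : ∀ (w : K.Diamond) c d, mulFirst F hp c (mulSecond F hp hK w d) =
      ∑ i, mulSecond F hp hK (K.act (lactLeft hp (a i) w) (lact hp (b i) c) (1 : L)) d :=
    fun w c d => by
      induction w using BeRing.dind with
      | hmk u v =>
        rw [mulSecond_dmk, mulFirst_dmk, h, map_sum, LinearMap.sum_apply]
        refine Finset.sum_congr rfl fun i _ => ?_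
        rw [lactLeft_dmk, BeRing.act_dmk, smul_eq_mul, smul_eq_mul, mul_one, mulSecond_dmk]
      | hadd v w hv hw => simp only [map_add, LinearMap.add_apply, hv, hw, Finset.sum_add_distrib]
  rw [twistProd, IsBalanced.ev_sum _ e, map_sum, hy, map_sum]
  simp only [comul_rightTwist F hp hK (hy' _), mulComul_dmk, hw, comul_lact]
  exact Finset.sum_comm

variable {F} (hF : H.IsTwoCocycle F)
include hF

/-- Left multiplication of the first factor, carried to `L ◇_B L`. As `twistProd` twists `leftTwist`
along `▶`, the cocycle identity moves it past `twistDmk`. -/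
theorem twistDmk_twistProd_left (x c v : L) : twistDmk hp hK F (twistProd hp hK F x c) v =
    (mulFirst_balanced F hp hK).ev F c (twistDmk hp hK F x v) := by
  rw [twistProd_eq]
  exact IsEquivariant.ev_assoc hF (leftTwist_equivariant hp hK F) (comul_isTensor hp hK).isBalanced
    (comul_isTensor hp hK).isEquivariant (mulFirst_balanced F hp hK) (fun _ _ _ => rfl) c x v

/-- The analogue of `twistDmk_twistProd_left` for the second factor. -/
theorem twistDmk_twistProd_right (x y d : L) : twistDmk hp hK F x (twistProd hp hK F y d) =
    (mulSecond_balanced F hp hK).ev F (twistDmk hp hK F x y) d :=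
  (IsEquivariant.ev_assoc hF (comul_isTensor hp hK).isEquivariant (mulSecond_balanced F hp hK)
    (rightTwist_equivariant hp hK F) (comul_isTensor hp hK).isBalanced (fun _ _ _ => rfl)
    x y d).symm

theorem mulFirst_ev_mulSecond_ev (x c d : L) :
    (mulFirst_balanced F hp hK).ev F c ((mulSecond_balanced F hp hK).ev F (K.comul x) d) =
      mulComul F hp hK x (twistDmk hp hK F c d) := by
  obtain ⟨n, a, b, e⟩ := BeRing.exists_sum F
  rw [mulSecond_ev_comul, hF.counit_left, map_one (lact hp), Module.End.one_apply, twistDmk,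
    IsBalanced.ev_sum _ e, IsBalanced.ev_sum _ e, map_sum]
  refine Finset.sum_congr rfl fun i _ => ?_
  rw [(mulSecond_equivariant F hp hK).map_act, mulSecond_ev_comul, H.counit_comul_left,
    mulComul_dmk]

theorem cotwistEquiv_act (hFinv : H.IsInvertible F) (T : (cotwistBeRing hp hK hF).Diamond)
    (c d : L) : cotwistEquiv hp hK hF hFinv ((cotwistBeRing hp hK hF).act T
      (toCotwist hp hK hF c) (toCotwist hp hK hF d)) =
    (mulFirst_balanced F hp hK).ev F c
      ((mulSecond_balanced F hp hK).ev F (cotwistEquiv hp hK hF hFinv T) d) := by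
  induction T using cotwist_dind with
  | hmk x y =>
    rw [BeRing.act_dmk, smul_eq_mul, smul_eq_mul, toCotwist_mul, toCotwist_mul, cotwistEquiv_dmk,
      cotwistEquiv_dmk, twistDmk_twistProd_left hp hK hF, twistDmk_twistProd_right hp hK hF]
  | hadd v w hv hw => simp only [map_add, LinearMap.add_apply, hv, hw]

theorem cotwistEquiv_comulAct (hFinv : H.IsInvertible F) (x : L)
    (w : (cotwistBeRing hp hK hF).Diamond) : cotwistEquiv hp hK hF hFinv
      ((cotwistComulData hp hK hF hFinv).comulAct (toCotwist hp hK hF x) w) =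
    mulComul F hp hK x (cotwistEquiv hp hK hF hFinv w) := by
  let f : (cotwistBeRing hp hK hF).Diamond →ₗ[k] (cotwistBeRing hp hK hF).Diamond :=
    (cotwistComulData hp hK hF hFinv).comulAct (toCotwist hp hK hF x)
  have hf : ∀ w, cotwistEquiv hp hK hF hFinv (f w) =
      mulComul F hp hK x (cotwistEquiv hp hK hF hFinv w) := fun w => by
    induction w using cotwist_dind with
    | hmk c d =>
      change cotwistEquiv hp hK hF hFinv ((cotwistBeRing hp hK hF).act
        (cotwistComul hp hK hF hFinv (toCotwist hp hK hF x)) _ _) = _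
      rw [cotwistEquiv_act, cotwistEquiv_comul, mulFirst_ev_mulSecond_ev hp hK hF,
        cotwistEquiv_dmk]
    | hadd v w hv hw => simp only [map_add, hv, hw]
  exact hf w

end Mult

/-! ### The twisted pairing of a product -/

section PairProd

variable {k B Λ L : Type u} [Field k] [Ring B] [Algebra k B] [Ring Λ] [Algebra k Λ]
  [Ring L] [Algebra k L] {H : LeftBialgebroid k B Λ} {K : LeftBialgebroid k B L}
  {p : Λ →ₗ[k] L →ₗ[k] B} {F : H.Diamond}
  (hp : IsDualPairing H K p) (hK : K.IsLeftHopf)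

/-- `(α ◇ β, y) ↦ \bar{⟨β | y⟩} α`. -/
def contractSecond : H.Diamond →ₗ[k] L →ₗ[k] Λ :=
  H.dlift (LinearMap.mk₂ k (fun α β => LinearMap.mulRight k α ∘ₗ H.t ∘ₗ p β)
    (by intros; ext; simp [mul_add]) (by intros; ext; simp) (by intros; ext; simp [add_mul])
    (by intros; ext; simp))
    (fun b α β => by
      ext y
      simp [hp.balanced.s_left, H.t_mul, mul_assoc])

theorem contractSecond_dmk (α β : Λ) (y : L) :
    contractSecond hp (H.dmk α β) y = H.t (p β y) * α := rfl

theorem contractSecond_balanced : IsBalanced H.toBeRing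
    (tensorAct H (dmk_isTensor H.toBeRing)) (ract hp hK) (contractSecond hp) := by
  intro b w y
  rw [tensorAct_dmk, comulAct_t_eq, ract_s]
  induction w using BeRing.dind with
  | hmk α β =>
    rw [BeRing.rightT_dmk, contractSecond_dmk, contractSecond_dmk, hp.balanced.t_left]
  | hadd v w hv hw => simp only [map_add, LinearMap.add_apply, hv, hw]

theorem contractSecond_equivariant : IsEquivariant H (tensorAct H (dmk_isTensor H.toBeRing))
    (ract hp hK) (Algebra.lsmul k k Λ) (contractSecond hp) :=
  (dmk_isTensor H.toBeRing).equivariant_of_assoc (contractSecond_balanced hp hK)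
    (pairing_equivariant hp hK) (rightBase_equivariant H (Algebra.lsmul k k Λ)) (fun _ _ _ => rfl)

theorem contractSecond_act (w : H.Diamond) (α β : Λ) (y : L) :
    contractSecond hp (H.act w α β) y = contractSecond hp w (lact hp β y) * α := by
  induction w using BeRing.dind with
  | hmk a b =>
    rw [BeRing.act_dmk, contractSecond_dmk, contractSecond_dmk, smul_eq_mul, smul_eq_mul,
      pairing_mul hp b β, mul_assoc]
  | hadd v w hv hw => simp only [map_add, LinearMap.add_apply, add_mul, hv, hw]

/-- `(α, y) ↦ \bar{⟨α₂ | y⟩} α₁`. -/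
def contractComul : Λ →ₗ[k] L →ₗ[k] Λ := contractSecond hp ∘ₗ H.comul

theorem contractComul_balanced :
    IsBalanced H.toBeRing (Algebra.lsmul k k Λ) (ract hp hK) (contractComul hp) := by
  intro b α y
  refine Eq.trans ?_ (contractSecond_balanced hp hK b (H.comul α) y)
  rw [tensorAct_dmk]
  exact congrArg (contractSecond hp · y) (H.comul_mul (H.t b) α)

theorem contractComul_ev (T : H.Diamond) (α : Λ) (y : L) :
    (contractComul_balanced hp hK).ev T α y =
      (contractSecond_balanced hp hK).ev T (H.comul α) y :=
  (contractComul_balanced hp hK).ev_map (contractSecond_balanced hp hK) H.comul id LinearMap.id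
    (fun x α => by rw [tensorAct_dmk]; exact H.comul_mul x α) (fun _ _ => rfl) (fun _ _ => rfl)
    T α y

theorem contractComul_equivariant : IsEquivariant H (Algebra.lsmul k k Λ) (ract hp hK)
    (Algebra.lsmul k k Λ) (contractComul hp) := by
  refine ⟨contractComul_balanced hp hK, fun γ α y => ?_⟩
  rw [contractComul_ev]
  exact (contractSecond_equivariant hp hK).map_act γ (H.comul α) y

/-- The second axiom of a dual pairing, in terms of `contractComul`. -/
theorem pairing_mul_right (α : Λ) (x y : L) : p α (x * y) = p (contractComul hp α y) x := by
  rw [hp.mul_right']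
  change _ = p (contractSecond hp (H.comul α) y) x
  induction H.comul α using BeRing.dind with
  | hmk a b => rfl
  | hadd v w hv hw => simp only [map_add, LinearMap.add_apply, hv, hw]

variable (hF : H.IsTwoCocycle F)
include hF

theorem twistPair_rightTwist (α : Λ) (x y : L) :
    twistPair hp hK F α (rightTwist hp hK F x y) =
      twistPair hp hK F ((contractComul_balanced hp hK).ev F α y) x :=
  (IsEquivariant.ev_assoc hF (contractComul_equivariant hp hK) (pairing_equivariant hp hK).bal
    (ract_mul_equivariant hp hK) (pairing_equivariant hp hK).bal
    (fun α y x => (pairing_mul_right hp α x y).symm) α y x).symm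

theorem twistPair_twistProd (α : Λ) (x y : L) :
    twistPair hp hK F α (twistProd hp hK F x y) =
      twistPair hp hK F ((contractSecond_balanced hp hK).ev F (H.comulAct α F) y) x := by
  obtain ⟨n, a, b, e⟩ := BeRing.exists_sum F
  have h : ∀ γ, H.comulAct γ F = ∑ i, H.act (H.comul γ) (a i) (b i) := fun γ => by
    rw [e, map_sum]
    rfl
  have h' : (contractSecond_balanced hp hK).ev F (H.comulAct α F) y =
      ∑ i, (contractComul_balanced hp hK).ev F α (lact hp (b i) y) * a i := by
    rw [IsBalanced.ev_sum _ e]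
    simp only [(contractComul_balanced hp hK).ev_sum e, Finset.sum_mul]
    rw [Finset.sum_comm]
    refine Finset.sum_congr rfl fun i _ => ?_
    rw [tensorAct_dmk, ← comulAct_mul, h, map_sum, LinearMap.sum_apply]
    refine Finset.sum_congr rfl fun j _ => ?_
    rw [contractSecond_act, lact_ract_comm]
    rfl
  rw [h', twistProd, IsBalanced.ev_sum _ e, map_sum, map_sum, LinearMap.sum_apply]
  refine Finset.sum_congr rfl fun i _ => ?_
  rw [twistPair_rightTwist hp hK hF, twistPair_mul]

/-- `t^F([β | y]) α` is a function of the image of `α ◇ β` in `Λ ◇_B Λ`, so `twistPair_twistProd` is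
the second axiom for the twisted pairing. -/
theorem twistT_twistPair_mul (α β : Λ) (y : L) :
    H.twistT F (twistPair hp hK F β y) * α =
      (contractSecond_balanced hp hK).ev F (H.act F α β) y := by
  have h := IsEquivariant.ev_assoc hF (dmk_isTensor H.toBeRing).isEquivariant
    (contractSecond_balanced hp hK) (pairing_equivariant hp hK)
    (rightBase_balanced H (Algebra.lsmul k k Λ)) (fun _ _ _ => rfl) α β y
  rw [rightBase_ev, ← act_eq_ev] at h
  exact h.symm

theorem twistPair_one_twistProd (x y : L) : twistPair hp hK F 1 (twistProd hp hK F x y) =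
    twistPair hp hK F (H.twistT F (twistPair hp hK F 1 y)) x := by
  rw [twistPair_twistProd hp hK hF, comulAct_one]
  have h := twistT_twistPair_mul hp hK hF 1 1 y
  rw [mul_one, act_one_one] at h
  rw [h]

end PairProd

/-! ### The cotwisted bialgebroid and its pairing with Xu's twist -/

section Final

variable {k B Λ L : Type u} [Field k] [Ring B] [Algebra k B] [Ring Λ] [Algebra k Λ]
  [Ring L] [Algebra k L] {H : LeftBialgebroid k B Λ} {K : LeftBialgebroid k B L}
  {p : Λ →ₗ[k] L →ₗ[k] B}

theorem IsBalancedPairing.evalMul_eq (hp : IsBalancedPairing H K p) (x y : L) (w : H.Diamond) :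
    hp.evalMul x y w = hp.evalMul' x y w :=
  BeRing.dext_apply (fun α β => (hp.t_left (p β y) α x).symm) w

theorem IsBalancedPairing.evalComul_eq (hp : IsBalancedPairing H K p) (α β : Λ) (w : K.Diamond) :
    hp.evalComul α β w = hp.evalComul' α β w :=
  BeRing.dext_apply (fun x y => hp.s_right (p β x) α y) w

variable {F : H.Diamond} (hp : IsDualPairing H K p) (hK : K.IsLeftHopf)
  (hF : H.IsTwoCocycle F) (hFinv : H.IsInvertible F)

theorem cotwist_counitLeft (T : (cotwistBeRing hp hK hF).Diamond) :
    (cotwistComulData hp hK hF hFinv).counitLeft T = toCotwist hp hK hF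
      ((contractLeft_balanced hp hK).ev F 1 (cotwistEquiv hp hK hF hFinv T)) := by
  let f : (cotwistBeRing hp hK hF).Diamond →ₗ[k] Cotwist hp hK hF :=
    (cotwistComulData hp hK hF hFinv).counitLeft
  have hf : ∀ T, f T = toCotwist hp hK hF
      ((contractLeft_balanced hp hK).ev F 1 (cotwistEquiv hp hK hF hFinv T)) := fun T => by
    induction T using cotwist_dind with
    | hmk x y =>
      change toCotwist hp hK hF (twistProd hp hK F (K.s (twistPair hp hK F 1 x)) y) = _
      rw [twistProd_s_left hp hK hF, lact_twistS_twistPair hp hK hF, cotwistEquiv_dmk]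
    | hadd v w hv hw => simp only [map_add, hv, hw]
  exact hf T

theorem cotwist_counitRight (T : (cotwistBeRing hp hK hF).Diamond) {n : ℕ} {a b : Fin n → Λ}
    (e : F = ∑ i, H.dmk (a i) (b i)) :
    (cotwistComulData hp hK hF hFinv).counitRight T = toCotwist hp hK hF
      (∑ i, K.counitRight (tensorAct H (comul_isTensor hp hK) (a i)
        (ractRight hp hK (b i) (cotwistEquiv hp hK hF hFinv T)))) := by
  let f : (cotwistBeRing hp hK hF).Diamond →ₗ[k] Cotwist hp hK hF :=
    (cotwistComulData hp hK hF hFinv).counitRight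
  have hf : ∀ T, f T = toCotwist hp hK hF
      (∑ i, K.counitRight (tensorAct H (comul_isTensor hp hK) (a i)
        (ractRight hp hK (b i) (cotwistEquiv hp hK hF hFinv T)))) := fun T => by
    induction T using cotwist_dind with
    | hmk x y =>
      change toCotwist hp hK hF (twistProd hp hK F (K.t (twistPair hp hK F 1 y)) x) = _
      rw [twistProd_t_left hp hK hF, ract_twistT_twistPair hp hK hF e, cotwistEquiv_dmk]
    | hadd v w hv hw => simp only [map_add, Finset.sum_add_distrib, hv, hw]
  exact hf T

/-- The cotwist `L^Γ`. -/
noncomputable def cotwist : LeftBialgebroid k (TwistBase hF) (Cotwist hp hK hF) where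
  toComulData := cotwistComulData hp hK hF hFinv
  coassoc := fun x => by
    obtain ⟨x, rfl⟩ := (toCotwist hp hK hF).surjective x
    apply (cotwistEquiv₃ hp hK hF hFinv).injective
    refine (cotwistEquiv₃_comulLeft hp hK hF hFinv _).trans ?_
    refine Eq.trans ?_ (cotwistEquiv₃_comulRight hp hK hF hFinv _).symm
    change K.comulLeft (cotwistEquiv hp hK hF hFinv (cotwistComul hp hK hF hFinv _)) =
      K.comulRight (cotwistEquiv hp hK hF hFinv (cotwistComul hp hK hF hFinv _))
    rw [cotwistEquiv_comul, K.coassoc]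
  counit_comul_left := fun x => by
    obtain ⟨x, rfl⟩ := (toCotwist hp hK hF).surjective x
    refine (cotwist_counitLeft hp hK hF hFinv _).trans (congrArg _ ?_)
    change (contractLeft_balanced hp hK).ev F 1
      (cotwistEquiv hp hK hF hFinv (cotwistComul hp hK hF hFinv _)) = x
    rw [cotwistEquiv_comul, contractLeft_ev_comul hp hK hF, map_one, Module.End.one_apply]
  counit_comul_right := fun x => by
    obtain ⟨x, rfl⟩ := (toCotwist hp hK hF).surjective x
    obtain ⟨n, a, b, e⟩ := BeRing.exists_sum F
    refine (cotwist_counitRight hp hK hF hFinv _ e).trans (congrArg _ ?_)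
    refine Eq.trans ?_ (sum_counitRight_tensorAct_comul hp hK hF e x)
    refine Finset.sum_congr rfl fun i _ => ?_
    exact congrArg (fun w => K.counitRight (tensorAct H (comul_isTensor hp hK) (a i)
      (ractRight hp hK (b i) w))) (cotwistEquiv_comul hp hK hF hFinv x)
  comul_one := by
    apply (cotwistEquiv hp hK hF hFinv).injective
    refine (cotwistEquiv_comul hp hK hF hFinv 1).trans ?_
    refine Eq.trans ?_ (cotwistEquiv_dmk hp hK hF hFinv 1 1).symm
    rw [K.comul_one, twistDmk_one hp hK hF]
  comul_mul := fun x y => by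
    obtain ⟨x, rfl⟩ := (toCotwist hp hK hF).surjective x
    obtain ⟨y, rfl⟩ := (toCotwist hp hK hF).surjective y
    apply (cotwistEquiv hp hK hF hFinv).injective
    refine Eq.trans ?_ (cotwistEquiv_comulAct hp hK hF hFinv x _).symm
    refine (cotwistEquiv_comul hp hK hF hFinv (twistProd hp hK F x y)).trans ?_
    rw [comul_twistProd]
    exact congrArg _ (cotwistEquiv_comul hp hK hF hFinv y).symm
  counit_one := congrArg (toTwistBase hF)
    ((twistPair_one_right hp hK hF 1).trans H.counit_one)
  counit_mul_s := fun x y => by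
    obtain ⟨x, rfl⟩ := (toCotwist hp hK hF).surjective x
    obtain ⟨y, rfl⟩ := (toCotwist hp hK hF).surjective y
    change toTwistBase hF (twistPair hp hK F 1 (twistProd hp hK F x y)) = toTwistBase hF
      (twistPair hp hK F 1 (twistProd hp hK F x (K.s (twistPair hp hK F 1 y))))
    rw [twistPair_one_twistProd hp hK hF, twistPair_mul_s hp hK hF, one_mul]
  counit_mul_t := fun x y => by
    obtain ⟨x, rfl⟩ := (toCotwist hp hK hF).surjective x
    obtain ⟨y, rfl⟩ := (toCotwist hp hK hF).surjective y
    change toTwistBase hF (twistPair hp hK F 1 (twistProd hp hK F x y)) = toTwistBase hF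
      (twistPair hp hK F 1 (twistProd hp hK F x (K.t (twistPair hp hK F 1 y))))
    rw [twistPair_one_twistProd hp hK hF, twistPair_mul_t hp hK hF, mul_one]

theorem cotwist_isCotwist : IsCotwist K hK (hp.dualCochain F) (toTwistBase hF)
    (toCotwist hp hK hF) (cotwist hp hK hF hFinv) where
  base_mul := fun a b => (toTwistBase_mul hF a b).trans (congrArg _ (form_s hp a b).symm)
  base_one := rfl
  mul := fun x y => (toCotwist_mul hp hK hF x y).trans
    (congrArg _ (dualCochain_cotwistMul hp hK x y).symm)
  one := rfl
  source := fun _ => rfl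
  target := fun _ => rfl
  counit := fun x => congrArg (toTwistBase hF) (dualCochain_cotwistCounit hp hK x).symm
  sharp_iso := by
    have h₁ : (fun b : B => (hp.dualCochain F).cotwistMul hK (K.t b)) =
        fun b => ract hp hK (H.twistT F b) := funext fun b => LinearMap.ext fun x => by
      rw [dualCochain_cotwistMul, twistProd_t_left hp hK hF]
    have h₂ : (fun b : B => (hp.dualCochain F).cotwistMul hK (K.s b)) =
        fun b => lact hp (H.twistS F b) := funext fun b => LinearMap.ext fun x => by
      rw [dualCochain_cotwistMul, twistProd_s_left hp hK hF]
    rw [h₁, h₂, dualCochain_sharp]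
    exact (comul_isTensor hp hK).twist hFinv
  comul := fun x z hz => by
    rw [← cotwistEquiv_lift hp hK hF hFinv]
    exact (congrArg (cotwistEquiv hp hK hF hFinv) hz).trans (cotwistEquiv_comul hp hK hF hFinv x)

theorem cotwistPair_balanced : IsBalancedPairing (xuTwist hF hFinv) (cotwist hp hK hF hFinv)
    (cotwistPair hp hK hF) := by
  intro a b c d f α x
  obtain ⟨a, rfl⟩ := (toTwistBase hF).surjective a
  obtain ⟨b, rfl⟩ := (toTwistBase hF).surjective b
  obtain ⟨c, rfl⟩ := (toTwistBase hF).surjective c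
  obtain ⟨d, rfl⟩ := (toTwistBase hF).surjective d
  obtain ⟨f, rfl⟩ := (toTwistBase hF).surjective f
  obtain ⟨x, rfl⟩ := (toCotwist hp hK hF).surjective x
  change cotwistPair hp hK hF ((xuBeRing hF).s (toTwistBase hF a) *
      (xuBeRing hF).t (toTwistBase hF b) * α * (xuBeRing hF).s (toTwistBase hF c) *
      (xuBeRing hF).t (toTwistBase hF d)) (toCotwist hp hK hF x) * toTwistBase hF f =
    toTwistBase hF a * cotwistPair hp hK hF α (toCotwist hp hK hF (K.s c) *
      toCotwist hp hK hF (K.t f) * toCotwist hp hK hF x * toCotwist hp hK hF (K.s d) *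
      toCotwist hp hK hF (K.t b))
  simp only [xuBeRing_s, xuBeRing_t, cotwistPair_apply, toTwistBase_mul, toCotwist_mul]
  rw [twistPair_mul_t hp hK hF, twistPair_mul_s hp hK hF, twistProd_assoc hp hK hF,
    twistPair_s_mul hp hK hF, twistPair_t_mul hp hK hF, ← twistBaseMul_assoc hF,
    ← twistPair_twistS hp hK hF]
  simp only [mul_assoc, twistS_twistT_comm hF]
  rw [← mul_assoc (H.twistS F a) (H.twistT F b), twistS_twistT_comm hF, mul_assoc]

theorem cotwistPair_isDualPairing : IsDualPairing (xuTwist hF hFinv) (cotwist hp hK hF hFinv)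
    (cotwistPair hp hK hF) := by
  have hb := cotwistPair_balanced hp hK hF hFinv
  have hm : ∀ α x y, cotwistPair hp hK hF α (x * y) =
      hb.evalMul' x y ((xuTwist hF hFinv).comul α) := fun α x y => by
    obtain ⟨x, rfl⟩ := (toCotwist hp hK hF).surjective x
    obtain ⟨y, rfl⟩ := (toCotwist hp hK hF).surjective y
    let f : (xuBeRing hF).Diamond →ₗ[k] TwistBase hF :=
      hb.evalMul' (toCotwist hp hK hF x) (toCotwist hp hK hF y)
    have hf : ∀ w, f w = toTwistBase hF (twistPair hp hK F
        ((contractSecond_balanced hp hK).ev F (xuEquiv hF hFinv w) y) x) := fun w => by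
      induction w using BeRing.dind with
      | hmk α β =>
        change cotwistPair hp hK hF ((xuBeRing hF).t (toTwistBase hF (twistPair hp hK F β y)) * α)
          (toCotwist hp hK hF x) = _
        rw [xuBeRing_t, twistT_twistPair_mul hp hK hF, cotwistPair_apply, xuEquiv_dmk]
      | hadd v w hv hw => simp only [map_add, LinearMap.add_apply, hv, hw]
    refine Eq.trans ?_ (hf (xuComul hF hFinv α)).symm
    rw [toCotwist_mul, cotwistPair_apply, twistPair_twistProd hp hK hF, xuEquiv_comul]
  have hc : ∀ α β x, cotwistPair hp hK hF (α * β) x =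
      hb.evalComul' α β ((cotwist hp hK hF hFinv).comul x) := fun α β x => by
    obtain ⟨x, rfl⟩ := (toCotwist hp hK hF).surjective x
    let f : (cotwistBeRing hp hK hF).Diamond →ₗ[k] TwistBase hF := hb.evalComul' α β
    have hf : ∀ w, f w = toTwistBase hF (twistPair hp hK F α
        ((contractLeft_balanced hp hK).ev F β (cotwistEquiv hp hK hF hFinv w))) := fun w => by
      induction w using cotwist_dind with
      | hmk x y =>
        change toTwistBase hF (twistPair hp hK F α
          (twistProd hp hK F (K.s (twistPair hp hK F β x)) y)) = _
        rw [twistProd_s_left hp hK hF, lact_twistS_twistPair hp hK hF, cotwistEquiv_dmk]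
      | hadd v w hv hw => simp only [map_add, hv, hw]
    refine Eq.trans ?_ (hf (cotwistComul hp hK hF hFinv (toCotwist hp hK hF x))).symm
    rw [cotwistEquiv_comul, contractLeft_ev_comul hp hK hF, ← twistPair_mul]
    rfl
  exact
  { balanced := hb
    mul_right := fun α x y => (hm α x y).trans (hb.evalMul_eq x y _).symm
    mul_right' := hm
    mul_left := fun α β x => (hc α β x).trans (hb.evalComul_eq α β _).symm
    mul_left' := hc
    one_right := fun α => congrArg (toTwistBase hF) (twistPair_one_right hp hK hF α)
    one_left := fun _ => rfl }

end Final

end Bialgd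

theorem mainTheorem2 {k B Λ L : Type u} [Field k] [Ring B] [Algebra k B]
    [Ring Λ] [Algebra k Λ] [Ring L] [Algebra k L]
    (H : Bialgd.LeftBialgebroid k B Λ) (K : Bialgd.LeftBialgebroid k B L)
    (hK : K.IsLeftHopf)
    (p : Λ →ₗ[k] L →ₗ[k] B) (hp : Bialgd.IsDualPairing H K p)
    (F : H.Diamond) (hF : H.IsTwoCocycle F) (hFinv : H.IsInvertible F) :
    (hp.dualCochain F).IsTwoCocycle ∧
    ∃ (B' L' : Type u) (_ : Ring B') (_ : Algebra k B') (_ : Ring L') (_ : Algebra k L')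
      (e : B ≃ₗ[k] B') (f : L ≃ₗ[k] L')
      (HF : Bialgd.LeftBialgebroid k B' Λ) (KΓ : Bialgd.LeftBialgebroid k B' L')
      (q : Λ →ₗ[k] L' →ₗ[k] B'),
      Bialgd.IsXuTwist H F e HF ∧
      Bialgd.IsCotwist K hK (hp.dualCochain F) e f KΓ ∧
      (∀ (α : Λ) (x : L), q α (f x) = e (hp.twisted F hK α x)) ∧
      Bialgd.IsDualPairing HF KΓ q :=
  ⟨Bialgd.dualCochain_isTwoCocycle hp hF, Bialgd.TwistBase hF, Bialgd.Cotwist hp hK hF,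
    inferInstance, inferInstance, inferInstance, inferInstance, Bialgd.toTwistBase hF,
    Bialgd.toCotwist hp hK hF, Bialgd.xuTwist hF hFinv, Bialgd.cotwist hp hK hF hFinv,
    Bialgd.cotwistPair hp hK hF, Bialgd.xuTwist_isXuTwist hF hFinv,
    Bialgd.cotwist_isCotwist hp hK hF hFinv,
    fun α x => congrArg (Bialgd.toTwistBase hF) (Bialgd.twisted_eq hp hK α x).symm,
    Bialgd.cotwistPair_isDualPairing hp hK hF hFinv⟩
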